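/- **Notation.** Let $e>2$ and $d>1$ be integers. For a partition $\lambda=(\lambda_1\ge\dots\ge\lambda_t>0)$ with Young diagram $Y(\lambda)=\{(i,j):1\le i\le t,\ 1\le j\le\lambda_i\}$, the rim hook at $(i,j)\in Y(\lambda)$ is $R_{i,j}=\{(i',j')\in Y(\lambda): i'\ge i,\ j'\ge j,\ (i'+1,j'+1)\notin Y(\lambda)\}$; its arm length is $\lambda_i-j$. The rim of $\lambda$ is $R_{1,1}$, and $\lambda'$ denotes the conjugate partition. An $e$-hook is a rim hook of size $e$, and an $e$-core is a partition without $e$-hooks. Removing $e$-hooks from $\lambda$ one after the other until none is left yields the $e$-core of $\lambda$; the number of removed $e$-hooks is the $e$-weight of $\lambda$. The partition $\lambda$ is $e$-regular if no $e$ of its parts are equal, and $d$-balanced if $d$ divides the arm length of every rim hook of $\lambda$ of size divisible by $e$. The $d$-runner matrix of $\lambda$ is the $(d-1)\times e$ matrix, indexed by $1\le x\le d-1$ and $0\le y\le e-1$, whose $(x,y)$ entry is the number of indices $i$ such that $\lambda_i\equiv x \pmod d$ and $\lambda_i\equiv i+y\pmod e$. The dominance order on partitions of the same size is given by $\mu\unlhd\lambda$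 if $\sum_{j\le i}\mu_j\le\sum_{j\le i}\lambda_j$ for all $i$. For an $e$-core $\gamma$ and a $(d-1)\times e$ matrix $\mathcal R$ of non-negative integers, let $E_{\mathcal R}(\gamma)$ be the set of the partitions with $e$-core $\gamma$ and $d$-runner matrix $\mathcal R$ that have the minimal $e$-weight among all such partitions. The Mullineux map $m_e$ on $e$-regular partitions is defined as follows. The $e$-rim of $\lambda$ is the subset of its rim obtained by traversing the rim from $(1,\lambda_1)$ downwards, repeatedly taking the next $e$ boxes (or all remaining ones, if there are fewer) and then moving to the rightmost box of the next row, until there is no next row. Put $\lambda^{(1)}=\lambda$, let $\lambda^{(k+1)}$ be $\lambda^{(k)}$ with its $e$-rim removed, and let $a_k$ be the size of the $e$-rim and $r_k$ the number of parts of $\lambda^{(k)}$, as long as $\lambda^{(k)}\neq\varnothing$. Then $m_e(\lambda)$ is the unique $e$-regular partition for which the corresponding numbers are $a_k$ and $a_k+\varepsilon_k-r_k$, where $\varepsilon_k=0$ if $e\mid a_k$ and $\varepsilon_k=1$ otherwise. (For $e$ prime, it describes the tensor product of the irreducible modules of symmetric groups in characteristic $e$ with the sign: $D^\lambda\otimes\mathrm{sgn}\cong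 D^{m_e(\lambda)}$.) **Theorem.** Let $1<d<e$ be coprime integers, let $\gamma$ be an $e$-core partition and let $\mathcal R$ be a $(d-1)\times e$ matrix of non-negative integers with at least one $0$ in its first row. Then the set $E_{\mathcal R}(\gamma)$ has a unique maximal element $\lambda$ in the dominance order. Moreover, if $\lambda$ is $d$-balanced, then $\lambda$ is $e$-regular (so that $m_e(\lambda)$ is defined; that is, there is exactly one partition as in the definition of $m_e(\lambda)$), and $m_e(\lambda)'$ is the unique minimal element of $E_{\mathcal R}(\gamma)$ in the dominance order. -/

import Mathlib

/- Partitions are Mathlib's `YoungDiagram`s.  Boxes, rows and columns are indexed from `0`, so the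
box `(i, j)` of a diagram is the box `(i + 1, j + 1)` of the usual convention, and
`μ.rowLen i` is the `(i + 1)`-st part of the partition. -/

namespace Mullineux

/-- The rim hook of `μ` at the box `c`: the boxes of the rim of `μ` that lie weakly below and
weakly to the right of `c`. -/
def rimHook (μ : YoungDiagram) (c : ℕ × ℕ) : Finset (ℕ × ℕ) :=
  μ.cells.filter fun b => c.1 ≤ b.1 ∧ c.2 ≤ b.2 ∧ (b.1 + 1, b.2 + 1) ∉ μ

/-- The arm length of the rim hook of `μ` at the box `c ∈ μ`. -/
def armLength (μ : YoungDiagram) (c : ℕ × ℕ) : ℕ :=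
  μ.rowLen c.1 - (c.2 + 1)

/-- `μ` is `d`-balanced (with respect to `e`): the arm length of every rim hook of size divisible
by `e` is divisible by `d`. -/
def IsBalanced (d e : ℕ) (μ : YoungDiagram) : Prop :=
  ∀ c ∈ μ.cells, e ∣ (rimHook μ c).card → armLength μ c ≡ 0 [MOD d]

/-- `μ` is `e`-regular: no `e` of its parts are equal. -/
def IsRegular (e : ℕ) (μ : YoungDiagram) : Prop :=
  ∀ p, μ.rowLens.count p < e

/-- `μ` is an `e`-core: it has no rim hook of size `e`. -/
def IsCore (e : ℕ) (μ : YoungDiagram) : Prop :=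
  ∀ c ∈ μ.cells, (rimHook μ c).card ≠ e

/-- `Removes e w μ ν`: one can get from `μ` to `ν` by removing `w` rim hooks of size `e`,
one after the other. -/
inductive Removes (e : ℕ) : ℕ → YoungDiagram → YoungDiagram → Prop
  | refl (μ : YoungDiagram) : Removes e 0 μ μ
  | step {w : ℕ} {μ ν ρ : YoungDiagram} (c : ℕ × ℕ) (hc : c ∈ μ.cells)
      (hsize : (rimHook μ c).card = e) (hν : ν.cells = μ.cells \ rimHook μ c)
      (h : Removes e w ν ρ) : Removes e (w + 1) μ ρ

/-- `μ` has `e`-core `γ` and `e`-weight `w`. -/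
def HasCoreWeight (e : ℕ) (μ γ : YoungDiagram) (w : ℕ) : Prop :=
  IsCore e γ ∧ Removes e w μ γ

/-- The `d`-runner matrix of `μ`.  Its row with index `x : Fin (d - 1)` is the row `x + 1` of the
usual convention `1 ≤ x ≤ d - 1`; the index `i` (from `0`) stands for the part number `i + 1`. -/
def runnerMatrix (d e : ℕ) (μ : YoungDiagram) : Matrix (Fin (d - 1)) (Fin e) ℕ :=
  fun x y => ((Finset.range (μ.colLen 0)).filter fun i =>
    μ.rowLen i ≡ (x : ℕ) + 1 [MOD d] ∧ μ.rowLen i ≡ (i + 1) + (y : ℕ) [MOD e]).card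

/-- The minimal `e`-weight of a partition with `e`-core `γ` and `d`-runner matrix `R`. -/
noncomputable def minWeight (d e : ℕ) (γ : YoungDiagram)
    (R : Matrix (Fin (d - 1)) (Fin e) ℕ) : ℕ :=
  sInf {w | ∃ μ, HasCoreWeight e μ γ w ∧ runnerMatrix d e μ = R}

/-- The set of partitions with `e`-core `γ`, `d`-runner matrix `R` and minimal `e`-weight. -/
def minimalSet (d e : ℕ) (γ : YoungDiagram) (R : Matrix (Fin (d - 1)) (Fin e) ℕ) :
    Set YoungDiagram :=
  {μ | HasCoreWeight e μ γ (minWeight d e γ R) ∧ runnerMatrix d e μ = R}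

/-- The dominance order: `DominatedBy μ ν` means that `μ ⊴ ν`. -/
def DominatedBy (μ ν : YoungDiagram) : Prop :=
  μ.card = ν.card ∧
    ∀ k, ∑ i ∈ Finset.range k, μ.rowLen i ≤ ∑ i ∈ Finset.range k, ν.rowLen i

/-- `μ` is a maximal element of `E` in the dominance order. -/
def IsDomMaximal (E : Set YoungDiagram) (μ : YoungDiagram) : Prop :=
  μ ∈ E ∧ ∀ ν ∈ E, DominatedBy μ ν → ν = μ

/-- `μ` is a minimal element of `E` in the dominance order. -/
def IsDomMinimal (E : Set YoungDiagram) (μ : YoungDiagram) : Prop :=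
  μ ∈ E ∧ ∀ ν ∈ E, DominatedBy ν μ → ν = μ

/-- `μ` is the unique maximal element of `E` in the dominance order. -/
def IsUniqueDomMaximal (E : Set YoungDiagram) (μ : YoungDiagram) : Prop :=
  IsDomMaximal E μ ∧ ∀ ν, IsDomMaximal E ν → ν = μ

/-- `μ` is the unique minimal element of `E` in the dominance order. -/
def IsUniqueDomMinimal (E : Set YoungDiagram) (μ : YoungDiagram) : Prop :=
  IsDomMinimal E μ ∧ ∀ ν, IsDomMinimal E ν → ν = μ

/-- The rim of `μ` is traversed from the top right to the bottom left; the content `j - i` of the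
box `(i, j)` drops by one at every step.  `segment e μ s` consists of the next `e` boxes of the
rim (or of all the remaining ones, if there are fewer), starting from the rightmost box
`(s, μ.rowLen s - 1)` of row `s`.  These are the boxes of the rim whose content is at most
`μ.rowLen s - 1 - s` and greater than `μ.rowLen s - 1 - s - e`. -/
def segment (e : ℕ) (μ : YoungDiagram) (s : ℕ) : Finset (ℕ × ℕ) :=
  (rimHook μ (0, 0)).filter fun b =>
    (b.2 : ℤ) - b.1 ≤ (μ.rowLen s : ℤ) - 1 - s ∧ (μ.rowLen s : ℤ) - 1 - s - e < (b.2 : ℤ) - b.1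

/-- The row in which the `k`-th segment of the `e`-rim of `μ` starts: the first segment starts in
the first row, and every other one in the row just below the last row of the segment before. -/
def segmentStart (e : ℕ) (μ : YoungDiagram) : ℕ → ℕ
  | 0 => 0
  | k + 1 => max (segmentStart e μ k) ((segment e μ (segmentStart e μ k)).sup Prod.fst) + 1

/-- The `e`-rim of `μ`: the union of its segments.  (Segments starting below the last row are
empty.) -/
def eRim (e : ℕ) (μ : YoungDiagram) : Finset (ℕ × ℕ) :=
  (Finset.range (μ.colLen 0)).biUnion fun k => segment e μ (segmentStart e μ k)

/-- `IsSymbol e μ l`: the Mullineux symbol of `μ` is `l`, the list of the pairs `(a, r)` where `a`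
is the size of the `e`-rim and `r` is the number of rows of the partitions `μ = μ⁰, μ¹, …`, each
arising from the one before by removing the `e`-rim, until the empty partition is reached. -/
inductive IsSymbol (e : ℕ) : YoungDiagram → List (ℕ × ℕ) → Prop
  | nil : IsSymbol e ⊥ []
  | cons {μ ν : YoungDiagram} {l : List (ℕ × ℕ)} (hμ : μ ≠ ⊥)
      (hν : ν.cells = μ.cells \ eRim e μ) (h : IsSymbol e ν l) :
      IsSymbol e μ (((eRim e μ).card, μ.colLen 0) :: l)

/-- The dual of a Mullineux symbol: `(a, r)` becomes `(a, a + ε - r)`, where `ε` is `0` if `e`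
divides `a` and `1` otherwise.  (In a symbol `r ≤ a`, as the `e`-rim meets every row.) -/
def dualSymbol (e : ℕ) (l : List (ℕ × ℕ)) : List (ℕ × ℕ) :=
  l.map fun p => (p.1, p.1 + (if e ∣ p.1 then 0 else 1) - p.2)

/-- `ν` is the image of the `e`-regular partition `μ` under the Mullineux map: it is an `e`-regular
partition whose Mullineux symbol is the dual of that of `μ`. -/
def IsMullineuxImage (e : ℕ) (μ ν : YoungDiagram) : Prop :=
  IsRegular e μ ∧ IsRegular e ν ∧ ∃ l, IsSymbol e μ l ∧ IsSymbol e ν (dualSymbol e l)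

open Classical in
/-- The Mullineux map `m_e` (with the value `⊥` where there is no image). -/
noncomputable def mullineuxMap (e : ℕ) (μ : YoungDiagram) : YoungDiagram :=
  if h : ∃ ν, IsMullineuxImage e μ ν then h.choose else ⊥

end Mullineux

/-!
A partition `μ` is encoded by its boundary path, as a profile `h : ℤ → ℤ` (`prof`): at every
position `p` the profile either stays constant (a bead, which stands for a row) or increases by one
(a gap, which stands for a column).  The boxes of `μ` are the pairs of a gap `p` and a bead `q > p`;
the rim hook of such a box has size `q - p` and arm length `h q - h p - 1`.  The vertex of the path
at `p` is the pair `(h p mod d, p mod e)`; its first entry is the class of `p`, and its second entry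
is the runner of `p`.  The runner matrix counts the beads at the vertices of nonzero class.

**Core and runner matrix.**  For two profiles `h`, `h'`, consider the sums over a runner of
`⌊(h q - x) / d⌋ - ⌊(h' q - x) / d⌋` (`flr`, `rsum`).  They change by differences of bead counts
along diagonal steps of the vertex, and by differences of gap counts along horizontal steps.  As `d`
and `e` are coprime, the two partitions have the same core and the same runner matrix if and only if
these sums do not depend on the vertex (`SameData`), and the weights agree as well if and only if
the sums vanish (`rsum_flr_eq_zero`).

**Extreme elements.**  If a profile takes all beads before all gaps at each vertex (`BeadsFirst`),
the partial sums of the differences above are nonpositive by a maximum principle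
(`BeadsFirst.rsum_flr_nonpos`), so the partition has minimal weight and dominates all the others.
Such a profile is built by a greedy walk (`exists_greedy`, `exists_beadsFirst`).  Dually, a profile
which enters each vertex by beads before it enters it by gaps (`GapsLast`) is the least element.  If
the greatest element is balanced and some runner has no bead of class `1`, a `GapsLast` profile
exists: it is the conjugate of a greedy walk (`exists_gapsLast`).

**Balance of the least element.**  Among partitions with the same core, runner matrix and weight,
the number of hooks of size divisible by `e` with arm length `D - 1` or `-D` modulo `d` is constant
(`pairSum_invariant`).  Hence, if all these hooks of the greatest element have arm length `0`, those
of the least element have arm length `-1` (`antibalanced_of_balanced`).  So the greatest element and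
the conjugate of the least one satisfy the same hook condition for two different gradings
`h p - c * p` of the positions, with `c = 0` and `c = 1` (`SlopeBalanced`), which implies that they
are `e`-regular.  Two such partitions are called mates here.

**Mullineux symbols.**  The `e`-rim is found by a scan of the profile from the top that moves by one
at a gap and by `e` at a bead (`scan`, `mem_rimSet_prof`).  The hook condition determines the
vertices outside of the `e`-rim, namely those of a run of consecutive integers
(`SlopeBalanced.exists_rim_data`).  Comparing these for two mates shows that the `e`-rims have the
same size `a`, that the numbers of rows are `r` and `a + ε - r`, and that what is left after removing
the `e`-rims is again a pair of mates (`rim_pair`).  By induction the Mullineux symbols are dual to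
each other (`exists_dual_symbols`).  Finally, a partition is determined by its symbol, as the scan
can be traced back on what is left (`IsSymbol.injective`), so the Mullineux image is unique.
-/

namespace Mullineux

/-! ### Profiles and sums along runners -/

/-- `h` is the profile of a partition all of whose boxes have content of absolute value less
than `N`: `h p` is the number of gaps to the left of `p` on the abacus of charge `0`.  There is a
bead at `p` if `h (p + 1) = h p`, and a gap if `h (p + 1) = h p + 1`. -/
structure IsProfile (N : ℕ) (h : ℤ → ℤ) : Prop where
  step : ∀ p, h (p + 1) = h p ∨ h (p + 1) = h p + 1
  left : ∀ p, p ≤ -(N : ℤ) → h p = 0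
  right : ∀ p, (N : ℤ) ≤ p → h p = p

theorem IsProfile.weaken {N M : ℕ} {h : ℤ → ℤ} (H : IsProfile N h) (hNM : N ≤ M) :
    IsProfile M h :=
  ⟨H.step, fun p hp => H.left p (by omega), fun p hp => H.right p (by omega)⟩

theorem IsProfile.mono {N : ℕ} {h : ℤ → ℤ} (H : IsProfile N h) : Monotone h :=
  monotone_int_of_le_succ fun p => by rcases H.step p with h | h <;> omega

theorem IsProfile.anti {N : ℕ} {h : ℤ → ℤ} (H : IsProfile N h) :
    Antitone fun p => h p - p :=
  antitone_int_of_succ_le fun p => by rcases H.step p with h | h <;> omega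

/-- The sum of `f` over the integers of `[A, B)` congruent to `y` modulo `e`. -/
noncomputable def rsum (e : ℕ) (A B y : ℤ) (f : ℤ → ℤ) : ℤ :=
  ∑ q ∈ (Finset.Ico A B).filter (fun q => (e : ℤ) ∣ q - y), f q

/-- The indicator of a bead at `q` with `h q ≡ x` modulo `d`. -/
def beadInd (d : ℕ) (h : ℤ → ℤ) (x q : ℤ) : ℤ :=
  if h (q + 1) = h q ∧ (d : ℤ) ∣ h q - x then 1 else 0

/-- The indicator of a gap at `q` with `h q ≡ x` modulo `d`. -/
def gapInd (d : ℕ) (h : ℤ → ℤ) (x q : ℤ) : ℤ :=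
  if h (q + 1) = h q + 1 ∧ (d : ℤ) ∣ h q - x then 1 else 0

/-- The difference of the rounded-down values of two profiles. -/
def flr (d : ℕ) (h h' : ℤ → ℤ) (x q : ℤ) : ℤ := (h q - x) / d - (h' q - x) / d

theorem beadInd_nonneg (d : ℕ) (h : ℤ → ℤ) (x q : ℤ) : 0 ≤ beadInd d h x q := by
  unfold beadInd; split_ifs <;> simp

theorem gapInd_nonneg (d : ℕ) (h : ℤ → ℤ) (x q : ℤ) : 0 ≤ gapInd d h x q := by
  unfold gapInd; split_ifs <;> simp

theorem beadInd_congr {d : ℕ} {h : ℤ → ℤ} {x x' : ℤ} (hx : (d : ℤ) ∣ x - x') (q : ℤ) :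
    beadInd d h x q = beadInd d h x' q := by
  have : ((d : ℤ) ∣ h q - x) ↔ (d : ℤ) ∣ h q - x' := by
    rw [show h q - x' = h q - x + (x - x') by ring, dvd_add_left hx]
  simp only [beadInd, this]

theorem gapInd_congr {d : ℕ} {h : ℤ → ℤ} {x x' : ℤ} (hx : (d : ℤ) ∣ x - x') (q : ℤ) :
    gapInd d h x q = gapInd d h x' q := by
  have : ((d : ℤ) ∣ h q - x) ↔ (d : ℤ) ∣ h q - x' := by
    rw [show h q - x' = h q - x + (x - x') by ring, dvd_add_left hx]
  simp only [gapInd, this]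

theorem add_one_ediv (d : ℕ) (hd : 0 < d) (n : ℤ) :
    (n + 1) / (d : ℤ) = n / d + if (d : ℤ) ∣ n + 1 then 1 else 0 := by
  have hd' : (0 : ℤ) < d := by exact_mod_cast hd
  have h1 := Int.mul_ediv_add_emod n d
  have h2 := Int.emod_nonneg n hd'.ne'
  have h3 := Int.emod_lt_of_pos n hd'
  split_ifs with h
  · obtain ⟨k, hk⟩ := h
    have : n % d = d - 1 := by
      have : n = d - 1 + d * (k - 1) := by linarith
      rw [this, Int.add_mul_emod_self_left]
      exact Int.emod_eq_of_lt (by omega) (by omega)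
    rw [show n + 1 = d * (n / d + 1) by linarith]
    rw [Int.mul_ediv_cancel_left _ hd'.ne']
  · have h4 : n % d + 1 < d := by
      rcases lt_or_eq_of_le (show n % d + 1 ≤ d by omega) with h' | h'
      · exact h'
      · exact absurd ⟨n / d + 1, by linarith⟩ h
    rw [show n + 1 = (n % d + 1) + d * (n / d) by linarith, Int.add_mul_ediv_left _ _ hd'.ne',
      Int.ediv_eq_zero_of_lt (by omega) h4]
    ring

section steps

variable {d N : ℕ} {h h' : ℤ → ℤ}

theorem ediv_diag (hd : 0 < d) (H : IsProfile N h) (x q : ℤ) :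
    (h (q + 1) - (x + 1)) / (d : ℤ) = (h q - x) / d - beadInd d h x q := by
  unfold beadInd
  rcases H.step q with hs | hs
  · have := add_one_ediv d hd (h q - x - 1)
    rw [sub_add_cancel] at this
    rw [hs, this, show h q - (x + 1) = h q - x - 1 by ring]
    split_ifs <;> simp_all
  · rw [hs, show h q + 1 - (x + 1) = h q - x by ring]
    rw [if_neg (by omega)]; simp

theorem ediv_horiz (hd : 0 < d) (H : IsProfile N h) (x q : ℤ) :
    (h (q + 1) - (x + 1)) / (d : ℤ) = (h q - (x + 1)) / d + gapInd d h x q := by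
  unfold gapInd
  rcases H.step q with hs | hs
  · rw [hs, if_neg (by omega)]; simp
  · have := add_one_ediv d hd (h q - x - 1)
    rw [sub_add_cancel] at this
    rw [hs, show h q + 1 - (x + 1) = h q - x by ring, this,
      show h q - (x + 1) = h q - x - 1 by ring]
    split_ifs <;> simp_all

theorem flr_diag (hd : 0 < d) (H : IsProfile N h) (H' : IsProfile N h') (x q : ℤ) :
    flr d h h' (x + 1) (q + 1) = flr d h h' x q - (beadInd d h x q - beadInd d h' x q) := by
  unfold flr
  rw [ediv_diag hd H, ediv_diag hd H']; ring

theorem flr_horiz (hd : 0 < d) (H : IsProfile N h) (H' : IsProfile N h') (x q : ℤ) :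
    flr d h h' (x + 1) (q + 1) = flr d h h' (x + 1) q + (gapInd d h x q - gapInd d h' x q) := by
  unfold flr
  rw [ediv_horiz hd H, ediv_horiz hd H']; ring

theorem flr_left (H : IsProfile N h) (H' : IsProfile N h') {q : ℤ} (hq : q ≤ -(N : ℤ)) (x : ℤ) :
    flr d h h' x q = 0 := by
  simp [flr, H.left q hq, H'.left q hq]

theorem flr_right (H : IsProfile N h) (H' : IsProfile N h') {q : ℤ} (hq : (N : ℤ) ≤ q) (x : ℤ) :
    flr d h h' x q = 0 := by
  simp [flr, H.right q hq, H'.right q hq]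

theorem flr_periodic (hd : 0 < d) (x q : ℤ) : flr d h h' (x + d) q = flr d h h' x q := by
  have hd' : (d : ℤ) ≠ 0 := by exact_mod_cast hd.ne'
  have key : ∀ n : ℤ, (n - (x + d)) / (d : ℤ) = (n - x) / d - 1 := fun n => by
    rw [show n - (x + d) = n - x + d * (-1) by ring, Int.add_mul_ediv_left _ _ hd']; ring
  simp [flr, key]

/-- Hermite's identity for differences. -/
theorem sum_flr (hd : 0 < d) (q : ℤ) :
    ∑ x ∈ Finset.range d, flr d h h' (x : ℤ) q = h q - h' q := by
  have hd' : (d : ℤ) ≠ 0 := by exact_mod_cast hd.ne'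
  have key : ∀ n : ℤ, ∑ x ∈ Finset.range d, (n + 1 - (x : ℤ)) / (d : ℤ) =
      ∑ x ∈ Finset.range d, (n - (x : ℤ)) / (d : ℤ) + 1 := by
    intro n
    obtain ⟨k, rfl⟩ : ∃ k, d = k + 1 := ⟨d - 1, by omega⟩
    rw [Finset.sum_range_succ', Finset.sum_range_succ]
    have h1 : (n + 1 - ((0 : ℕ) : ℤ)) / ((k + 1 : ℕ) : ℤ) = (n - k) / ((k + 1 : ℕ) : ℤ) + 1 := by
      rw [← Int.add_mul_ediv_left _ _ hd']
      congr 1; push_cast; ring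
    rw [h1, ← add_assoc]
    congr 2
    refine Finset.sum_congr rfl fun x _ => ?_
    congr 1; push_cast; ring
  have key2 : ∀ n : ℤ, ∑ x ∈ Finset.range d, (n - (x : ℤ)) / (d : ℤ) =
      ∑ x ∈ Finset.range d, (0 - (x : ℤ)) / (d : ℤ) + n := by
    intro n
    induction n using Int.induction_on with
    | zero => simp
    | succ i ih => rw [key, ih]; ring
    | pred i ih =>
      have := key (-(i : ℤ) - 1)
      rw [sub_add_cancel, ih] at this
      linarith
  simp only [flr, Finset.sum_sub_distrib]
  rw [key2 (h q), key2 (h' q)]; ring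

end steps

theorem rsum_shift (e : ℕ) (A B y : ℤ) (f : ℤ → ℤ) :
    rsum e (A + 1) (B + 1) (y + 1) f = rsum e A B y (fun q => f (q + 1)) := by
  unfold rsum
  symm
  refine Finset.sum_bij' (fun q _ => q + 1) (fun q _ => q - 1) ?_ ?_ ?_ ?_ ?_
  all_goals simp only [Finset.mem_filter, Finset.mem_Ico]
  · rintro q ⟨h1, h2⟩
    exact ⟨by omega, by rwa [add_sub_add_right_eq_sub]⟩
  · rintro q ⟨h1, h2⟩
    exact ⟨by omega, by rwa [show q - 1 - y = q - (y + 1) by ring]⟩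
  · intros; ring
  · intros; ring
  · intros; trivial

theorem rsum_left {e : ℕ} {A B y : ℤ} {f : ℤ → ℤ} (h : f A = 0) :
    rsum e (A + 1) B y f = rsum e A B y f := by
  unfold rsum
  refine Finset.sum_subset (fun q => ?_) fun q hq hq' => ?_
  · simp only [Finset.mem_filter, Finset.mem_Ico]; rintro ⟨h1, h2⟩; exact ⟨by omega, h2⟩
  · simp only [Finset.mem_filter, Finset.mem_Ico] at hq hq'
    have : q = A := by
      by_contra hne; exact hq' ⟨by omega, hq.2⟩
    rw [this, h]

theorem rsum_right {e : ℕ} {A B y : ℤ} {f : ℤ → ℤ} (h : f B = 0) :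
    rsum e A (B + 1) y f = rsum e A B y f := by
  unfold rsum
  symm
  refine Finset.sum_subset (fun q => ?_) fun q hq hq' => ?_
  · simp only [Finset.mem_filter, Finset.mem_Ico]; rintro ⟨h1, h2⟩; exact ⟨by omega, h2⟩
  · simp only [Finset.mem_filter, Finset.mem_Ico] at hq hq'
    have : q = B := by
      by_contra hne; exact hq' ⟨by omega, hq.2⟩
    rw [this, h]

theorem rsum_sub (e : ℕ) (A B y : ℤ) (f g : ℤ → ℤ) :
    rsum e A B y (fun q => f q - g q) = rsum e A B y f - rsum e A B y g := by
  simp [rsum, Finset.sum_sub_distrib]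

theorem rsum_add (e : ℕ) (A B y : ℤ) (f g : ℤ → ℤ) :
    rsum e A B y (fun q => f q + g q) = rsum e A B y f + rsum e A B y g := by
  simp [rsum, Finset.sum_add_distrib]

theorem rsum_neg (e : ℕ) (A B y : ℤ) (f : ℤ → ℤ) :
    rsum e A B y (fun q => -f q) = -rsum e A B y f := by
  simp [rsum]

theorem rsum_congr {e : ℕ} {A B y : ℤ} {f g : ℤ → ℤ}
    (h : ∀ q, A ≤ q → q < B → (e : ℤ) ∣ q - y → f q = g q) : rsum e A B y f = rsum e A B y g := by
  refine Finset.sum_congr rfl fun q hq => ?_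
  simp only [Finset.mem_filter, Finset.mem_Ico] at hq
  exact h q hq.1.1 hq.1.2 hq.2

theorem rsum_eq_zero {e : ℕ} {A B y : ℤ} {f : ℤ → ℤ}
    (h : ∀ q, A ≤ q → q < B → (e : ℤ) ∣ q - y → f q = 0) : rsum e A B y f = 0 := by
  refine Finset.sum_eq_zero fun q hq => ?_
  simp only [Finset.mem_filter, Finset.mem_Ico] at hq
  exact h q hq.1.1 hq.1.2 hq.2

theorem rsum_nonneg {e : ℕ} {A B y : ℤ} {f : ℤ → ℤ} (h : ∀ q, 0 ≤ f q) : 0 ≤ rsum e A B y f :=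
  Finset.sum_nonneg fun q _ => h q

theorem rsum_congr_mod {e : ℕ} {A B y y' : ℤ} {f : ℤ → ℤ} (h : (e : ℤ) ∣ y - y') :
    rsum e A B y f = rsum e A B y' f := by
  unfold rsum
  congr 1
  refine Finset.filter_congr fun q _ => ?_
  rw [show q - y' = q - y + (y - y') by ring, dvd_add_left h]

theorem rsum_split {e : ℕ} {A B C y : ℤ} {f : ℤ → ℤ} (h1 : A ≤ B) (h2 : B ≤ C) :
    rsum e A C y f = rsum e A B y f + rsum e B C y f := by
  unfold rsum
  rw [← Finset.Ico_union_Ico_eq_Ico h1 h2, Finset.filter_union, Finset.sum_union]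
  exact Finset.disjoint_filter_filter (Finset.Ico_disjoint_Ico_consecutive A B C)

/-- Summing over all residues gives the sum over the interval. -/
theorem sum_rsum {e : ℕ} (he : 0 < e) (A B : ℤ) (f : ℤ → ℤ) :
    ∑ y ∈ Finset.range e, rsum e A B (y : ℤ) f = ∑ q ∈ Finset.Ico A B, f q := by
  have he' : (0 : ℤ) < e := by exact_mod_cast he
  unfold rsum
  rw [← Finset.sum_fiberwise_of_maps_to (s := Finset.Ico A B) (t := Finset.range e)
    (g := fun q => (q % e).toNat)]
  · refine Finset.sum_congr rfl fun y hy => ?_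
    congr 1
    refine Finset.filter_congr fun q _ => ?_
    have hy' := Finset.mem_range.1 hy
    have h2 := Int.emod_nonneg q he'.ne'
    rw [← Int.emod_emod_of_dvd q (dvd_refl (e:ℤ)), ← Int.emod_eq_emod_iff_emod_sub_eq_zero.trans
      (Int.dvd_iff_emod_eq_zero).symm, Int.emod_eq_of_lt (a := (y : ℤ)) (by omega) (by omega)]
    simp only [Int.emod_emod]
    omega
  · intro q _
    have h2 := Int.emod_nonneg q he'.ne'
    have h3 := Int.emod_lt_of_pos q he'
    simp only [Finset.mem_range]
    omega

/-! ### The extremal property of greedy profiles -/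

section compare

variable {d e N : ℕ} {h h' : ℤ → ℤ}

/-- The profile has no rim hook of size divisible by `e` whose arm length is `-1` modulo `d`.
Equivalently, read from left to right, it takes all its beads before all its gaps at each vertex
`(h p mod d, p mod e)`. -/
def BeadsFirst (d e : ℕ) (h : ℤ → ℤ) : Prop :=
  ∀ p q, p < q → (e : ℤ) ∣ q - p → h (p + 1) = h p + 1 → h (q + 1) = h q → ¬(d : ℤ) ∣ h q - h p

/-- The profile has no rim hook of size divisible by `e` whose arm length is `0` modulo `d`.
Equivalently, each vertex is entered from beads before it is entered from gaps. -/
def GapsLast (d e : ℕ) (h : ℤ → ℤ) : Prop :=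
  ∀ p q, p < q → (e : ℤ) ∣ q - p → h (p + 1) = h p + 1 → h (q + 1) = h q →
    ¬(d : ℤ) ∣ h q - h p - 1

theorem beadInd_right (H : IsProfile N h) {q : ℤ} (hq : (N : ℤ) ≤ q) (x : ℤ) :
    beadInd d h x q = 0 := by
  unfold beadInd
  rw [H.right q hq, H.right (q + 1) (by omega), if_neg (by omega)]

theorem gapInd_left (H : IsProfile N h) {q : ℤ} (hq : q + 1 ≤ -(N : ℤ)) (x : ℤ) :
    gapInd d h x q = 0 := by
  unfold gapInd
  rw [H.left q (by omega), H.left (q + 1) hq, if_neg (by omega)]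

/-- The key estimate for `BeadsFirst` profiles: a maximum principle.  At a vertex where the beads
of `h` are used up one passes along the diagonal, and otherwise `h` has not yet used a gap there
and one passes horizontally. -/
theorem BeadsFirst.rsum_flr_nonpos (hd : 0 < d) (H : IsProfile N h) (H' : IsProfile N h')
    (hmax : BeadsFirst d e h)
    (hb : ∀ x y, rsum e (-N) N y (beadInd d h x) = rsum e (-N) N y (beadInd d h' x)) (p x : ℤ) :
    rsum e (-N) (p + 1) p (flr d h h' x) ≤ 0 := by
  rcases le_or_gt p (-(N : ℤ)) with hp | hp
  · refine le_of_eq (rsum_eq_zero fun q _ h2 _ => flr_left H H' (by omega) x)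
  induction p, hp.le using Int.leInduction generalizing x with
  | base => omega
  | succ p hp0 ih =>
    have IH : ∀ x, rsum e (-N) (p + 1) p (flr d h h' x) ≤ 0 := fun x => by
      rcases eq_or_lt_of_le hp0 with h1 | h1
      · exact le_of_eq (rsum_eq_zero fun q _ h2 _ => flr_left H H' (by omega) x)
      · exact ih x h1
    obtain ⟨z, rfl⟩ : ∃ z, x = z + 1 := ⟨x - 1, by ring⟩
    have hsh : rsum e (-N) (p + 1 + 1) (p + 1) (flr d h h' (z + 1)) =
        rsum e (-N) (p + 1) p fun q => flr d h h' (z + 1) (q + 1) := by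
      rw [← rsum_shift, rsum_left]
      exact flr_left H H' le_rfl _
    rw [hsh]
    by_cases hex : ∃ q, p < q ∧ (e : ℤ) ∣ q - p ∧ h (q + 1) = h q ∧ (d : ℤ) ∣ h q - z
    · -- a later bead at the vertex: no gap has been used there
      obtain ⟨q, hq1, hq2, hq3, hq4⟩ := hex
      have h0 : rsum e (-N) (p + 1) p (gapInd d h z) = 0 := by
        refine rsum_eq_zero fun r _ hr2 hr3 => ?_
        unfold gapInd
        rw [if_neg]
        rintro ⟨hr4, hr5⟩
        refine hmax r q (by omega) ?_ hr4 hq3 ?_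
        · rw [show q - r = (q - p) - (r - p) by ring]; exact dvd_sub hq2 hr3
        · rw [show h q - h r = (h q - z) - (h r - z) by ring]; exact dvd_sub hq4 hr5
      simp only [flr_horiz hd H H']
      rw [rsum_add, rsum_sub, h0]
      have := rsum_nonneg (e := e) (A := -N) (B := p + 1) (y := p)
        (fun q => gapInd_nonneg d h' z q)
      linarith [IH (z + 1)]
    · -- all beads at the vertex are used up
      push Not at hex
      have key : rsum e (-N) (p + 1) p (beadInd d h' z) ≤
          rsum e (-N) (p + 1) p (beadInd d h z) := by
        have hM : ∀ {g : ℤ → ℤ}, IsProfile N g → rsum e (-N) N p (beadInd d g z) =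
            rsum e (-N) (max N (p + 1)) p (beadInd d g z) := fun {g} G => by
          rw [rsum_split (C := max N (p + 1)) (show (-(N : ℤ)) ≤ N by omega) (le_max_left _ _)]
          rw [rsum_eq_zero (A := N), add_zero]
          exact fun q hq _ _ => beadInd_right G hq z
        have h1 := hb z p
        rw [hM H, hM H', rsum_split (B := p + 1) (by omega) (le_max_right _ _),
          rsum_split (B := p + 1) (f := beadInd d h' z) (by omega) (le_max_right _ _)] at h1
        have h2 : rsum e (p + 1) (max N (p + 1)) p (beadInd d h z) = 0 := by
          refine rsum_eq_zero fun q hq1 _ hq2 => ?_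
          unfold beadInd
          rw [if_neg]
          rintro ⟨hq3, hq4⟩
          exact hex q (by omega) hq2 hq3 hq4
        have h3 := rsum_nonneg (e := e) (A := p + 1) (B := max N (p + 1)) (y := p)
          (fun q => beadInd_nonneg d h' z q)
        linarith
      simp only [flr_diag hd H H']
      rw [rsum_sub, rsum_sub]
      linarith [IH z]

/-- The key estimate for `GapsLast` profiles, by the same maximum principle read from the right. -/
theorem GapsLast.rsum_flr_nonpos (hd : 0 < d) (H : IsProfile N h) (H' : IsProfile N h')
    (hmin : GapsLast d e h)
    (hg : ∀ x y, rsum e (-N) N y (gapInd d h x) = rsum e (-N) N y (gapInd d h' x)) (p x : ℤ) :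
    rsum e p N p (flr d h h' x) ≤ 0 := by
  rcases le_or_gt (N : ℤ) p with hp | hp
  · refine le_of_eq (rsum_eq_zero fun q _ h2 _ => flr_right H H' (by omega) x)
  induction p, hp.le using Int.leInductionDown generalizing x with
  | base => omega
  | pred p hp0 ih =>
    obtain ⟨p, rfl⟩ : ∃ z, p = z + 1 := ⟨p - 1, by ring⟩
    rw [add_sub_cancel_right]
    have IH : ∀ x, rsum e (p + 1) N (p + 1) (flr d h h' x) ≤ 0 := fun x => by
      rcases eq_or_lt_of_le hp0 with h1 | h1
      · exact le_of_eq (rsum_eq_zero fun q _ h2 _ => flr_right H H' (by omega) x)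
      · exact ih x h1
    obtain ⟨z, rfl⟩ : ∃ z, x = z + 1 := ⟨x - 1, by ring⟩
    have hsh : ∀ x, rsum e (p + 1) N (p + 1) (flr d h h' x) =
        rsum e p N p fun q => flr d h h' x (q + 1) := fun x => by
      rw [← rsum_shift, rsum_right]
      exact flr_right H H' le_rfl _
    simp only [hsh] at IH
    by_cases hex : ∃ q, p ≤ q ∧ (e : ℤ) ∣ q - p ∧ h (q + 1) = h q ∧ (d : ℤ) ∣ h q - (z + 1)
    · -- a bead enters the end vertex later: no gap has entered it before
      obtain ⟨q, hq1, hq2, hq3, hq4⟩ := hex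
      have hM : ∀ {g : ℤ → ℤ}, IsProfile N g → rsum e (-N) N p (gapInd d g z) =
          rsum e (min (-N) p) N p (gapInd d g z) := fun {g} G => by
        rw [rsum_split (A := min (-N) p) (min_le_left _ _) (show (-(N : ℤ)) ≤ N by omega)]
        rw [rsum_eq_zero (B := -N), zero_add]
        exact fun q _ hq _ => gapInd_left G (by omega) z
      have h1 := hg z p
      rw [hM H, hM H', rsum_split (B := p) (min_le_right _ _) (by omega),
        rsum_split (B := p) (f := gapInd d h' z) (min_le_right _ _) (by omega)] at h1
      have h2 : rsum e (min (-N) p) p p (gapInd d h z) = 0 := by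
        refine rsum_eq_zero fun r _ hr2 hr3 => ?_
        unfold gapInd
        rw [if_neg]
        rintro ⟨hr4, hr5⟩
        refine hmin r q (by omega) ?_ hr4 hq3 ?_
        · rw [show q - r = (q - p) - (r - p) by ring]; exact dvd_sub hq2 hr3
        · rw [show h q - h r - 1 = (h q - (z + 1)) - (h r - z) by ring]; exact dvd_sub hq4 hr5
      have h3 := rsum_nonneg (e := e) (A := min (-N) p) (B := p) (y := p)
        (fun q => gapInd_nonneg d h' z q)
      have h4 := IH (z + 1)
      simp only [flr_horiz hd H H'] at h4
      rw [rsum_add, rsum_sub] at h4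
      linarith
    · push Not at hex
      have h0 : rsum e p N p (beadInd d h (z + 1)) = 0 := by
        refine rsum_eq_zero fun q hq1 _ hq2 => ?_
        unfold beadInd
        rw [if_neg]
        rintro ⟨hq3, hq4⟩
        exact hex q hq1 hq2 hq3 hq4
      have h3 := rsum_nonneg (e := e) (A := p) (B := N) (y := p)
        (fun q => beadInd_nonneg d h' (z + 1) q)
      have h4 := IH (z + 1 + 1)
      simp only [flr_diag hd H H'] at h4
      rw [rsum_sub, rsum_sub] at h4
      linarith

/-- Summing the runner sums that end near `p` gives a full initial sum. -/
theorem sum_initial_rsum (he : 0 < e) (f : ℤ → ℤ) (p : ℤ) :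
    ∑ i ∈ Finset.range e, rsum e (-N) (p - i + 1) (p - i) f = ∑ q ∈ Finset.Ico (-(N : ℤ)) (p + 1), f q := by
  rw [← sum_rsum he]
  have he' : (0 : ℤ) < e := by exact_mod_cast he
  refine Finset.sum_bij' (fun i _ => ((p - i) % e).toNat) (fun i _ => ((p - i) % e).toNat) ?_ ?_ ?_ ?_ ?_
  · intro i _
    have h2 := Int.emod_nonneg (p - i) he'.ne'
    have h3 := Int.emod_lt_of_pos (p - i) he'
    simp only [Finset.mem_range]; omega
  · intro i _
    have h2 := Int.emod_nonneg (p - i) he'.ne'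
    have h3 := Int.emod_lt_of_pos (p - i) he'
    simp only [Finset.mem_range]; omega
  · intro i hi
    have h2 := Int.emod_nonneg (p - i) he'.ne'
    have hi' := Finset.mem_range.1 hi
    rw [Int.toNat_of_nonneg h2, Int.sub_emod, Int.emod_emod, ← Int.sub_emod, sub_sub_cancel,
      Int.emod_eq_of_lt (by omega) (by omega)]
    rfl
  · intro i hi
    have h2 := Int.emod_nonneg (p - i) he'.ne'
    have hi' := Finset.mem_range.1 hi
    rw [Int.toNat_of_nonneg h2, Int.sub_emod, Int.emod_emod, ← Int.sub_emod, sub_sub_cancel,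
      Int.emod_eq_of_lt (by omega) (by omega)]
    rfl
  · intro i hi
    have h2 := Int.emod_nonneg (p - i) he'.ne'
    have hi' := Finset.mem_range.1 hi
    rw [Int.toNat_of_nonneg h2]
    have hdv : (e : ℤ) ∣ (p - i) - (p - i) % e := Int.dvd_self_sub_emod
    rw [rsum_congr_mod hdv]
    rcases le_or_gt (-(N : ℤ)) (p - i + 1) with hA | hA
    · rw [rsum_split (C := p + 1) hA (by omega), rsum_eq_zero (A := p - i + 1), add_zero]
      intro q hq1 hq2 hq3
      have : (e : ℤ) ∣ q - (p - i) := by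
        rw [show q - (p - i) = (q - (p - i) % e) - ((p - i) - (p - i) % e) by ring]
        exact dvd_sub hq3 hdv
      exact absurd (Int.le_of_dvd (by omega) this) (by omega)
    · rw [rsum_eq_zero, rsum_eq_zero]
      · intro q hq1 hq2 hq3
        have : (e : ℤ) ∣ q - (p - i) := by
          rw [show q - (p - i) = (q - (p - i) % e) - ((p - i) - (p - i) % e) by ring]
          exact dvd_sub hq3 hdv
        exact absurd (Int.le_of_dvd (by omega) this) (by omega)
      · intro q hq1 hq2 hq3; omega

theorem sum_final_rsum (he : 0 < e) (f : ℤ → ℤ) (p : ℤ) :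
    ∑ i ∈ Finset.range e, rsum e (p + i) N (p + i) f = ∑ q ∈ Finset.Ico p (N : ℤ), f q := by
  rw [← sum_rsum he]
  have he' : (0 : ℤ) < e := by exact_mod_cast he
  refine Finset.sum_bij' (fun i _ => ((p + i) % e).toNat) (fun i _ => ((i - p) % e).toNat) ?_ ?_ ?_ ?_ ?_
  · intro i _
    have h2 := Int.emod_nonneg (p + i) he'.ne'
    have h3 := Int.emod_lt_of_pos (p + i) he'
    simp only [Finset.mem_range]; omega
  · intro i _
    have h2 := Int.emod_nonneg (i - p) he'.ne'
    have h3 := Int.emod_lt_of_pos (i - p) he'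
    simp only [Finset.mem_range]; omega
  · intro i hi
    have h2 := Int.emod_nonneg (p + i) he'.ne'
    have hi' := Finset.mem_range.1 hi
    rw [Int.toNat_of_nonneg h2, Int.sub_emod, Int.emod_emod, ← Int.sub_emod, add_sub_cancel_left,
      Int.emod_eq_of_lt (by omega) (by omega)]
    rfl
  · intro i hi
    have h2 := Int.emod_nonneg (i - p) he'.ne'
    have hi' := Finset.mem_range.1 hi
    rw [Int.toNat_of_nonneg h2, Int.add_emod, Int.emod_emod, ← Int.add_emod, add_sub_cancel,
      Int.emod_eq_of_lt (by omega) (by omega)]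
    rfl
  · intro i hi
    have h2 := Int.emod_nonneg (p + i) he'.ne'
    have hi' := Finset.mem_range.1 hi
    rw [Int.toNat_of_nonneg h2]
    have hdv : (e : ℤ) ∣ (p + i) - (p + i) % e := Int.dvd_self_sub_emod
    rw [rsum_congr_mod hdv]
    have hz : ∀ q, q < p + i → p ≤ q → (e : ℤ) ∣ q - (p + i) % e → False := fun q hq1 hq2 hq3 => by
      have : (e : ℤ) ∣ (p + i) - q := by
        rw [show (p + i) - q = ((p + i) - (p + i) % e) - (q - (p + i) % e) by ring]
        exact dvd_sub hdv hq3
      exact absurd (Int.le_of_dvd (by omega) this) (by omega)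
    rcases le_or_gt (p + i) (N : ℤ) with hA | hA
    · rw [rsum_split (A := p) (B := p + i) (by omega) hA, rsum_eq_zero (B := p + i), zero_add]
      exact fun q hq1 hq2 hq3 => (hz q hq2 hq1 hq3).elim
    · rw [rsum_eq_zero, rsum_eq_zero]
      · exact fun q hq1 hq2 hq3 => (hz q (by omega) hq1 hq3).elim
      · intro q hq1 hq2 hq3; omega

/-- A `BeadsFirst` profile has the least initial sums among all profiles with the same data. -/
theorem BeadsFirst.sum_le (hd : 0 < d) (he : 0 < e) (H : IsProfile N h) (H' : IsProfile N h')
    (hmax : BeadsFirst d e h)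
    (hb : ∀ x y, rsum e (-N) N y (beadInd d h x) = rsum e (-N) N y (beadInd d h' x)) (p : ℤ) :
    ∑ q ∈ Finset.Ico (-(N : ℤ)) (p + 1), h q ≤ ∑ q ∈ Finset.Ico (-(N : ℤ)) (p + 1), h' q := by
  rw [← sub_nonpos, ← Finset.sum_sub_distrib]
  simp only [← sum_flr hd]
  rw [Finset.sum_comm]
  refine Finset.sum_nonpos fun x _ => ?_
  rw [← sum_initial_rsum he]
  exact Finset.sum_nonpos fun i _ => hmax.rsum_flr_nonpos hd H H' hb _ _

/-- A `GapsLast` profile has the least final sums among all profiles with the same data. -/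
theorem GapsLast.sum_le (hd : 0 < d) (he : 0 < e) (H : IsProfile N h) (H' : IsProfile N h')
    (hmin : GapsLast d e h)
    (hg : ∀ x y, rsum e (-N) N y (gapInd d h x) = rsum e (-N) N y (gapInd d h' x)) (p : ℤ) :
    ∑ q ∈ Finset.Ico p (N : ℤ), h q ≤ ∑ q ∈ Finset.Ico p (N : ℤ), h' q := by
  rw [← sub_nonpos, ← Finset.sum_sub_distrib]
  simp only [← sum_flr hd]
  rw [Finset.sum_comm]
  refine Finset.sum_nonpos fun x _ => ?_
  rw [← sum_final_rsum he]
  exact Finset.sum_nonpos fun i _ => hmin.rsum_flr_nonpos hd H H' hg _ _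

end compare

/-! ### Profiles with the same data -/

section data

variable {d e N : ℕ} {h h' : ℤ → ℤ}

theorem rsum_succ_residue {f : ℤ → ℤ} (h1 : f (-N) = 0) (h2 : f N = 0) (y : ℤ) :
    rsum e (-N) N (y + 1) f = rsum e (-N) N y fun q => f (q + 1) := by
  rw [← rsum_shift, rsum_left h1, rsum_right h2]

theorem rsum_flr_diag (hd : 0 < d) (H : IsProfile N h) (H' : IsProfile N h') (x y : ℤ) :
    rsum e (-N) N (y + 1) (flr d h h' (x + 1)) = rsum e (-N) N y (flr d h h' x) -
      (rsum e (-N) N y (beadInd d h x) - rsum e (-N) N y (beadInd d h' x)) := by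
  rw [rsum_succ_residue (flr_left H H' le_rfl _) (flr_right H H' le_rfl _)]
  simp only [flr_diag hd H H']
  rw [rsum_sub, rsum_sub]

theorem rsum_flr_horiz (hd : 0 < d) (H : IsProfile N h) (H' : IsProfile N h') (x y : ℤ) :
    rsum e (-N) N (y + 1) (flr d h h' (x + 1)) = rsum e (-N) N y (flr d h h' (x + 1)) +
      (rsum e (-N) N y (gapInd d h x) - rsum e (-N) N y (gapInd d h' x)) := by
  rw [rsum_succ_residue (flr_left H H' le_rfl _) (flr_right H H' le_rfl _)]
  simp only [flr_horiz hd H H']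
  rw [rsum_add, rsum_sub]

theorem rsum_flr_congr_mod (hd : 0 < d) {x x' : ℤ} (hx : (d : ℤ) ∣ x - x') (y : ℤ) :
    rsum e (-N) N y (flr d h h' x) = rsum e (-N) N y (flr d h h' x') := by
  obtain ⟨k, hk⟩ := hx
  have : ∀ (k x q : ℤ), flr d h h' (x + d * k) q = flr d h h' x q := by
    intro k x q
    induction k using Int.induction_on with
    | zero => simp
    | succ i ih => rw [mul_add, mul_one, ← add_assoc, flr_periodic hd, ih]
    | pred i ih =>
      rw [← flr_periodic hd, ← ih]; congr 1; ring
  obtain rfl : x = x' + d * k := by linarith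
  exact rsum_congr fun q _ _ _ => this k x' q

/-- Two profiles have the same data if the total runner sums of the differences of their rounded
values do not depend on the vertex. -/
def SameData (d e N : ℕ) (h h' : ℤ → ℤ) : Prop :=
  ∃ c, ∀ x y, rsum e (-N) N y (flr d h h' x) = c

theorem SameData.beads (hd : 0 < d) (H : IsProfile N h) (H' : IsProfile N h')
    (hs : SameData d e N h h') (x y : ℤ) :
    rsum e (-N) N y (beadInd d h x) = rsum e (-N) N y (beadInd d h' x) := by
  obtain ⟨c, hc⟩ := hs
  have := rsum_flr_diag (e := e) hd H H' x y
  rw [hc, hc] at this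
  linarith

theorem SameData.gaps (hd : 0 < d) (H : IsProfile N h) (H' : IsProfile N h')
    (hs : SameData d e N h h') (x y : ℤ) :
    rsum e (-N) N y (gapInd d h x) = rsum e (-N) N y (gapInd d h' x) := by
  obtain ⟨c, hc⟩ := hs
  have := rsum_flr_horiz (e := e) hd H H' x y
  rw [hc, hc] at this
  linarith

/-- As `d` and `e` are coprime, the diagonal step acts transitively on the vertices. -/
theorem SameData.of_beads (hd : 0 < d) (hcop : Nat.Coprime d e)
    (H : IsProfile N h) (H' : IsProfile N h')
    (hb : ∀ x y, rsum e (-N) N y (beadInd d h x) = rsum e (-N) N y (beadInd d h' x)) :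
    SameData d e N h h' := by
  have step : ∀ x y, rsum e (-N) N (y + 1) (flr d h h' (x + 1)) =
      rsum e (-N) N y (flr d h h' x) := fun x y => by
    rw [rsum_flr_diag hd H H', hb x y]; ring
  have steps : ∀ k x y : ℤ, rsum e (-N) N (y + k) (flr d h h' (x + k)) =
      rsum e (-N) N y (flr d h h' x) := by
    intro k x y
    induction k using Int.induction_on with
    | zero => simp
    | succ i ih => rw [← add_assoc, ← add_assoc, step, ih]
    | pred i ih =>
      rw [← step, ← ih]; congr 1
      · ring
      · congr 1; ring
  refine ⟨rsum e (-N) N 0 (flr d h h' 0), fun x y => ?_⟩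
  have hc : IsCoprime (d : ℤ) (e : ℤ) := Nat.isCoprime_iff_coprime.2 hcop
  obtain ⟨a, b, hab⟩ := hc
  -- `k` is congruent to `x` modulo `d` and to `y` modulo `e`
  have h1 : (d : ℤ) ∣ x - (0 + (y * a * d + x * b * e)) :=
    ⟨x * a - y * a, by linear_combination (-x) * hab⟩
  have h2 : (e : ℤ) ∣ y - (0 + (y * a * d + x * b * e)) :=
    ⟨y * b - x * b, by linear_combination (-y) * hab⟩
  rw [rsum_flr_congr_mod hd h1, rsum_congr_mod h2, steps]

theorem sum_rsum_flr (hd : 0 < d) (y : ℤ) :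
    ∑ x ∈ Finset.range d, rsum e (-N) N y (flr d h h' (x : ℤ)) =
      rsum e (-N) N y (fun q => h q - h' q) := by
  unfold rsum
  rw [Finset.sum_comm]
  exact Finset.sum_congr rfl fun q _ => sum_flr hd q

/-- Bead counts agree in all classes as soon as they agree in the nonzero ones and the residue
contents differ by a constant. -/
theorem SameData.of_nonzero (hd : 0 < d) (hcop : Nat.Coprime d e)
    (H : IsProfile N h) (H' : IsProfile N h')
    (hb : ∀ x : ℕ, 0 < x → x < d → ∀ y,
      rsum e (-N) N y (beadInd d h x) = rsum e (-N) N y (beadInd d h' x))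
    (c : ℤ) (hc : ∀ y, rsum e (-N) N y (fun q => h q - h' q) = c) :
    SameData d e N h h' := by
  have hd' : (0 : ℤ) < d := by exact_mod_cast hd
  have htot : ∀ y, ∑ x ∈ Finset.range d, rsum e (-N) N y (beadInd d h (x : ℤ)) =
      ∑ x ∈ Finset.range d, rsum e (-N) N y (beadInd d h' (x : ℤ)) := by
    intro y
    have h1 := fun x : ℕ => rsum_flr_diag (e := e) hd H H' (x : ℤ) y
    have h2 : ∑ x ∈ Finset.range d, rsum e (-N) N (y + 1) (flr d h h' ((x : ℤ) + 1)) =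
        rsum e (-N) N (y + 1) (fun q => h q - h' q) := by
      rw [← sum_rsum_flr hd]
      obtain ⟨k, rfl⟩ : ∃ k, d = k + 1 := ⟨d - 1, by omega⟩
      rw [Finset.sum_range_succ' (fun x : ℕ => rsum e (-N) N (y + 1) (flr (k + 1) h h' (x : ℤ))),
        Finset.sum_range_succ]
      congr 1
      refine rsum_flr_congr_mod hd ⟨1, ?_⟩ _
      push_cast; ring
    simp only [h1, Finset.sum_sub_distrib, sum_rsum_flr hd, hc] at h2
    linarith
  refine SameData.of_beads hd hcop H H' fun x y => ?_
  have h2 := Int.emod_nonneg x hd'.ne'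
  have h3 := Int.emod_lt_of_pos x hd'
  have hx : ∀ g, rsum e (-N) N y (beadInd d g x) =
      rsum e (-N) N y (beadInd d g ((x % d).toNat : ℤ)) := fun g => by
    refine rsum_congr fun q _ _ _ => beadInd_congr ?_ q
    rw [Int.toNat_of_nonneg h2]
    exact Int.dvd_self_sub_emod
  rw [hx, hx]
  rcases Nat.eq_zero_or_pos (x % d).toNat with h0 | h0
  · have h4 := htot y
    obtain ⟨k, rfl⟩ : ∃ k, d = k + 1 := ⟨d - 1, by omega⟩
    rw [Finset.sum_range_succ', Finset.sum_range_succ'] at h4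
    rw [h0]
    have h5 : ∑ x ∈ Finset.range k, rsum e (-N) N y (beadInd (k + 1) h ((x + 1 : ℕ) : ℤ)) =
        ∑ x ∈ Finset.range k, rsum e (-N) N y (beadInd (k + 1) h' ((x + 1 : ℕ) : ℤ)) :=
      Finset.sum_congr rfl fun x hx => hb (x + 1) (by omega)
        (by have := Finset.mem_range.1 hx; omega) y
    linarith
  · exact hb _ h0 (by omega) y

end data

/-! ### An invariant of pairs of a gap and a bead -/

section flux

variable {d e N : ℕ} {h h' : ℤ → ℤ}

/-- The sum of `f p q` over all `p < q` in `[-N, N)` with `p ≡ q` modulo `e`. -/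
noncomputable def pairSum (e N : ℕ) (f : ℤ → ℤ → ℤ) : ℤ :=
  ∑ p ∈ Finset.Ico (-(N : ℤ)) N, ∑ q ∈ Finset.Ico (-(N : ℤ)) N,
    if p < q ∧ (e : ℤ) ∣ q - p then f p q else 0

/-- The indicator of a gap at `p` and a bead at `q` with `h q - h p ≡ D` modulo `d`. -/
def gapBead (d : ℕ) (h : ℤ → ℤ) (D p q : ℤ) : ℤ :=
  if h (p + 1) = h p + 1 ∧ h (q + 1) = h q ∧ (d : ℤ) ∣ h q - h p - D then 1 else 0

/-- The indicator of a bead at `p` and a gap at `q` with `h q - h p ≡ D` modulo `d`. -/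
def beadGap (d : ℕ) (h : ℤ → ℤ) (D p q : ℤ) : ℤ :=
  if h (p + 1) = h p ∧ h (q + 1) = h q + 1 ∧ (d : ℤ) ∣ h q - h p - D then 1 else 0

theorem ediv_pair (hd : 0 < d) (H : IsProfile N h) (D p q : ℤ) :
    (h (q + 1) - h (p + 1) - D) / (d : ℤ) =
      (h q - h p - D) / d + (beadGap d h (D - 1) p q - gapBead d h D p q) := by
  unfold beadGap gapBead
  rcases H.step p with hp | hp <;> rcases H.step q with hq | hq <;> rw [hp, hq]
  · rw [if_neg (by omega), if_neg (by omega)]; simp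
  · have := add_one_ediv d hd (h q - h p - D)
    rw [show h q + 1 - h p - D = h q - h p - D + 1 by ring, this,
      if_neg (show ¬(h p = h p + 1 ∧ h q + 1 = h q ∧ (d : ℤ) ∣ h q - h p - D) by omega)]
    simp only [true_and, sub_zero]
    rw [show h q - h p - (D - 1) = h q - h p - D + 1 by ring]
  · have := add_one_ediv d hd (h q - h p - D - 1)
    rw [sub_add_cancel] at this
    rw [show h q - (h p + 1) - D = h q - h p - D - 1 by ring, this,
      if_neg (show ¬(h p + 1 = h p ∧ h q = h q + 1 ∧ (d : ℤ) ∣ h q - h p - (D - 1)) by omega)]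
    simp only [true_and]
    ring
  · rw [if_neg (by omega), if_neg (by omega)]
    simp

theorem pairSum_eq (f : ℤ → ℤ → ℤ) :
    pairSum e N f = ∑ p ∈ Finset.Ico (-(N : ℤ)) N, rsum e (p + 1) N p (f p) := by
  unfold pairSum rsum
  refine Finset.sum_congr rfl fun p hp => ?_
  rw [← Finset.sum_filter]
  refine Finset.sum_congr ?_ fun _ _ => rfl
  ext q
  simp only [Finset.mem_filter, Finset.mem_Ico] at hp ⊢
  constructor
  · rintro ⟨h1, h2, h3⟩; exact ⟨by omega, h3⟩
  · rintro ⟨h1, h3⟩; exact ⟨by omega, by omega, h3⟩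

theorem pairSum_sub (f g : ℤ → ℤ → ℤ) :
    pairSum e N (fun p q => f p q - g p q) = pairSum e N f - pairSum e N g := by
  unfold pairSum
  simp only [← Finset.sum_sub_distrib]
  refine Finset.sum_congr rfl fun p _ => Finset.sum_congr rfl fun q _ => ?_
  split_ifs <;> simp

/-- The diagonal differences of `G` telescope along the diagonals `q - p = const`; what remains are
the terms on the right and on the left edge of the triangle `p < q`. -/
theorem pairSum_telescope (G : ℤ → ℤ → ℤ) (h1 : G N N = 0) (h2 : G (-N) (-N) = 0)
    (h3 : G (-N) N = 0) :
    pairSum e N (fun p q => G (p + 1) (q + 1) - G p q) =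
      rsum e (-N) N N (fun r => G r N) - rsum e (-N) N (-N) (G (-N)) := by
  rw [pairSum_eq]
  set A : ℤ → ℤ := fun p => rsum e (p + 1) N p (G p) with hA
  have key : ∀ p ∈ Finset.Ico (-(N : ℤ)) N, rsum e (p + 1) N p (fun q => G (p + 1) (q + 1) - G p q) =
      A (p + 1) - A p + if (e : ℤ) ∣ p + 1 - N then G (p + 1) N else 0 := by
    intro p hp
    rw [Finset.mem_Ico] at hp
    rw [rsum_sub, ← rsum_shift (f := G (p + 1))]
    rcases eq_or_lt_of_le (show p + 1 ≤ N by omega) with h | h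
    · -- all the sums are empty, or consist of the term `G N N`
      have e1 : rsum e (p + 1 + 1) (N + 1) (p + 1) (G (p + 1)) = 0 :=
        rsum_eq_zero fun q h1 h2 _ => by omega
      have e2 : rsum e (p + 1) N p (G p) = 0 := rsum_eq_zero fun q h1 h2 _ => by omega
      have e3 : rsum e (p + 1 + 1) N (p + 1) (G (p + 1)) = 0 :=
        rsum_eq_zero fun q h1 h2 _ => by omega
      have e4 : (if (e : ℤ) ∣ p + 1 - N then G (p + 1) N else 0) = 0 := by
        rw [h, h1]; simp
      rw [e4]
      simp only [hA]
      rw [e1, e2, e3]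
      simp
    · rw [rsum_split (B := N) (by omega) (by omega)]
      have : rsum e (N : ℤ) (N + 1) (p + 1) (G (p + 1)) =
          if (e : ℤ) ∣ p + 1 - N then G (p + 1) N else 0 := by
        unfold rsum
        rw [Finset.sum_filter, show Finset.Ico (N : ℤ) (N + 1) = {(N : ℤ)} by ext; simp; omega,
          Finset.sum_singleton]
        exact if_congr (by rw [show (N : ℤ) - (p + 1) = -(p + 1 - N) by ring, dvd_neg]) rfl rfl
      rw [this]
      simp only [hA]; ring
  rw [Finset.sum_congr rfl key, Finset.sum_add_distrib]
  have t1 : ∀ M : ℤ, -(N : ℤ) ≤ M → ∑ p ∈ Finset.Ico (-(N : ℤ)) M, (A (p + 1) - A p) = A M - A (-N) := by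
    intro M hM
    induction M, hM using Int.leInduction with
    | base => simp
    | succ M hM ih => rw [← Finset.insert_Ico_right_eq_Ico_add_one hM, Finset.sum_insert (by simp), ih]; ring
  have t2 : ∑ p ∈ Finset.Ico (-(N : ℤ)) N, (if (e : ℤ) ∣ p + 1 - N then G (p + 1) N else 0) =
      rsum e (-N) N (N - 1) (fun r => G (r + 1) N) := by
    unfold rsum
    rw [Finset.sum_filter]
    refine Finset.sum_congr rfl fun p _ => ?_
    rw [show p + 1 - (N : ℤ) = p - (N - 1) by ring]
  rw [t1 N (by omega), t2, ← rsum_shift (f := fun r => G r N), rsum_left (by exact h3),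
    rsum_right (by exact h1), sub_add_cancel]
  have t3 : A N = 0 := rsum_eq_zero fun q h1 h2 _ => by omega
  have t4 : A (-N) = rsum e (-N) N (-N) (G (-N)) := rsum_left h2
  rw [t3, t4]; ring

theorem flr_reflect (hd : 0 < d) (D n m : ℤ) :
    (N - n - D) / (d : ℤ) - (N - m - D) / (d : ℤ) =
      -((n - (N - D - d + 1)) / (d : ℤ) - (m - (N - D - d + 1)) / (d : ℤ)) := by
  have hd' : (0 : ℤ) < d := by exact_mod_cast hd
  have key : ∀ a : ℤ, a / (d : ℤ) = -((-a + d - 1) / d) := by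
    intro a
    have h1 := Int.mul_ediv_add_emod a d
    have h2 := Int.emod_nonneg a hd'.ne'
    have h3 := Int.emod_lt_of_pos a hd'
    have h4 : (d - 1 - a % d) / (d : ℤ) = 0 := Int.ediv_eq_zero_of_lt (by omega) (by omega)
    rw [show -a + d - 1 = (d - 1 - a % d) + d * (-(a / d)) by linarith,
      Int.add_mul_ediv_left _ _ hd'.ne', h4]
    ring
  rw [key (N - n - D), key (N - m - D)]
  rw [show -(N - n - D) + d - 1 = n - (N - D - d + 1) by ring,
    show -(N - m - D) + d - 1 = m - (N - D - d + 1) by ring]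
  ring

/-- Move a pair `p < q` of positions on a runner simultaneously to the right.  The number of passages
of the difference `h q - h p` from the class `D - 1` to the class `D`, minus the number of passages
back, depends only on the ends of the diagonals, hence only on the runner sums of the rounded
values. -/
theorem pairSum_flux (hd : 0 < d) (H : IsProfile N h) (H' : IsProfile N h')
    (h0 : ∀ x y, rsum e (-N) N y (flr d h h' x) = 0) (D : ℤ) :
    pairSum e N (beadGap d h (D - 1)) - pairSum e N (gapBead d h D) =
      pairSum e N (beadGap d h' (D - 1)) - pairSum e N (gapBead d h' D) := by
  set G : ℤ → ℤ → ℤ := fun p q => (h q - h p - D) / (d : ℤ) - (h' q - h' p - D) / d with hG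
  have key : pairSum e N (fun p q => G (p + 1) (q + 1) - G p q) =
      (pairSum e N (beadGap d h (D - 1)) - pairSum e N (gapBead d h D)) -
      (pairSum e N (beadGap d h' (D - 1)) - pairSum e N (gapBead d h' D)) := by
    rw [← pairSum_sub, ← pairSum_sub, ← pairSum_sub]
    congr 1
    funext p q
    simp only [hG]
    rw [ediv_pair hd H, ediv_pair hd H']; ring
  rw [← sub_eq_zero, ← key, pairSum_telescope]
  · have e1 : rsum e (-N) N N (fun r => G r N) = 0 := by
      have : (fun r => G r N) = fun r => -flr d h h' (N - D - d + 1) r := by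
        funext r
        simp only [hG, H.right N le_rfl, H'.right N le_rfl, flr]
        exact flr_reflect hd D (h r) (h' r)
      rw [this, rsum_neg, h0]; rfl
    have e2 : rsum e (-N) N (-N) (G (-N)) = 0 := by
      have : G (-N) = flr d h h' D := by
        funext r
        simp only [hG, H.left (-N) le_rfl, H'.left (-N) le_rfl, flr, sub_zero]
      rw [this, h0]
    rw [e1, e2]; rfl
  · simp [hG, H.right N le_rfl, H'.right N le_rfl]
  · simp [hG, H.left (-N) le_rfl, H'.left (-N) le_rfl]
  · simp [hG, H.left (-N) le_rfl, H'.left (-N) le_rfl, H.right N le_rfl, H'.right N le_rfl]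

/-- The number of pairs of a gap and a bead, in either order, with given difference class. -/
theorem pairSum_total (D : ℤ) :
    pairSum e N (gapBead d h D) + pairSum e N (beadGap d h (-D)) =
      ∑ p ∈ Finset.Ico (-(N : ℤ)) N,
        if h (p + 1) = h p + 1 then rsum e (-N) N p (beadInd d h (h p + D)) else 0 := by
  have e1 : pairSum e N (beadGap d h (-D)) = ∑ p ∈ Finset.Ico (-(N : ℤ)) N,
      ∑ q ∈ Finset.Ico (-(N : ℤ)) N,
        if q < p ∧ (e : ℤ) ∣ q - p then gapBead d h D p q else 0 := by
    unfold pairSum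
    rw [Finset.sum_comm]
    refine Finset.sum_congr rfl fun p _ => Finset.sum_congr rfl fun q _ => ?_
    have e2 : beadGap d h (-D) q p = gapBead d h D p q := by
      unfold beadGap gapBead
      refine if_congr ?_ rfl rfl
      rw [show h p - h q - -D = -(h q - h p - D) by ring, dvd_neg]
      exact ⟨fun ⟨a, b, c⟩ => ⟨b, a, c⟩, fun ⟨a, b, c⟩ => ⟨b, a, c⟩⟩
    rw [e2]
    exact if_congr (by rw [show p - q = -(q - p) by ring, dvd_neg]) rfl rfl
  rw [e1]
  unfold pairSum
  rw [← Finset.sum_add_distrib]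
  refine Finset.sum_congr rfl fun p _ => ?_
  rw [← Finset.sum_add_distrib]
  by_cases hp : h (p + 1) = h p + 1
  · rw [if_pos hp]
    unfold rsum
    rw [Finset.sum_filter]
    refine Finset.sum_congr rfl fun q _ => ?_
    have e3 : gapBead d h D p q = beadInd d h (h p + D) q := by
      unfold gapBead beadInd
      rw [show h q - (h p + D) = h q - h p - D by ring]
      simp [hp]
    rw [e3]
    rcases lt_trichotomy p q with hlt | heq | hgt
    · simp [hlt, hlt.not_gt]
    · subst heq
      have : beadInd d h (h p + D) p = 0 := by
        unfold beadInd; rw [if_neg (by omega)]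
      simp [this]
    · simp [hgt, hgt.not_gt]
  · rw [if_neg hp]
    refine Finset.sum_eq_zero fun q _ => ?_
    have : gapBead d h D p q = 0 := by
      unfold gapBead; rw [if_neg (fun hh => hp hh.1)]
    simp [this]

/-- A sum over the gaps of a function of their vertices is determined by the numbers of gaps at
the vertices. -/
theorem sum_gaps_eq (hd : 0 < d) (he : 0 < e) (b : ℤ → ℤ → ℤ)
    (hb1 : ∀ x x' y, (d : ℤ) ∣ x - x' → b x y = b x' y)
    (hb2 : ∀ x y y', (e : ℤ) ∣ y - y' → b x y = b x y') :
    ∑ p ∈ Finset.Ico (-(N : ℤ)) N, (if h (p + 1) = h p + 1 then b (h p) p else 0) =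
      ∑ y ∈ Finset.range e, ∑ x ∈ Finset.range d, b x y * rsum e (-N) N y (gapInd d h x) := by
  have hd' : (0 : ℤ) < d := by exact_mod_cast hd
  rw [← sum_rsum he]
  refine Finset.sum_congr rfl fun y _ => ?_
  unfold rsum
  simp only [Finset.mul_sum]
  rw [Finset.sum_comm]
  refine Finset.sum_congr rfl fun q hq => ?_
  have hqy := (Finset.mem_filter.1 hq).2
  split_ifs with hg
  · have h2 := Int.emod_nonneg (h q) hd'.ne'
    have h3 := Int.emod_lt_of_pos (h q) hd'
    rw [Finset.sum_eq_single (h q % d).toNat]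
    · have h4 : (d : ℤ) ∣ h q - ((h q % d).toNat : ℤ) := by
        rw [Int.toNat_of_nonneg h2]
        exact Int.dvd_self_sub_emod
      unfold gapInd
      rw [if_pos ⟨hg, h4⟩, mul_one, hb1 _ _ _ h4, hb2 _ _ _ hqy]
    · intro x hx hne
      unfold gapInd
      rw [if_neg, mul_zero]
      rintro ⟨-, hx2⟩
      have hx' := Finset.mem_range.1 hx
      apply hne
      have : h q % d = x := by
        rw [Int.emod_eq_emod_iff_emod_sub_eq_zero.2 (Int.emod_eq_zero_of_dvd hx2)]
        exact Int.emod_eq_of_lt (by omega) (by omega)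
      omega
    · intro hx; exact absurd (Finset.mem_range.2 (by omega)) hx
  · symm
    refine Finset.sum_eq_zero fun x _ => ?_
    unfold gapInd
    rw [if_neg (fun hh => hg hh.1), mul_zero]

/-- The number of hooks of size divisible by `e` whose arm length is `D - 1` or `-D` modulo `d` is
the same for all profiles with the same data and the same area: combine the flux with the total
number of pairs of a gap and a bead. -/
theorem pairSum_invariant (hd : 0 < d) (he : 0 < e) (H : IsProfile N h) (H' : IsProfile N h')
    (h0 : ∀ x y, rsum e (-N) N y (flr d h h' x) = 0) (D : ℤ) :
    pairSum e N (gapBead d h D) + pairSum e N (gapBead d h (1 - D)) =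
      pairSum e N (gapBead d h' D) + pairSum e N (gapBead d h' (1 - D)) := by
  have hs : SameData d e N h h' := ⟨0, h0⟩
  have f1 := pairSum_flux hd H H' h0 (1 - D)
  rw [show 1 - D - 1 = -D by ring] at f1
  have t1 := pairSum_total (d := d) (e := e) (N := N) (h := h) D
  have t2 := pairSum_total (d := d) (e := e) (N := N) (h := h') D
  have c1 : ∀ g, ∀ x x' y : ℤ, (d : ℤ) ∣ x - x' →
      rsum e (-N) N y (beadInd d g (x + D)) = rsum e (-N) N y (beadInd d g (x' + D)) :=
    fun g x x' y hx => rsum_congr fun q _ _ _ => beadInd_congr (by simpa using hx) q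
  have c2 : ∀ g, ∀ x y y' : ℤ, (e : ℤ) ∣ y - y' →
      rsum e (-N) N y (beadInd d g (x + D)) = rsum e (-N) N y' (beadInd d g (x + D)) :=
    fun g x y y' hy => rsum_congr_mod hy
  rw [sum_gaps_eq hd he (fun x y => rsum e (-N) N y (beadInd d h (x + D))) (c1 h) (c2 h)] at t1
  rw [sum_gaps_eq hd he (fun x y => rsum e (-N) N y (beadInd d h' (x + D))) (c1 h') (c2 h')] at t2
  simp only [hs.beads hd H H', hs.gaps hd H H'] at t1
  linarith

theorem pairSum_eq_zero {f : ℤ → ℤ → ℤ} (hf : ∀ p q, p < q → (e : ℤ) ∣ q - p → f p q = 0) :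
    pairSum e N f = 0 := by
  refine Finset.sum_eq_zero fun p _ => Finset.sum_eq_zero fun q _ => ?_
  split_ifs with hh
  · exact hf p q hh.1 hh.2
  · rfl

theorem gapBead_nonneg (D p q : ℤ) : 0 ≤ gapBead d h D p q := by
  unfold gapBead; split_ifs <;> simp

theorem pairSum_pos {f : ℤ → ℤ → ℤ} (hf : ∀ p q, 0 ≤ f p q) {p q : ℤ}
    (hp : -(N : ℤ) ≤ p) (hq : q < N) (hpq : p < q) (hdv : (e : ℤ) ∣ q - p) (hpos : 0 < f p q) :
    0 < pairSum e N f := by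
  unfold pairSum
  have hn : ∀ a b, 0 ≤ if a < b ∧ (e : ℤ) ∣ b - a then f a b else 0 := fun a b => by
    split_ifs <;> simp [hf]
  refine Finset.sum_pos' (fun a _ => Finset.sum_nonneg fun b _ => hn a b)
    ⟨p, Finset.mem_Ico.2 ⟨hp, by omega⟩, ?_⟩
  refine Finset.sum_pos' (fun b _ => hn p b) ⟨q, Finset.mem_Ico.2 ⟨by omega, hq⟩, ?_⟩
  rw [if_pos ⟨hpq, hdv⟩]
  exact hpos

theorem IsProfile.gap_ge (H : IsProfile N h) {p : ℤ} (hp : h (p + 1) = h p + 1) :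
    -(N : ℤ) ≤ p := by
  by_contra hlt
  rw [H.left p (by omega), H.left (p + 1) (by omega)] at hp
  omega

theorem IsProfile.bead_lt (H : IsProfile N h) {p : ℤ} (hp : h (p + 1) = h p) : p < N := by
  by_contra hlt
  rw [H.right p (by omega), H.right (p + 1) (by omega)] at hp
  omega

/-- Consider hooks of size divisible by `e` and arm lengths modulo `d`.  If `h` is balanced, and `h'`
has the same data and area and no hook of arm length `0`, then all the hooks of `h'` have arm length
`-1`: by `pairSum_invariant`, a hook of `h'` of arm length `D - 1` forces `h` to have a hook of arm
length `D - 1` or `-D`. -/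
theorem antibalanced_of_balanced (hd : 0 < d) (he : 0 < e) (H : IsProfile N h)
    (H' : IsProfile N h') (h0 : ∀ x y, rsum e (-N) N y (flr d h h' x) = 0)
    (hbal : ∀ p q, p < q → (e : ℤ) ∣ q - p → h (p + 1) = h p + 1 → h (q + 1) = h q →
      (d : ℤ) ∣ h q - h p - 1)
    (hmin : GapsLast d e h') {p q : ℤ} (hpq : p < q) (hdv : (e : ℤ) ∣ q - p)
    (hp : h' (p + 1) = h' p + 1) (hq : h' (q + 1) = h' q) : (d : ℤ) ∣ h' q - h' p := by
  by_contra hD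
  have hD1 := hmin p q hpq hdv hp hq
  set D := h' q - h' p with hDdef
  have inv := pairSum_invariant hd he H H' h0 D
  have z : ∀ D', ¬(d : ℤ) ∣ D' - 1 → pairSum e N (gapBead d h D') = 0 := by
    intro D' hD'
    refine pairSum_eq_zero fun p q h1 h2 => ?_
    unfold gapBead
    rw [if_neg]
    rintro ⟨h3, h4, h5⟩
    have := dvd_sub (hbal p q h1 h2 h3 h4) h5
    rw [show h q - h p - 1 - (h q - h p - D') = D' - 1 by ring] at this
    exact hD' this
  rw [z D hD1, z (1 - D) (by rwa [show 1 - D - 1 = -D by ring, dvd_neg])] at inv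
  have pos : 0 < pairSum e N (gapBead d h' D) := by
    refine pairSum_pos (gapBead_nonneg D) (H'.gap_ge hp) (H'.bead_lt hq) hpq hdv ?_
    unfold gapBead
    rw [if_pos ⟨hp, hq, by simp [hDdef]⟩]; exact one_pos
  have nn : 0 ≤ pairSum e N (gapBead d h' (1 - D)) := by
    unfold pairSum
    refine Finset.sum_nonneg fun p _ => Finset.sum_nonneg fun q _ => ?_
    split_ifs
    · exact gapBead_nonneg _ _ _
    · exact le_rfl
  linarith

end flux

/-! ### Partitions and their profiles -/

theorem IsProfile.nonneg {N : ℕ} {h : ℤ → ℤ} (H : IsProfile N h) (p : ℤ) : 0 ≤ h p := by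
  rcases le_total p (-(N : ℤ)) with hp | hp
  · exact (H.left p hp).ge
  · rw [← H.left _ le_rfl]; exact H.mono hp

theorem IsProfile.self_le {N : ℕ} {h : ℤ → ℤ} (H : IsProfile N h) (p : ℤ) : p ≤ h p := by
  rcases le_total (N : ℤ) p with hp | hp
  · exact (H.right p hp).ge
  · have := H.anti hp
    simp only [H.right _ le_rfl] at this
    linarith

theorem exists_le_sub_colLen (μ : YoungDiagram) (p : ℤ) : ∃ j : ℕ, p ≤ (j : ℤ) - μ.colLen j := by
  refine ⟨p.toNat + μ.colLen 0, ?_⟩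
  have := μ.colLen_anti 0 (p.toNat + μ.colLen 0) (Nat.zero_le _)
  push_cast
  omega

open Classical in
/-- The profile of `μ`: the number of columns `j` with `j - μ.colLen j < p`.  The boundary of `μ`,
read from the bottom left to the top right, has at `p` a horizontal step (a gap) or a vertical step
(a bead) according as the profile increases between `p` and `p + 1` or not. -/
noncomputable def prof (μ : YoungDiagram) (p : ℤ) : ℤ := Nat.find (exists_le_sub_colLen μ p)

theorem lt_prof_iff (μ : YoungDiagram) (p : ℤ) (j : ℕ) :
    (j : ℤ) < prof μ p ↔ (j : ℤ) - μ.colLen j < p := by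
  classical
  unfold prof
  rw [Nat.cast_lt, Nat.lt_find_iff]
  constructor
  · intro h; simpa using h j le_rfl
  · intro h m hm
    have := μ.colLen_anti m j hm
    push Not
    omega

theorem prof_nonneg (μ : YoungDiagram) (p : ℤ) : 0 ≤ prof μ p := by
  unfold prof; positivity

theorem le_prof (μ : YoungDiagram) (p : ℤ) : p ≤ prof μ p := by
  by_contra hlt
  have h0 := prof_nonneg μ p
  have := (lt_prof_iff μ p (prof μ p).toNat).2 (by omega)
  omega

theorem mem_iff_lt_prof (μ : YoungDiagram) (i j : ℕ) :
    (i, j) ∈ μ ↔ (j : ℤ) < prof μ ((j : ℤ) - i) := by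
  rw [lt_prof_iff, YoungDiagram.mem_iff_lt_colLen]; omega

theorem lt_prof_sub_iff (μ : YoungDiagram) (p : ℤ) (i : ℕ) :
    (i : ℤ) < prof μ p - p ↔ p ≤ (μ.rowLen i : ℤ) - i - 1 := by
  have h0 := prof_nonneg μ p
  rcases lt_or_ge (i + p) 0 with h | h
  · constructor <;> intro <;> omega
  · obtain ⟨j, hj⟩ := Int.eq_ofNat_of_zero_le h
    have h1 := lt_prof_iff μ p j
    have h2 : i < μ.colLen j ↔ j < μ.rowLen i := by
      rw [← YoungDiagram.mem_iff_lt_colLen, ← YoungDiagram.mem_iff_lt_rowLen]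
    constructor
    · intro h3
      have := h2.1 (by have := h1.1 (by omega); omega)
      omega
    · intro h3
      have := h1.2 (by have := h2.2 (by omega); omega)
      omega

/-- A bound for the positions at which the profile of `μ` is not that of the empty partition. -/
def bnd (μ : YoungDiagram) : ℕ := μ.colLen 0 + μ.rowLen 0

theorem prof_isProfile (μ : YoungDiagram) {N : ℕ} (hN : bnd μ ≤ N) : IsProfile N (prof μ) := by
  unfold bnd at hN
  refine ⟨fun p => ?_, fun p hp => ?_, fun p hp => ?_⟩
  · have a1 : prof μ p ≤ prof μ (p + 1) := by
      by_contra hlt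
      have h0 := prof_nonneg μ (p + 1)
      have h1 := lt_prof_iff μ p (prof μ (p + 1)).toNat
      have h2 := lt_prof_iff μ (p + 1) (prof μ (p + 1)).toNat
      omega
    have a2 : prof μ (p + 1) ≤ prof μ p + 1 := by
      by_contra hlt
      have h0 := le_prof μ p
      have h1 := lt_prof_sub_iff μ p (prof μ p - p).toNat
      have h2 := lt_prof_sub_iff μ (p + 1) (prof μ p - p).toNat
      omega
    omega
  · have h0 := prof_nonneg μ p
    have h1 := lt_prof_iff μ p 0
    push_cast at h1
    omega
  · have h0 := le_prof μ p
    have h1 := lt_prof_sub_iff μ p 0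
    push_cast at h1
    omega

theorem prof_step (μ : YoungDiagram) (p : ℤ) :
    prof μ (p + 1) = prof μ p ∨ prof μ (p + 1) = prof μ p + 1 :=
  (prof_isProfile μ le_rfl).step p

/-- A profile is determined by the boxes under it. -/
theorem IsProfile.ext {N N' : ℕ} {h h' : ℤ → ℤ} (H : IsProfile N h) (H' : IsProfile N' h')
    (hb : ∀ i j : ℕ, (j : ℤ) < h ((j : ℤ) - i) ↔ (j : ℤ) < h' ((j : ℤ) - i)) : h = h' := by
  have key : ∀ {N N' : ℕ} {h h' : ℤ → ℤ}, IsProfile N h → IsProfile N' h' →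
      (∀ i j : ℕ, (j : ℤ) < h ((j : ℤ) - i) → (j : ℤ) < h' ((j : ℤ) - i)) → ∀ p, h p ≤ h' p := by
    intro N N' h h' H H' hb p
    by_contra hlt
    have h1 := H'.nonneg p
    have h2 := H'.self_le p
    have h3 := hb (h' p - p).toNat (h' p).toNat
    rw [Int.toNat_of_nonneg h1, Int.toNat_of_nonneg (by omega)] at h3
    rw [show h' p - (h' p - p) = p by ring] at h3
    omega
  funext p
  exact le_antisymm (key H H' (fun i j => (hb i j).1) p) (key H' H (fun i j => (hb i j).2) p)

theorem prof_injective {μ ν : YoungDiagram} (h : prof μ = prof ν) : μ = ν := by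
  apply YoungDiagram.ext
  ext ⟨i, j⟩
  rw [YoungDiagram.mem_cells, YoungDiagram.mem_cells, mem_iff_lt_prof, mem_iff_lt_prof, h]

/-- The partition with a given profile. -/
def ofProf {N : ℕ} {h : ℤ → ℤ} (H : IsProfile N h) : YoungDiagram where
  cells := (Finset.range N ×ˢ Finset.range N).filter fun b => (b.2 : ℤ) < h ((b.2 : ℤ) - b.1)
  isLowerSet := by
    rintro ⟨i, j⟩ ⟨i', j'⟩ ⟨h1, h2⟩ hm
    simp only [Finset.coe_filter, Finset.mem_product, Finset.mem_range, Set.mem_ofPred_eq] at *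
    refine ⟨⟨by omega, by omega⟩, ?_⟩
    have m1 : h ((j : ℤ) - i) ≤ h ((j : ℤ) - i') := H.mono (by omega)
    have m2 := H.anti (show (j' : ℤ) - i' ≤ j - i' by omega)
    simp only at m2
    omega

theorem mem_ofProf {N : ℕ} {h : ℤ → ℤ} (H : IsProfile N h) (i j : ℕ) :
    (i, j) ∈ ofProf H ↔ (j : ℤ) < h ((j : ℤ) - i) := by
  rw [← YoungDiagram.mem_cells]
  simp only [ofProf, Finset.mem_filter, Finset.mem_product, Finset.mem_range, and_iff_right_iff_imp]
  intro hj
  have h1 : (j : ℤ) - i ≤ N := by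
    by_contra hlt
    rw [H.right _ (by omega)] at hj
    omega
  have h2 : -(N : ℤ) ≤ (j : ℤ) - i := by
    by_contra hlt
    rw [H.left _ (by omega)] at hj
    omega
  have m1 := H.mono h1
  have m2 := H.anti h2
  simp only [H.right _ le_rfl, H.left _ le_rfl] at m1 m2
  omega

theorem prof_ofProf {N : ℕ} {h : ℤ → ℤ} (H : IsProfile N h) : prof (ofProf H) = h :=
  (prof_isProfile _ le_rfl).ext H fun i j => by rw [← mem_iff_lt_prof, mem_ofProf]

theorem prof_transpose (μ : YoungDiagram) (p : ℤ) : prof μ.transpose p = prof μ (-p) + p := by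
  have H0 := prof_isProfile μ le_rfl
  have H : IsProfile (bnd μ) (fun p : ℤ => prof μ (-p) + p) := by
    refine ⟨fun p => ?_, fun p hp => ?_, fun p hp => ?_⟩
    · have := H0.step (-(p + 1))
      rw [show -(p + 1) + 1 = -p by ring] at this
      omega
    · rw [H0.right _ (by omega)]; ring
    · rw [H0.left _ (by omega)]; ring
  have := (prof_isProfile μ.transpose le_rfl).ext H fun i j => by
    rw [← mem_iff_lt_prof, YoungDiagram.mem_transpose]
    change (j, i) ∈ μ ↔ _
    rw [mem_iff_lt_prof, show -((j : ℤ) - i) = i - j by ring]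
    omega
  rw [this]

/-! ### Rows, columns and hooks -/

/-- The position of the bead of row `i`. -/
def beadPos (μ : YoungDiagram) (i : ℕ) : ℤ := (μ.rowLen i : ℤ) - i - 1

/-- The position of the gap of column `j`. -/
def gapPos (μ : YoungDiagram) (j : ℕ) : ℤ := (j : ℤ) - μ.colLen j

theorem lt_prof_iff_gapPos (μ : YoungDiagram) (p : ℤ) (j : ℕ) :
    (j : ℤ) < prof μ p ↔ gapPos μ j < p := lt_prof_iff μ p j

theorem lt_prof_sub_iff_beadPos (μ : YoungDiagram) (p : ℤ) (i : ℕ) :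
    (i : ℤ) < prof μ p - p ↔ p ≤ beadPos μ i := lt_prof_sub_iff μ p i

theorem prof_beadPos (μ : YoungDiagram) (i : ℕ) :
    prof μ (beadPos μ i) = μ.rowLen i ∧ prof μ (beadPos μ i + 1) = μ.rowLen i := by
  have h1 := lt_prof_sub_iff_beadPos μ (beadPos μ i) i
  have h2 := lt_prof_sub_iff_beadPos μ (beadPos μ i + 1) i
  have h3 := prof_step μ (beadPos μ i)
  unfold beadPos at *
  omega

theorem prof_gapPos (μ : YoungDiagram) (j : ℕ) :
    prof μ (gapPos μ j) = j ∧ prof μ (gapPos μ j + 1) = j + 1 := by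
  have h1 := lt_prof_iff_gapPos μ (gapPos μ j) j
  have h2 := lt_prof_iff_gapPos μ (gapPos μ j + 1) j
  have h3 := prof_step μ (gapPos μ j)
  omega

theorem exists_beadPos {μ : YoungDiagram} {p : ℤ} (hp : prof μ (p + 1) = prof μ p) :
    ∃ i, beadPos μ i = p := by
  have h0 := le_prof μ (p + 1)
  refine ⟨(prof μ p - p - 1).toNat, ?_⟩
  have h1 := lt_prof_sub_iff_beadPos μ p (prof μ p - p - 1).toNat
  have h2 := lt_prof_sub_iff_beadPos μ (p + 1) (prof μ p - p - 1).toNat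
  omega

theorem exists_gapPos {μ : YoungDiagram} {p : ℤ} (hp : prof μ (p + 1) = prof μ p + 1) :
    ∃ j, gapPos μ j = p := by
  have h0 := prof_nonneg μ p
  refine ⟨(prof μ p).toNat, ?_⟩
  have h1 := lt_prof_iff_gapPos μ p (prof μ p).toNat
  have h2 := lt_prof_iff_gapPos μ (p + 1) (prof μ p).toNat
  omega

theorem mem_iff_gapPos_lt (μ : YoungDiagram) (i j : ℕ) :
    (i, j) ∈ μ ↔ gapPos μ j < beadPos μ i := by
  have h1 := prof_beadPos μ i
  rw [YoungDiagram.mem_iff_lt_rowLen]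
  have h2 := lt_prof_iff_gapPos μ (beadPos μ i) j
  rw [h1.1] at h2
  omega

/-- The rim boxes are those under the profile, one for each content. -/
theorem mem_rim_iff (μ : YoungDiagram) (i j : ℕ) :
    ((i, j) ∈ μ ∧ (i + 1, j + 1) ∉ μ) ↔ (j : ℤ) + 1 = prof μ ((j : ℤ) - i) := by
  rw [mem_iff_lt_prof, mem_iff_lt_prof]
  push_cast
  rw [show (j : ℤ) + 1 - (i + 1) = j - i by ring]
  omega

theorem mem_rimHook_iff (μ : YoungDiagram) (c : ℕ × ℕ) (i j : ℕ) :
    (i, j) ∈ rimHook μ c ↔ (j : ℤ) + 1 = prof μ ((j : ℤ) - i) ∧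
      gapPos μ c.2 < (j : ℤ) - i ∧ (j : ℤ) - i ≤ beadPos μ c.1 := by
  have h1 := mem_rim_iff μ i j
  have h2 := lt_prof_iff_gapPos μ ((j : ℤ) - i) c.2
  have h3 := lt_prof_sub_iff_beadPos μ ((j : ℤ) - i) c.1
  simp only [rimHook, Finset.mem_filter, YoungDiagram.mem_cells]
  constructor
  · rintro ⟨a, b, c', f⟩
    have := h1.1 ⟨a, f⟩
    omega
  · rintro ⟨a, b, c'⟩
    have := h1.2 a
    exact ⟨this.1, by omega, by omega, this.2⟩

/-- A set of rim boxes is counted by its contents. -/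
theorem card_rim_contents (μ : YoungDiagram) (S : Finset (ℕ × ℕ)) (U : Finset ℤ)
    (hS : ∀ i j : ℕ, (i, j) ∈ S ↔ (j : ℤ) + 1 = prof μ ((j : ℤ) - i) ∧ (j : ℤ) - i ∈ U)
    (hU : ∀ q ∈ U, 0 < prof μ q ∧ q < prof μ q) : S.card = U.card := by
  refine Finset.card_bij (fun b _ => (b.2 : ℤ) - b.1) ?_ ?_ ?_
  · rintro ⟨i, j⟩ hb; exact ((hS i j).1 hb).2
  · rintro ⟨i, j⟩ hb ⟨i', j'⟩ hb' heq
    have h1 := ((hS i j).1 hb).1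
    have h2 := ((hS i' j').1 hb').1
    simp only at heq
    rw [heq] at h1
    simp only [Prod.mk.injEq]
    omega
  · intro q hq
    obtain ⟨h1, h2⟩ := hU q hq
    refine ⟨((prof μ q - 1 - q).toNat, (prof μ q - 1).toNat), ?_, ?_⟩
    · rw [hS]
      rw [Int.toNat_of_nonneg (by omega), Int.toNat_of_nonneg (by omega)]
      rw [show prof μ q - 1 - (prof μ q - 1 - q) = q by ring]
      exact ⟨by ring, hq⟩
    · simp only
      omega

/-- Removing rim boxes lowers the profile by one at their contents. -/
theorem prof_sdiff {μ ν : YoungDiagram} {S : Finset (ℕ × ℕ)} {U : Finset ℤ}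
    (hν : ν.cells = μ.cells \ S)
    (hS : ∀ i j : ℕ, (i, j) ∈ S ↔ (j : ℤ) + 1 = prof μ ((j : ℤ) - i) ∧ (j : ℤ) - i ∈ U)
    (hU : ∀ q ∈ U, 0 < prof μ q ∧ q < prof μ q) (q : ℤ) :
    prof ν q = prof μ q - if q ∈ U then 1 else 0 := by
  have hm : ∀ i j : ℕ, (i, j) ∈ ν ↔ (i, j) ∈ μ ∧ (i, j) ∉ S := fun i j => by
    rw [← YoungDiagram.mem_cells, hν, Finset.mem_sdiff, YoungDiagram.mem_cells]
  -- the boxes of content `q`, as a statement about their columns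
  have key : ∀ j : ℕ, q ≤ j → ((j : ℤ) < prof ν q ↔ (j : ℤ) < prof μ q ∧
      ¬((j : ℤ) + 1 = prof μ q ∧ q ∈ U)) := by
    intro j hj
    have := hm ((j : ℤ) - q).toNat j
    rw [mem_iff_lt_prof, mem_iff_lt_prof, hS, Int.toNat_of_nonneg (by omega),
      show (j : ℤ) - (j - q) = q by ring] at this
    exact this
  have a1 := prof_nonneg ν q
  have a2 := le_prof ν q
  have a3 := prof_nonneg μ q
  have a4 := le_prof μ q
  have k1 := key (prof ν q).toNat (by omega)
  rw [Int.toNat_of_nonneg a1] at k1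
  have k3 : prof ν q ≤ prof μ q := by
    by_contra hlt
    have := key (prof μ q).toNat (by omega)
    omega
  split_ifs with hq
  · have hU' := hU q hq
    have k2 := key (prof μ q - 1).toNat (by omega)
    rw [Int.toNat_of_nonneg (by omega)] at k2
    have : ¬ (prof μ q - 1 < prof ν q) := fun hh => (k2.1 hh).2 ⟨by ring, hq⟩
    by_contra hne
    exact lt_irrefl _ (k1.2 ⟨by omega, by omega⟩)
  · by_contra hne
    exact lt_irrefl _ (k1.2 ⟨by omega, by tauto⟩)

theorem rimHook_contents {μ : YoungDiagram} {c : ℕ × ℕ} (q : ℤ)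
    (hq : q ∈ Finset.Ioc (gapPos μ c.2) (beadPos μ c.1)) : 0 < prof μ q ∧ q < prof μ q := by
  rw [Finset.mem_Ioc] at hq
  have h2 := lt_prof_iff_gapPos μ q c.2
  have h3 := lt_prof_sub_iff_beadPos μ q c.1
  omega

theorem mem_rimHook_iff' (μ : YoungDiagram) (c : ℕ × ℕ) (i j : ℕ) :
    (i, j) ∈ rimHook μ c ↔ (j : ℤ) + 1 = prof μ ((j : ℤ) - i) ∧
      (j : ℤ) - i ∈ Finset.Ioc (gapPos μ c.2) (beadPos μ c.1) := by
  rw [mem_rimHook_iff, Finset.mem_Ioc]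

theorem card_rimHook {μ : YoungDiagram} {c : ℕ × ℕ} (hc : c ∈ μ.cells) :
    ((rimHook μ c).card : ℤ) = beadPos μ c.1 - gapPos μ c.2 := by
  rw [card_rim_contents μ _ _ (mem_rimHook_iff' μ c) rimHook_contents, Int.card_Ioc]
  have := (mem_iff_gapPos_lt μ c.1 c.2).1 hc
  omega

theorem isBalanced_iff {d e : ℕ} {μ : YoungDiagram} : IsBalanced d e μ ↔
    ∀ p q, p < q → (e : ℤ) ∣ q - p → prof μ (p + 1) = prof μ p + 1 → prof μ (q + 1) = prof μ q →
      (d : ℤ) ∣ prof μ q - prof μ p - 1 := by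
  have arm : ∀ i j, (i, j) ∈ μ → (armLength μ (i, j) ≡ 0 [MOD d] ↔
      (d : ℤ) ∣ prof μ (beadPos μ i) - prof μ (gapPos μ j) - 1) := by
    intro i j hm
    have := YoungDiagram.mem_iff_lt_rowLen.1 hm
    rw [Nat.modEq_zero_iff_dvd, ← Int.natCast_dvd_natCast, (prof_beadPos μ i).1,
      (prof_gapPos μ j).1]
    simp only [armLength]
    rw [Nat.cast_sub (by omega)]
    push_cast
    rw [show (μ.rowLen i : ℤ) - (j + 1) = μ.rowLen i - j - 1 by ring]
  constructor
  · intro hb p q hpq hdv hp hq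
    obtain ⟨i, rfl⟩ := exists_beadPos hq
    obtain ⟨j, rfl⟩ := exists_gapPos hp
    have hm := (mem_iff_gapPos_lt μ i j).2 hpq
    refine (arm i j hm).1 (hb (i, j) hm ?_)
    rw [← Int.natCast_dvd_natCast, card_rimHook (c := (i, j)) hm]
    exact hdv
  · rintro hb ⟨i, j⟩ hm hdv
    rw [← Int.natCast_dvd_natCast, card_rimHook hm] at hdv
    exact (arm i j hm).2 (hb _ _ ((mem_iff_gapPos_lt μ i j).1 hm) hdv
      ((prof_gapPos μ j).2.trans (by rw [(prof_gapPos μ j).1]))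
      ((prof_beadPos μ i).2.trans (prof_beadPos μ i).1.symm))

theorem isCore_iff {e : ℕ} (he : 0 < e) {μ : YoungDiagram} : IsCore e μ ↔
    ∀ p, prof μ (p + 1) = prof μ p + 1 → prof μ (p + e + 1) = prof μ (p + e) + 1 := by
  constructor
  · intro hc p hp
    refine (prof_step μ (p + e)).resolve_left fun hq => ?_
    obtain ⟨i, hi⟩ := exists_beadPos hq
    obtain ⟨j, rfl⟩ := exists_gapPos hp
    have hm := (mem_iff_gapPos_lt μ i j).2 (by omega)
    refine hc (i, j) hm ?_
    have := card_rimHook (c := (i, j)) hm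
    simp only at this
    omega
  · rintro hp ⟨i, j⟩ hm hcard
    have h1 := card_rimHook hm
    simp only at h1
    have h2 := hp _ ((prof_gapPos μ j).2.trans (by rw [(prof_gapPos μ j).1]))
    rw [show gapPos μ j + e = beadPos μ i by omega, (prof_beadPos μ i).1, (prof_beadPos μ i).2] at h2
    omega

theorem IsCore.beadsFirst {e : ℕ} (he : 0 < e) {μ : YoungDiagram} (hμ : IsCore e μ) :
    BeadsFirst 1 e (prof μ) := by
  rw [isCore_iff he] at hμ
  intro p q hpq hdv hp hq
  exfalso
  obtain ⟨k, hk⟩ := hdv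
  have key : ∀ k : ℕ, prof μ (p + e * k + 1) = prof μ (p + e * k) + 1 := by
    intro k
    induction k with
    | zero => simpa using hp
    | succ k ih =>
      have := hμ _ ih
      push_cast
      rw [mul_add, mul_one, ← add_assoc]
      exact this
  have hk0 : 0 ≤ k := by
    by_contra hlt
    have : (e : ℤ) * k < 0 := mul_neg_of_pos_of_neg (by exact_mod_cast he) (by omega)
    omega
  have := key k.toNat
  rw [Int.toNat_of_nonneg hk0, ← hk] at this
  rw [show p + (q - p) = q by ring] at this
  omega

/-- A partition is `e`-regular if its profile has no run of `e` beads at a positive value. -/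
theorem isRegular_of_prof {e : ℕ} (he : 0 < e) {μ : YoungDiagram}
    (hr : ∀ q, 0 < prof μ q → prof μ (q + e) ≠ prof μ q) : IsRegular e μ := by
  intro x
  by_contra hge
  push Not at hge
  have h1 : μ.rowLens.count x = ((Finset.range (μ.colLen 0)).filter fun i => μ.rowLen i = x).card := by
    unfold YoungDiagram.rowLens
    rw [List.count, List.countP_map, List.countP_eq_length_filter]
    change _ = (List.filter (fun i => decide (μ.rowLen i = x)) (List.range (μ.colLen 0))).length
    congr 1
  rw [h1] at hge
  set S := (Finset.range (μ.colLen 0)).filter fun i => μ.rowLen i = x with hS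
  have hne : S.Nonempty := Finset.card_pos.1 (by omega)
  have h2 : S ⊆ Finset.Icc (S.min' hne) (S.max' hne) := fun i hi =>
    Finset.mem_Icc.2 ⟨S.min'_le i hi, S.le_max' i hi⟩
  have h3 := Finset.card_le_card h2
  rw [Nat.card_Icc] at h3
  have m1 := Finset.mem_filter.1 (S.min'_mem hne)
  have m2 := Finset.mem_filter.1 (S.max'_mem hne)
  set a := S.min' hne
  set b := S.max' hne
  have b1 := prof_beadPos μ a
  have b2 := prof_beadPos μ b
  have hab : a ≤ b := S.min'_le_max' hne |> fun h => h
  have h4 : beadPos μ b + e ≤ beadPos μ a + 1 := by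
    unfold beadPos; rw [m1.2, m2.2]; omega
  have H := prof_isProfile μ le_rfl
  have h5 := H.mono h4
  have h6 := H.mono (show beadPos μ b ≤ beadPos μ b + e by omega)
  have hx : 0 < x := by
    have := Finset.mem_range.1 m1.1
    rw [← YoungDiagram.mem_iff_lt_colLen, YoungDiagram.mem_iff_lt_rowLen, m1.2] at this
    exact this
  refine hr (beadPos μ b) ?_ ?_ <;> omega

theorem runnerMatrix_eq {d e : ℕ} {μ : YoungDiagram} {N : ℕ} (H : IsProfile N (prof μ))
    (x : Fin (d - 1)) (y : Fin e) : (runnerMatrix d e μ x y : ℤ) =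
      rsum e (-N) N (y : ℕ) (beadInd d (prof μ) ((x : ℕ) + 1 : ℕ)) := by
  unfold rsum beadInd runnerMatrix
  rw [Finset.sum_boole, Nat.cast_inj]
  refine Finset.card_bij (fun i _ => beadPos μ i) ?_ ?_ ?_
  · intro i hi
    simp only [Finset.mem_filter, Finset.mem_range] at hi ⊢
    obtain ⟨-, h1, h2⟩ := hi
    have hb := prof_beadPos μ i
    rw [← Int.natCast_modEq_iff] at h1 h2
    have hbd : prof μ (beadPos μ i + 1) = prof μ (beadPos μ i) := by rw [hb.1, hb.2]
    refine ⟨⟨Finset.mem_Ico.2 ⟨?_, H.bead_lt hbd⟩, ?_⟩, hbd, ?_⟩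
    · by_contra hlt
      have h3 := hb.1
      rw [H.left _ (by omega)] at h3
      have h4 := h1.symm.dvd
      have h5 : (d : ℤ) ∣ ((x : ℕ) + 1 : ℕ) := by
        rw [← h3, zero_sub, dvd_neg] at h4
        exact h4
      have h6 := Nat.le_of_dvd (by omega) (Int.natCast_dvd_natCast.1 h5)
      have := x.2
      omega
    · have h4 := h2.symm.dvd
      unfold beadPos
      rw [show (μ.rowLen i : ℤ) - i - 1 - (y : ℕ) = μ.rowLen i - ((i + 1 + (y : ℕ) : ℕ) : ℤ) by
        push_cast; ring]
      exact h4
    · rw [hb.1]; exact_mod_cast h1.symm.dvd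
  · intro i _ k _ hik
    have h1 := prof_beadPos μ i
    have h2 := prof_beadPos μ k
    rw [hik] at h1
    unfold beadPos at hik
    omega
  · intro q hq
    simp only [Finset.mem_filter, Finset.mem_Ico] at hq
    obtain ⟨⟨-, h1⟩, h2, h3⟩ := hq
    obtain ⟨i, rfl⟩ := exists_beadPos h2
    refine ⟨i, ?_, rfl⟩
    rw [(prof_beadPos μ i).1] at h3
    simp only [Finset.mem_filter, Finset.mem_range]
    refine ⟨?_, ?_, ?_⟩
    · rw [← YoungDiagram.mem_iff_lt_colLen, YoungDiagram.mem_iff_lt_rowLen]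
      by_contra h0
      have h4 : μ.rowLen i = 0 := by omega
      rw [h4] at h3
      have h5 : (d : ℤ) ∣ ((x : ℕ) + 1 : ℕ) := by
        rwa [Nat.cast_zero, zero_sub, dvd_neg] at h3
      have h6 := Nat.le_of_dvd (by omega) (Int.natCast_dvd_natCast.1 h5)
      have := x.2
      omega
    · rw [← Int.natCast_modEq_iff]
      exact (Int.modEq_iff_dvd.2 (by exact_mod_cast h3)).symm
    · rw [← Int.natCast_modEq_iff]
      refine (Int.modEq_iff_dvd.2 ?_).symm
      unfold beadPos at h1
      rw [show (μ.rowLen i : ℤ) - ((i + 1 + (y : ℕ) : ℕ) : ℤ) = (μ.rowLen i : ℤ) - i - 1 - (y : ℕ) by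
        push_cast; ring]
      exact h1

theorem card_eq_sum {μ : YoungDiagram} {N : ℕ} (H : IsProfile N (prof μ)) :
    (μ.card : ℤ) = ∑ q ∈ Finset.Ico (-(N : ℤ)) N, (prof μ q - max 0 q) := by
  have h1 : μ.cells.card = ∑ q ∈ Finset.Ico (-(N : ℤ)) N,
      (μ.cells.filter fun b => (b.2 : ℤ) - b.1 = q).card := by
    refine Finset.card_eq_sum_card_fiberwise ?_
    rintro ⟨i, j⟩ hm
    have hm' := (mem_iff_lt_prof μ i j).1 hm
    simp only [Finset.coe_Ico, Set.mem_Ico]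
    constructor
    · by_contra hlt
      rw [H.left _ (by omega)] at hm'
      omega
    · by_contra hlt
      rw [H.right _ (by omega)] at hm'
      omega
  change ((μ.cells.card : ℕ) : ℤ) = _
  rw [h1]
  push_cast
  refine Finset.sum_congr rfl fun q _ => ?_
  have h2 : (μ.cells.filter fun b => (b.2 : ℤ) - b.1 = q).card =
      (Finset.Ico (max 0 q) (prof μ q)).card := by
    refine Finset.card_bij (fun b _ => (b.2 : ℤ)) ?_ ?_ ?_
    · rintro ⟨i, j⟩ hb
      simp only [Finset.mem_filter, YoungDiagram.mem_cells, Finset.mem_Ico] at hb ⊢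
      obtain ⟨hm, rfl⟩ := hb
      exact ⟨by omega, (mem_iff_lt_prof μ i j).1 hm⟩
    · rintro ⟨i, j⟩ hb ⟨i', j'⟩ hb' heq
      simp only [Finset.mem_filter, Prod.mk.injEq] at *
      omega
    · intro j hj
      rw [Finset.mem_Ico] at hj
      refine ⟨((j - q).toNat, j.toNat), ?_, ?_⟩
      · simp only [Finset.mem_filter, YoungDiagram.mem_cells, mem_iff_lt_prof]
        rw [Int.toNat_of_nonneg (by omega), Int.toNat_of_nonneg (by omega),
          show j - (j - q) = q by ring]
        exact ⟨hj.2, rfl⟩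
      · simp only; omega
  rw [h2, Int.card_Ico]
  have := prof_nonneg μ q
  have := le_prof μ q
  omega

/-! ### Dominance -/

/-- Both sides count the boxes of the first `k` rows of `μ`, each row being extended or shortened so
as to begin at the content `q`. -/
theorem sum_beadPos {μ : YoungDiagram} {M : ℕ} (H : IsProfile M (prof μ)) (q : ℤ) (k : ℕ) :
    ∑ i ∈ Finset.range k, max 0 (beadPos μ i - q + 1) =
      ∑ p ∈ Finset.Ico q M, min (k : ℤ) (prof μ p - p) := by
  have h1 : ∀ i : ℕ, max 0 (beadPos μ i - q + 1) =
      ∑ p ∈ Finset.Ico q (M : ℤ), if p ≤ beadPos μ i then 1 else 0 := by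
    intro i
    have hlt : beadPos μ i < M := H.bead_lt (by rw [(prof_beadPos μ i).1, (prof_beadPos μ i).2])
    rw [Finset.sum_boole, show (Finset.Ico q (M : ℤ)).filter (fun p => p ≤ beadPos μ i) =
      Finset.Ico q (beadPos μ i + 1) by
        ext p; simp only [Finset.mem_filter, Finset.mem_Ico]; omega, Int.card_Ico]
    omega
  simp only [h1]
  rw [Finset.sum_comm]
  refine Finset.sum_congr rfl fun p _ => ?_
  rw [Finset.sum_boole]
  have := le_prof μ p
  have h2 : (Finset.range k).filter (fun i => p ≤ beadPos μ i) =
      Finset.range (min k (prof μ p - p).toNat) := by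
    ext i
    simp only [Finset.mem_filter, Finset.mem_range, ← lt_prof_sub_iff_beadPos]
    omega
  rw [h2, Finset.card_range]
  omega

theorem dominatedBy_of_sum_le {μ ν : YoungDiagram} {N : ℕ} (H : IsProfile N (prof μ))
    (H' : IsProfile N (prof ν)) (hcard : μ.card = ν.card)
    (hle : ∀ p, ∑ q ∈ Finset.Ico p (N : ℤ), prof μ q ≤ ∑ q ∈ Finset.Ico p (N : ℤ), prof ν q) :
    DominatedBy μ ν := by
  refine ⟨hcard, fun k => ?_⟩
  set q := beadPos ν k + 1 with hq
  have hs : ∀ μ : YoungDiagram, ∑ i ∈ Finset.range k, (beadPos μ i - q + 1) =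
      ((∑ i ∈ Finset.range k, μ.rowLen i : ℕ) : ℤ) + ∑ i ∈ Finset.range k, (-(i : ℤ) - q) := by
    intro μ
    push_cast
    rw [← Finset.sum_add_distrib]
    refine Finset.sum_congr rfl fun i _ => ?_
    unfold beadPos; ring
  have h1 : ∑ i ∈ Finset.range k, (beadPos μ i - q + 1) ≤
      ∑ p ∈ Finset.Ico q (N : ℤ), (prof μ p - p) := by
    calc _ ≤ ∑ i ∈ Finset.range k, max 0 (beadPos μ i - q + 1) :=
          Finset.sum_le_sum fun i _ => le_max_right _ _
      _ = _ := sum_beadPos H q k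
      _ ≤ _ := Finset.sum_le_sum fun p _ => min_le_right _ _
  have h2 : ∑ i ∈ Finset.range k, (beadPos ν i - q + 1) =
      ∑ p ∈ Finset.Ico q (N : ℤ), (prof ν p - p) := by
    have e1 : ∑ i ∈ Finset.range k, (beadPos ν i - q + 1) =
        ∑ i ∈ Finset.range k, max 0 (beadPos ν i - q + 1) := by
      refine Finset.sum_congr rfl fun i hi => ?_
      have h3 := ν.rowLen_anti i k (Finset.mem_range.1 hi).le
      have h4 := Finset.mem_range.1 hi
      rw [hq]; unfold beadPos
      omega
    rw [e1, sum_beadPos H' q k]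
    refine Finset.sum_congr rfl fun p hp => min_eq_right ?_
    have h3 := lt_prof_sub_iff_beadPos ν p k
    have h4 := (Finset.mem_Ico.1 hp).1
    omega
  have h3 := hle q
  rw [hs] at h1 h2
  rw [Finset.sum_sub_distrib _ fun p : ℤ => p] at h1 h2
  have : ((∑ i ∈ Finset.range k, μ.rowLen i : ℕ) : ℤ) ≤ (∑ i ∈ Finset.range k, ν.rowLen i : ℕ) := by
    linarith
  exact_mod_cast this

theorem DominatedBy.antisymm {μ ν : YoungDiagram} (h : DominatedBy μ ν) (h' : DominatedBy ν μ) :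
    μ = ν := by
  have hs := fun k => le_antisymm (h.2 k) (h'.2 k)
  have hr : ∀ k, μ.rowLen k = ν.rowLen k := by
    intro k
    have h1 := hs (k + 1)
    rw [Finset.sum_range_succ, Finset.sum_range_succ, hs k] at h1
    omega
  apply YoungDiagram.ext
  ext ⟨i, j⟩
  rw [YoungDiagram.mem_cells, YoungDiagram.mem_cells, YoungDiagram.mem_iff_lt_rowLen,
    YoungDiagram.mem_iff_lt_rowLen, hr]

/-! ### Cores and weights -/

/-- Every residue class meets an interval of length `e` once. -/
theorem rsum_indicator {e : ℕ} (he : 0 < e) {A B g : ℤ} (hA : A ≤ g + 1) (hB : g + e < B) (y : ℤ) :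
    rsum e A B y (fun q => if q ∈ Finset.Ioc g (g + e) then 1 else 0) = 1 := by
  have he' : (0 : ℤ) < e := by exact_mod_cast he
  have h2 := Int.emod_nonneg (y - g - 1) he'.ne'
  have h3 := Int.emod_lt_of_pos (y - g - 1) he'
  have hdv : (e : ℤ) ∣ (y - g - 1) - (y - g - 1) % e := Int.dvd_self_sub_emod
  unfold rsum
  rw [Finset.sum_eq_single (g + 1 + (y - g - 1) % e)]
  · rw [if_pos]; rw [Finset.mem_Ioc]; omega
  · intro q hq hne
    rw [if_neg]
    intro hq'
    rw [Finset.mem_Ioc] at hq'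
    have hdv2 : (e : ℤ) ∣ q - (g + 1 + (y - g - 1) % e) := by
      rw [show q - (g + 1 + (y - g - 1) % e) = (q - y) + ((y - g - 1) - (y - g - 1) % e) by ring]
      exact dvd_add (Finset.mem_filter.1 hq).2 hdv
    apply hne
    by_contra hne'
    have := Int.eq_zero_of_abs_lt_dvd hdv2 (by rw [abs_lt]; omega)
    omega
  · intro hq
    exfalso
    apply hq
    rw [Finset.mem_filter, Finset.mem_Ico]
    refine ⟨by omega, ?_⟩
    rw [show g + 1 + (y - g - 1) % e - y = -((y - g - 1) - (y - g - 1) % e) by ring, dvd_neg]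
    exact hdv

theorem prof_sdiff_rimHook {μ ν : YoungDiagram} {c : ℕ × ℕ}
    (hν : ν.cells = μ.cells \ rimHook μ c) (q : ℤ) :
    prof ν q = prof μ q - if q ∈ Finset.Ioc (gapPos μ c.2) (beadPos μ c.1) then 1 else 0 :=
  prof_sdiff hν (mem_rimHook_iff' μ c) rimHook_contents q

theorem IsProfile.of_le {μ ν : YoungDiagram} {N : ℕ} (H : IsProfile N (prof μ))
    (hle : ∀ q, prof ν q ≤ prof μ q) : IsProfile N (prof ν) := by
  refine ⟨prof_step ν, fun p hp => ?_, fun p hp => ?_⟩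
  · have h1 := hle p
    rw [H.left p hp] at h1
    exact le_antisymm h1 (prof_nonneg ν p)
  · have h1 := hle p
    rw [H.right p hp] at h1
    exact le_antisymm h1 (le_prof ν p)

theorem Removes.prof {e w : ℕ} (he : 0 < e) {μ ν : YoungDiagram} (hr : Removes e w μ ν) {N : ℕ}
    (H : IsProfile N (prof μ)) : IsProfile N (prof ν) ∧
      ∀ y, rsum e (-N) N y (fun q => prof μ q - prof ν q) = w := by
  induction hr with
  | refl μ => exact ⟨H, fun y => rsum_eq_zero fun q _ _ _ => by simp⟩
  | @step w μ ν ρ c hc hsize hν h ih =>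
    have hp := prof_sdiff_rimHook hν
    have H' : IsProfile N (Mullineux.prof ν) := H.of_le fun q => by
      rw [hp]; split_ifs <;> omega
    obtain ⟨H2, ih⟩ := ih H'
    refine ⟨H2, fun y => ?_⟩
    have hcard := card_rimHook hc
    rw [hsize] at hcard
    have h1 : ∀ q, Mullineux.prof μ q - Mullineux.prof ρ q =
        (if q ∈ Finset.Ioc (gapPos μ c.2) (gapPos μ c.2 + e) then 1 else 0) +
          (Mullineux.prof ν q - Mullineux.prof ρ q) := by
      intro q
      rw [hp q, show gapPos μ c.2 + e = beadPos μ c.1 by omega]; ring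
    simp only [h1]
    rw [rsum_add, ih, rsum_indicator he]
    · push_cast; ring
    · have := H.gap_ge ((prof_gapPos μ c.2).2.trans (by rw [(prof_gapPos μ c.2).1]))
      omega
    · have := H.bead_lt ((prof_beadPos μ c.1).2.trans (by rw [(prof_beadPos μ c.1).1]))
      omega

/-- Removing a rim hook leaves a partition. -/
theorem exists_sdiff_rimHook (μ : YoungDiagram) (c : ℕ × ℕ) :
    ∃ ν : YoungDiagram, ν.cells = μ.cells \ rimHook μ c := by
  refine ⟨⟨μ.cells \ rimHook μ c, ?_⟩, rfl⟩
  rintro ⟨i, j⟩ ⟨i', j'⟩ ⟨hi, hj⟩ hm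
  simp only [Finset.coe_sdiff, Set.mem_sdiff, Finset.mem_coe, rimHook, Finset.mem_filter,
    not_and, not_not, YoungDiagram.mem_cells] at hm ⊢
  refine ⟨μ.up_left_mem hi hj hm.1, fun h1 h2 h3 => ?_⟩
  exact μ.up_left_mem (Nat.succ_le_succ hi) (Nat.succ_le_succ hj)
    (hm.2 hm.1 (h2.trans hi) (h3.trans hj))

theorem exists_hasCoreWeight {e : ℕ} (he : 0 < e) (μ : YoungDiagram) :
    ∃ γ w, HasCoreWeight e μ γ w := by
  induction hn : μ.card using Nat.strong_induction_on generalizing μ with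
  | _ n ih =>
    by_cases hc : IsCore e μ
    · exact ⟨μ, 0, hc, Removes.refl μ⟩
    · unfold IsCore at hc
      push Not at hc
      obtain ⟨c, hc, hsize⟩ := hc
      obtain ⟨ν, hν⟩ := exists_sdiff_rimHook μ c
      have hlt : ν.card < n := by
        rw [← hn]
        change ν.cells.card < μ.cells.card
        rw [hν]
        have hsub : rimHook μ c ⊆ μ.cells := Finset.filter_subset _ _
        rw [Finset.card_sdiff_of_subset hsub, hsize]
        have := Finset.card_le_card hsub
        omega
      obtain ⟨γ, w, h1, h2⟩ := ih _ hlt ν rfl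
      exact ⟨γ, w + 1, h1, Removes.step c hc hsize hν h2⟩

/-- A `BeadsFirst` profile is determined by its bead counts among the `BeadsFirst` profiles. -/
theorem BeadsFirst.eq {d e N : ℕ} (hd : 0 < d) (he : 0 < e) {h h' : ℤ → ℤ} (H : IsProfile N h)
    (H' : IsProfile N h') (hb : BeadsFirst d e h) (hb' : BeadsFirst d e h')
    (hs : SameData d e N h h') : h = h' := by
  have heq : ∀ p, ∑ q ∈ Finset.Ico (-(N : ℤ)) (p + 1), h q =
      ∑ q ∈ Finset.Ico (-(N : ℤ)) (p + 1), h' q := fun p =>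
    le_antisymm (hb.sum_le hd he H H' (hs.beads hd H H') p)
      (hb'.sum_le hd he H' H (fun x y => (hs.beads hd H H' x y).symm) p)
  funext p
  rcases le_or_gt p (-(N : ℤ)) with hp | hp
  · rw [H.left p hp, H'.left p hp]
  · have h1 := heq p
    have h2 := heq (p - 1)
    rw [← Finset.insert_Ico_right_eq_Ico_add_one hp.le, Finset.sum_insert (by simp),
      Finset.sum_insert (by simp)] at h1
    rw [sub_add_cancel] at h2
    linarith

theorem exists_hasCoreWeight_of_const {e : ℕ} (he : 0 < e) {μ γ : YoungDiagram} {N : ℕ} {c : ℤ}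
    (H : IsProfile N (prof μ)) (Hγ : IsProfile N (prof γ)) (hγ : IsCore e γ)
    (hc : ∀ y, rsum e (-N) N y (fun q => prof μ q - prof γ q) = c) :
    ∃ w : ℕ, HasCoreWeight e μ γ w ∧ (w : ℤ) = c := by
  obtain ⟨γ', w', h3, h4⟩ := exists_hasCoreWeight he μ
  obtain ⟨H', h5⟩ := h4.prof he H
  have hdiff : ∀ y, rsum e (-N) N y (fun q => prof γ' q - prof γ q) = c - w' := by
    intro y
    rw [← hc y, ← h5 y, ← rsum_sub]
    exact rsum_congr fun q _ _ _ => by ring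
  have hs : SameData 1 e N (prof γ') (prof γ) :=
    SameData.of_nonzero one_pos (Nat.coprime_one_left e) H' Hγ
      (fun x h0 h1 => by omega) _ hdiff
  obtain rfl := prof_injective (BeadsFirst.eq one_pos he H' Hγ (h3.beadsFirst he)
    (hγ.beadsFirst he) hs)
  have := hdiff 0
  rw [rsum_eq_zero (fun q _ _ _ => by simp)] at this
  exact ⟨w', ⟨h3, h4⟩, by omega⟩

/-- The core and the weight of a partition are determined by the sums of its profile over the
residue classes. -/
theorem hasCoreWeight_iff {e : ℕ} (he : 0 < e) {μ γ : YoungDiagram} {w N : ℕ}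
    (H : IsProfile N (prof μ)) (Hγ : IsProfile N (prof γ)) : HasCoreWeight e μ γ w ↔
      IsCore e γ ∧ ∀ y, rsum e (-N) N y (fun q => prof μ q - prof γ q) = w := by
  constructor
  · rintro ⟨h1, h2⟩; exact ⟨h1, (h2.prof he H).2⟩
  · rintro ⟨h1, h2⟩
    obtain ⟨w', h3, h4⟩ := exists_hasCoreWeight_of_const he H Hγ h1 h2
    rwa [Nat.cast_inj.1 h4] at h3

theorem HasCoreWeight.isProfile {e w N : ℕ} (he : 0 < e) {μ γ : YoungDiagram}
    (hw : HasCoreWeight e μ γ w) (H : IsProfile N (prof μ)) : IsProfile N (prof γ) :=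
  (hw.2.prof he H).1

/-! ### Minimal sets -/

section minimal

variable {d e N : ℕ}

theorem sum_Ico_split (f : ℤ → ℤ) {a b c : ℤ} (h1 : a ≤ b) (h2 : b ≤ c) :
    ∑ q ∈ Finset.Ico a c, f q = ∑ q ∈ Finset.Ico a b, f q + ∑ q ∈ Finset.Ico b c, f q := by
  rw [← Finset.Ico_union_Ico_eq_Ico h1 h2,
    Finset.sum_union (Finset.Ico_disjoint_Ico_consecutive a b c)]

theorem runnerMatrix_eq_iff (he : 0 < e) {μ ν : YoungDiagram} (H : IsProfile N (prof μ))
    (H' : IsProfile N (prof ν)) : runnerMatrix d e μ = runnerMatrix d e ν ↔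
      ∀ x : ℕ, 0 < x → x < d → ∀ y,
        rsum e (-N) N y (beadInd d (prof μ) x) = rsum e (-N) N y (beadInd d (prof ν) x) := by
  have he' : (0 : ℤ) < e := by exact_mod_cast he
  constructor
  · intro heq x hx0 hxd y
    have h2 := Int.emod_nonneg y he'.ne'
    have h3 := Int.emod_lt_of_pos y he'
    have hr : (y % e).toNat < e := by omega
    have hx : x - 1 < d - 1 := by omega
    have h1 := congrFun (congrFun heq ⟨x - 1, hx⟩) ⟨(y % e).toNat, hr⟩
    have h4 := runnerMatrix_eq H (d := d) ⟨x - 1, hx⟩ ⟨(y % e).toNat, hr⟩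
    have h5 := runnerMatrix_eq H' (d := d) ⟨x - 1, hx⟩ ⟨(y % e).toNat, hr⟩
    rw [h1, h5] at h4
    simp only [Int.toNat_of_nonneg h2, Nat.sub_add_cancel hx0] at h4
    have hdv : (e : ℤ) ∣ y - y % e := Int.dvd_self_sub_emod
    rw [rsum_congr_mod hdv, rsum_congr_mod hdv, h4]
  · intro hb
    ext x y
    have h4 := runnerMatrix_eq H x y
    have h5 := runnerMatrix_eq H' x y
    rw [hb _ (by omega) (by omega), ← h5] at h4
    exact_mod_cast h4

/-- Partitions with the same core and the same runner matrix have the same data. -/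
theorem SameData.of_core (hd : 0 < d) (he : 0 < e) (hcop : Nat.Coprime d e) {μ ν γ : YoungDiagram}
    {w w' : ℕ} (H : IsProfile N (prof μ)) (H' : IsProfile N (prof ν))
    (hμ : HasCoreWeight e μ γ w) (hν : HasCoreWeight e ν γ w')
    (hR : runnerMatrix d e μ = runnerMatrix d e ν) : SameData d e N (prof μ) (prof ν) := by
  refine SameData.of_nonzero hd hcop H H' ((runnerMatrix_eq_iff he H H').1 hR) ((w : ℤ) - w') ?_
  intro y
  rw [← ((hasCoreWeight_iff he H (hμ.isProfile he H)).1 hμ).2 y,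
    ← ((hasCoreWeight_iff he H' (hμ.isProfile he H)).1 hν).2 y, ← rsum_sub]
  exact rsum_congr fun q _ _ _ => by ring

/-- Partitions with the same data have the same core and the same runner matrix. -/
theorem SameData.core (hd : 0 < d) (he : 0 < e) {μ ν γ : YoungDiagram}
    {w : ℕ} (H : IsProfile N (prof μ)) (H' : IsProfile N (prof ν))
    (hμ : HasCoreWeight e μ γ w) (hs : SameData d e N (prof μ) (prof ν)) :
    (∃ w', HasCoreWeight e ν γ w') ∧ runnerMatrix d e μ = runnerMatrix d e ν := by
  refine ⟨?_, (runnerMatrix_eq_iff he H H').2 fun x _ _ y => hs.beads hd H H' x y⟩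
  obtain ⟨c, hc⟩ := hs
  have Hγ := hμ.isProfile he H
  have hdc : ∀ y, rsum e (-N) N y (fun q => prof μ q - prof ν q) = d * c := fun y => by
    rw [← sum_rsum_flr hd]
    simp only [hc, Finset.sum_const, Finset.card_range, nsmul_eq_mul]
  obtain ⟨w', h1, -⟩ := exists_hasCoreWeight_of_const he H' Hγ hμ.1 (c := w - d * c) fun y => by
    rw [← ((hasCoreWeight_iff he H Hγ).1 hμ).2 y, ← hdc y, ← rsum_sub]
    exact rsum_congr fun q _ _ _ => by ring
  exact ⟨w', h1⟩

theorem HasCoreWeight.sum_eq (he : 0 < e) {μ γ : YoungDiagram} {w : ℕ} (H : IsProfile N (prof μ))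
    (hμ : HasCoreWeight e μ γ w) : ∑ q ∈ Finset.Ico (-(N : ℤ)) N, prof μ q =
      ∑ q ∈ Finset.Ico (-(N : ℤ)) N, prof γ q + e * w := by
  have h1 := ((hasCoreWeight_iff he H (hμ.isProfile he H)).1 hμ).2
  have h2 := sum_rsum he (-(N : ℤ)) N fun q => prof μ q - prof γ q
  simp only [h1, Finset.sum_const, Finset.card_range, nsmul_eq_mul] at h2
  rw [Finset.sum_sub_distrib] at h2
  linarith

theorem card_eq_of_sum_eq {μ ν : YoungDiagram} (H : IsProfile N (prof μ))
    (H' : IsProfile N (prof ν)) (hs : ∑ q ∈ Finset.Ico (-(N : ℤ)) N, prof μ q =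
      ∑ q ∈ Finset.Ico (-(N : ℤ)) N, prof ν q) : μ.card = ν.card := by
  have h1 := card_eq_sum H
  have h2 := card_eq_sum H'
  rw [Finset.sum_sub_distrib _ fun q : ℤ => max 0 q, hs] at h1
  rw [Finset.sum_sub_distrib _ fun q : ℤ => max 0 q, ← h1] at h2
  exact_mod_cast h2.symm

/-- A partition of least size among those with its core and runner matrix has minimal weight. -/
theorem minWeight_eq (he : 0 < e) {μ γ : YoungDiagram} {w : ℕ} {R : Matrix (Fin (d - 1)) (Fin e) ℕ}
    (hμ : HasCoreWeight e μ γ w) (hR : runnerMatrix d e μ = R)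
    (hmin : ∀ (M : ℕ) (ν : YoungDiagram) (w' : ℕ), HasCoreWeight e ν γ w' →
      runnerMatrix d e ν = R → IsProfile M (prof μ) → IsProfile M (prof ν) →
      ∑ q ∈ Finset.Ico (-(M : ℤ)) M, prof μ q ≤ ∑ q ∈ Finset.Ico (-(M : ℤ)) M, prof ν q) :
    minWeight d e γ R = w := by
  have he' : (0 : ℤ) < e := by exact_mod_cast he
  refine le_antisymm (Nat.sInf_le ⟨μ, hμ, hR⟩) ?_
  refine le_csInf ⟨w, μ, hμ, hR⟩ ?_
  rintro w' ⟨ν, h1, h2⟩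
  have H := prof_isProfile μ (le_max_left (bnd μ) (bnd ν))
  have H' := prof_isProfile ν (le_max_right (bnd μ) (bnd ν))
  have h3 := hmin _ ν w' h1 h2 H H'
  rw [hμ.sum_eq he H, h1.sum_eq he H'] at h3
  have h4 : (e : ℤ) * w ≤ e * w' := by linarith
  exact_mod_cast le_of_mul_le_mul_left h4 he'

theorem sum_eq_of_mem (he : 0 < e) {μ ν γ : YoungDiagram} {R : Matrix (Fin (d - 1)) (Fin e) ℕ}
    (hμ : μ ∈ minimalSet d e γ R) (hν : ν ∈ minimalSet d e γ R)
    (H : IsProfile N (prof μ)) (H' : IsProfile N (prof ν)) :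
    ∑ q ∈ Finset.Ico (-(N : ℤ)) N, prof μ q = ∑ q ∈ Finset.Ico (-(N : ℤ)) N, prof ν q := by
  rw [hμ.1.sum_eq he H, hν.1.sum_eq he H']

/-- Two elements of a minimal set have the same data.  As they have the same size as well, the constant
in `SameData` is zero. -/
theorem rsum_flr_eq_zero (hd : 0 < d) (he : 0 < e) (hcop : Nat.Coprime d e) {μ ν γ : YoungDiagram}
    {R : Matrix (Fin (d - 1)) (Fin e) ℕ}
    (hμ : μ ∈ minimalSet d e γ R) (hν : ν ∈ minimalSet d e γ R)
    (H : IsProfile N (prof μ)) (H' : IsProfile N (prof ν)) (x y : ℤ) :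
    rsum e (-N) N y (flr d (prof μ) (prof ν) x) = 0 := by
  obtain ⟨c, hc⟩ := SameData.of_core hd he hcop H H' hμ.1 hν.1 (hμ.2.trans hν.2.symm)
  have h1 := sum_rsum_flr (e := e) (N := N) (h := prof μ) (h' := prof ν) hd 0
  simp only [hc, Finset.sum_const, Finset.card_range, nsmul_eq_mul] at h1
  have h2 : rsum e (-N) N 0 (fun q => prof μ q - prof ν q) = 0 := by
    have Hγ := hμ.1.isProfile he H
    have a1 := ((hasCoreWeight_iff he H Hγ).1 hμ.1).2 0
    have a2 := ((hasCoreWeight_iff he H' Hγ).1 hν.1).2 0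
    rw [show (fun q => prof μ q - prof ν q) =
      fun q => (prof μ q - prof γ q) - (prof ν q - prof γ q) by funext q; ring, rsum_sub, a1, a2,
      sub_self]
  rw [h2] at h1
  rw [hc]
  rcases mul_eq_zero.1 h1 with h3 | h3
  · exact absurd h3 (by exact_mod_cast hd.ne')
  · exact h3

/-- A `BeadsFirst` partition is the unique maximal element of its minimal set. -/
theorem isUniqueDomMaximal_of_beadsFirst (hd : 0 < d) (he : 0 < e) (hcop : Nat.Coprime d e)
    {μ γ : YoungDiagram} {w : ℕ} {R : Matrix (Fin (d - 1)) (Fin e) ℕ}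
    (hμ : HasCoreWeight e μ γ w) (hR : runnerMatrix d e μ = R) (hb : BeadsFirst d e (prof μ)) :
    IsUniqueDomMaximal (minimalSet d e γ R) μ := by
  have hle : ∀ (M : ℕ) (ν : YoungDiagram) (w' : ℕ), HasCoreWeight e ν γ w' →
      runnerMatrix d e ν = R → IsProfile M (prof μ) → IsProfile M (prof ν) → ∀ p : ℤ,
      ∑ q ∈ Finset.Ico (-(M : ℤ)) (p + 1), prof μ q ≤
        ∑ q ∈ Finset.Ico (-(M : ℤ)) (p + 1), prof ν q := by
    intro M ν w' h1 h2 H H' p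
    have hs := SameData.of_core hd he hcop H H' hμ h1 (hR.trans h2.symm)
    exact hb.sum_le hd he H H' (hs.beads hd H H') p
  have hmem : μ ∈ minimalSet d e γ R := by
    refine ⟨?_, hR⟩
    rw [minWeight_eq he hμ hR fun M ν w' h1 h2 H H' => by
      have := hle M ν w' h1 h2 H H' (M - 1)
      rwa [sub_add_cancel] at this]
    exact hμ
  have hdom : ∀ ν ∈ minimalSet d e γ R, DominatedBy ν μ := by
    intro ν hν
    have H := prof_isProfile μ (le_max_left (bnd μ) (bnd ν))
    have H' := prof_isProfile ν (le_max_right (bnd μ) (bnd ν))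
    set M := max (bnd μ) (bnd ν)
    have hsum := sum_eq_of_mem he hmem hν H H'
    refine dominatedBy_of_sum_le H' H (card_eq_of_sum_eq H' H hsum.symm) fun p => ?_
    rcases le_total p (-(M : ℤ)) with hp | hp
    · rw [sum_Ico_split _ hp (by omega : -(M : ℤ) ≤ M),
        sum_Ico_split _ hp (by omega : -(M : ℤ) ≤ M), hsum]
      refine add_le_add (le_of_eq (Finset.sum_congr rfl fun q hq => ?_)) le_rfl
      have := (Finset.mem_Ico.1 hq).2
      rw [H.left q this.le, H'.left q this.le]
    · rcases le_total (M : ℤ) p with hp' | hp'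
      · rw [Finset.Ico_eq_empty (by omega)]; simp
      · have h1 := hle M ν _ hν.1 hν.2 H H' (p - 1)
        rw [sub_add_cancel] at h1
        rw [sum_Ico_split _ hp hp', sum_Ico_split _ hp hp'] at hsum
        linarith
  exact ⟨⟨hmem, fun ν hν h1 => ((hdom ν hν).antisymm h1)⟩,
    fun ν hν => (hν.2 μ hmem (hdom ν hν.1)).symm⟩

/-- A `GapsLast` partition is the unique minimal element of its minimal set. -/
theorem isUniqueDomMinimal_of_gapsLast (hd : 0 < d) (he : 0 < e) (hcop : Nat.Coprime d e)
    {μ γ : YoungDiagram} {w : ℕ} {R : Matrix (Fin (d - 1)) (Fin e) ℕ}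
    (hμ : HasCoreWeight e μ γ w) (hR : runnerMatrix d e μ = R) (hg : GapsLast d e (prof μ)) :
    IsUniqueDomMinimal (minimalSet d e γ R) μ := by
  have hle : ∀ (M : ℕ) (ν : YoungDiagram) (w' : ℕ), HasCoreWeight e ν γ w' →
      runnerMatrix d e ν = R → IsProfile M (prof μ) → IsProfile M (prof ν) → ∀ p : ℤ,
      ∑ q ∈ Finset.Ico p (M : ℤ), prof μ q ≤ ∑ q ∈ Finset.Ico p (M : ℤ), prof ν q := by
    intro M ν w' h1 h2 H H' p
    have hs := SameData.of_core hd he hcop H H' hμ h1 (hR.trans h2.symm)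
    exact hg.sum_le hd he H H' (hs.gaps hd H H') p
  have hmem : μ ∈ minimalSet d e γ R := by
    refine ⟨?_, hR⟩
    rw [minWeight_eq he hμ hR fun M ν w' h1 h2 H H' => hle M ν w' h1 h2 H H' _]
    exact hμ
  have hdom : ∀ ν ∈ minimalSet d e γ R, DominatedBy μ ν := by
    intro ν hν
    have H := prof_isProfile μ (le_max_left (bnd μ) (bnd ν))
    have H' := prof_isProfile ν (le_max_right (bnd μ) (bnd ν))
    exact dominatedBy_of_sum_le H H' (card_eq_of_sum_eq H H' (sum_eq_of_mem he hmem hν H H'))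
      fun p => hle _ ν _ hν.1 hν.2 H H' p
  exact ⟨⟨hmem, fun ν hν h1 => (h1.antisymm (hdom ν hν))⟩,
    fun ν hν => (hν.2 μ hmem (hdom ν hν.1)).symm⟩

end minimal

/-! ### Greedy walks -/

section greedy

variable {d e : ℕ}

theorem rsum_succ {A B y : ℤ} {f : ℤ → ℤ} (hAB : A ≤ B) :
    rsum e A (B + 1) y f = rsum e A B y f + if (e : ℤ) ∣ B - y then f B else 0 := by
  rw [rsum_split hAB (by omega)]
  congr 1
  unfold rsum
  rw [Finset.sum_filter, show Finset.Ico B (B + 1) = {B} by ext; simp; omega,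
    Finset.sum_singleton]

/-- The indicator of a bead at `q` with `h q - c * q ≡ x` modulo `d`. -/
def slopeBead (d : ℕ) (c : ℤ) (h : ℤ → ℤ) (x q : ℤ) : ℤ :=
  if h (q + 1) = h q ∧ (d : ℤ) ∣ h q - c * q - x then 1 else 0

theorem slopeBead_nonneg (c : ℤ) (h : ℤ → ℤ) (x q : ℤ) : 0 ≤ slopeBead d c h x q := by
  unfold slopeBead; split_ifs <;> simp

theorem slopeBead_congr {c : ℤ} {h : ℤ → ℤ} {x x' : ℤ} (hx : (d : ℤ) ∣ x - x') (q : ℤ) :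
    slopeBead d c h x q = slopeBead d c h x' q := by
  unfold slopeBead
  refine if_congr (and_congr_right fun _ => ?_) rfl rfl
  rw [show h q - c * q - x' = (h q - c * q - x) + (x - x') by ring]
  exact (dvd_add_left hx).symm

theorem sum_class (hd : 0 < d) (n : ℤ) :
    ∑ x ∈ Finset.range d, (if (d : ℤ) ∣ n - x then 1 else 0 : ℤ) = 1 := by
  have hd' : (0 : ℤ) < d := by exact_mod_cast hd
  have h2 := Int.emod_nonneg n hd'.ne'
  have h3 := Int.emod_lt_of_pos n hd'
  rw [Finset.sum_eq_single (n % d).toNat]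
  · rw [if_pos]
    rw [Int.toNat_of_nonneg h2]
    exact Int.dvd_self_sub_emod
  · intro x hx hne
    rw [if_neg]
    intro hdv
    have hx' := Finset.mem_range.1 hx
    have : n % d = x := by
      rw [Int.emod_eq_emod_iff_emod_sub_eq_zero.2 (Int.emod_eq_zero_of_dvd hdv)]
      exact Int.emod_eq_of_lt (by omega) (by omega)
    omega
  · intro hx; exact absurd (Finset.mem_range.2 (by omega)) hx

theorem sum_slopeBead (hd : 0 < d) (c : ℤ) (h : ℤ → ℤ) (q : ℤ) :
    ∑ x ∈ Finset.range d, slopeBead d c h x q = if h (q + 1) = h q then 1 else 0 := by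
  unfold slopeBead
  split_ifs with hq
  · simp only [hq, true_and]
    exact sum_class hd _
  · simp [hq]

/-- The greedy walk: `greedyState n` consists of the height after `n` steps and of the quotas of
beads that remain at each vertex.  The walk steps by a bead as long as the quota of its vertex
allows it. -/
def greedyState (d e : ℕ) (c A : ℤ) (Q : ℤ → ℤ → ℤ) : ℕ → ℤ × (ℤ → ℤ → ℤ)
  | 0 => (0, Q)
  | n + 1 =>
    let s := greedyState d e c A Q n
    if 0 < s.2 (s.1 - c * (A + n)) (A + n) then
      (s.1, fun x y => s.2 x y -
        if (e : ℤ) ∣ A + n - y then (if (d : ℤ) ∣ s.1 - c * (A + n) - x then 1 else 0) else 0)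
    else (s.1 + 1, s.2)

/-- Existence of the walk that takes, at each vertex, a given number of beads before it takes its
gaps there. -/
theorem exists_greedy (hd : 0 < d) (he : 0 < e) (L : ℕ) (c : ℤ) (Q : ℤ → ℤ → ℤ)
    (hQ : ∀ x y, 0 ≤ Q x y)
    (hQp : ∀ x x' y y', (d : ℤ) ∣ x - x' → (e : ℤ) ∣ y - y' → Q x y = Q x' y') :
    ∃ (h : ℤ → ℤ) (M : ℕ), (∀ p, h (p + 1) = h p ∨ h (p + 1) = h p + 1) ∧
      (∀ p ≤ -(L : ℤ), h p = 0) ∧ (∀ p ≥ (M : ℤ), h (p + 1) = h p + 1) ∧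
      (∀ p x y, rsum e (-L) p y (slopeBead d c h x) ≤ Q x y) ∧
      (∀ p ≥ -(L : ℤ), h (p + 1) = h p + 1 →
        rsum e (-L) p p (slopeBead d c h (h p - c * p)) = Q (h p - c * p) p) := by
  set s := greedyState d e c (-L) Q with hs
  have s0 : s 0 = (0, Q) := rfl
  have sS : ∀ n, s (n + 1) = if 0 < (s n).2 ((s n).1 - c * (-L + n)) (-L + n) then
      ((s n).1, fun x y => (s n).2 x y - if (e : ℤ) ∣ -L + n - y then
        (if (d : ℤ) ∣ (s n).1 - c * (-L + n) - x then 1 else 0) else 0)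
      else ((s n).1 + 1, (s n).2) := fun n => rfl
  set h : ℤ → ℤ := fun p => (s (p + L).toNat).1 with hh
  have hn : ∀ n : ℕ, h (-L + n) = (s n).1 := fun n => by
    simp only [hh]; congr 2; omega
  have hn' : ∀ n : ℕ, h (-L + n + 1) = (s (n + 1)).1 := fun n => by
    rw [← hn]; congr 1; push_cast; ring
  have rem : ∀ n : ℕ, (∀ x y, (s n).2 x y = Q x y - rsum e (-L) (-L + n) y (slopeBead d c h x)) ∧
      ∀ x y, 0 ≤ (s n).2 x y := by
    intro n
    induction n with
    | zero =>
      refine ⟨fun x y => ?_, fun x y => ?_⟩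
      · rw [s0, rsum_eq_zero fun q _ _ _ => by push_cast at *; omega]; simp
      · rw [s0]; exact hQ x y
    | succ n ih =>
      have e1 : ∀ x y, rsum e (-L) (-L + (n + 1 : ℕ)) y (slopeBead d c h x) =
          rsum e (-L) (-L + n) y (slopeBead d c h x) +
            if (e : ℤ) ∣ -L + n - y then slopeBead d c h x (-L + n) else 0 := by
        intro x y
        rw [← rsum_succ (by omega)]; congr 1; push_cast; ring
      have e2 := sS n
      by_cases hpos : 0 < (s n).2 ((s n).1 - c * (-L + n)) (-L + n)
      · rw [if_pos hpos] at e2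
        have hbead : h (-L + n + 1) = h (-L + n) := by rw [hn', hn, e2]
        have e3 : ∀ x, slopeBead d c h x (-L + n) =
            if (d : ℤ) ∣ (s n).1 - c * (-L + n) - x then 1 else 0 := fun x => by
          unfold slopeBead
          simp only [hbead, true_and, hn]
        refine ⟨fun x y => ?_, fun x y => ?_⟩
        · rw [e2, e1, e3]
          simp only
          rw [ih.1]; ring
        · rw [e2]
          simp only
          have h0 := ih.2 x y
          split_ifs with c1 c2
          · have : (s n).2 x y = (s n).2 ((s n).1 - c * (-L + n)) (-L + n) := by
              rw [ih.1, ih.1, hQp _ _ _ _ c2 c1]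
              congr 1
              rw [rsum_congr_mod c1]
              exact rsum_congr fun q _ _ _ => (slopeBead_congr c2 q).symm
            omega
          · omega
          · omega
      · rw [if_neg hpos] at e2
        have hgap : h (-L + n + 1) = h (-L + n) + 1 := by rw [hn', hn, e2]
        refine ⟨fun x y => ?_, fun x y => ?_⟩
        · rw [e2, e1, ih.1, show slopeBead d c h x (-L + n) = 0 by
            unfold slopeBead; rw [if_neg (by omega)]]
          simp
        · rw [e2]; exact ih.2 x y
  have step : ∀ p, h (p + 1) = h p ∨ h (p + 1) = h p + 1 := by
    intro p
    rcases lt_or_ge p (-(L : ℤ)) with hp | hp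
    · left
      simp only [hh]
      rw [Int.toNat_eq_zero.2 (by omega), Int.toNat_eq_zero.2 (by omega)]
    · obtain ⟨n, hn1⟩ := Int.eq_ofNat_of_zero_le (show 0 ≤ p + L by omega)
      obtain rfl : p = -L + n := by omega
      rw [hn', hn, sS n]
      split_ifs <;> simp
  have hle : ∀ p x y, rsum e (-L) p y (slopeBead d c h x) ≤ Q x y := by
    intro p x y
    rcases lt_or_ge p (-(L : ℤ)) with hp | hp
    · rw [rsum_eq_zero fun q _ _ _ => by omega]; exact hQ x y
    · obtain ⟨n, hn1⟩ := Int.eq_ofNat_of_zero_le (show 0 ≤ p + L by omega)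
      obtain rfl : p = -L + n := by omega
      have h1 := (rem n).1 x y
      have h2 := (rem n).2 x y
      omega
  have hgap : ∀ p ≥ -(L : ℤ), h (p + 1) = h p + 1 →
      rsum e (-L) p p (slopeBead d c h (h p - c * p)) = Q (h p - c * p) p := by
    intro p hp hg
    obtain ⟨n, hn1⟩ := Int.eq_ofNat_of_zero_le (show 0 ≤ p + L by omega)
    obtain rfl : p = -L + n := by omega
    refine le_antisymm (hle _ _ _) ?_
    by_contra hlt
    have h1 := (rem n).1 (h (-L + n) - c * (-L + n)) (-L + n)
    have h2 := sS n
    rw [← hn n] at h2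
    rw [if_pos (by omega)] at h2
    rw [hn', h2] at hg
    simp only at hg
    omega
  -- the number of beads is bounded by the sum of all quotas
  set K := ∑ y ∈ Finset.range e, ∑ x ∈ Finset.range d, Q x y with hK
  have hcount : ∀ n : ℕ, (n : ℤ) - (s n).1 ≤ K := by
    intro n
    have h1 : ∀ n : ℕ, ∑ q ∈ Finset.Ico (-(L : ℤ)) (-L + n), (if h (q + 1) = h q then 1 else 0 : ℤ) =
        n - (s n).1 := by
      intro n
      induction n with
      | zero => simp [s0]
      | succ n ih =>
        have := step (-L + n)
        push_cast
        rw [← add_assoc, ← Finset.insert_Ico_right_eq_Ico_add_one (by omega),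
          Finset.sum_insert (by simp), ih, ← hn, ← hn']
        split_ifs <;> omega
    rw [← h1, ← sum_rsum he]
    refine Finset.sum_le_sum fun y _ => ?_
    have : rsum e (-L) (-L + n) y (fun q => if h (q + 1) = h q then 1 else 0) =
        ∑ x ∈ Finset.range d, rsum e (-L) (-L + n) y (slopeBead d c h x) := by
      unfold rsum
      rw [Finset.sum_comm]
      exact Finset.sum_congr rfl fun q _ => (sum_slopeBead hd c h q).symm
    rw [this]
    exact Finset.sum_le_sum fun x _ => hle _ _ _
  have hmono : ∀ n m : ℕ, n ≤ m → (n : ℤ) - (s n).1 ≤ m - (s m).1 := by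
    intro n m hnm
    induction m, hnm using Nat.le_induction with
    | base => rfl
    | succ m _ ih =>
      have := step (-L + m)
      rw [hn, hn'] at this
      push_cast
      omega
  set n0 := Function.argmin (fun n : ℕ => (K - (n - (s n).1)).toNat) with hn0
  have hmin : ∀ n, (K - (n0 - (s n0).1)).toNat ≤ (K - (n - (s n).1)).toNat := fun n =>
    Function.argmin_le (fun n : ℕ => (K - (n - (s n).1)).toNat) n
  refine ⟨h, n0, step, fun p hp => ?_, fun p hp => ?_, hle, hgap⟩
  · simp only [hh]
    rw [Int.toNat_eq_zero.2 (by omega), s0]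
  · obtain ⟨n, hn1⟩ := Int.eq_ofNat_of_zero_le (show 0 ≤ p + L by omega)
    obtain rfl : p = -L + n := by omega
    have h1 := hmin (n + 1)
    have h2 := hmono n0 n (by omega)
    have h3 := hcount n
    have h4 := hcount (n + 1)
    have h5 := step (-L + n)
    rw [hn, hn'] at h5 ⊢
    push_cast at *
    omega

end greedy

section maximal

variable {d e : ℕ}

theorem rsum_mono_right {A B C y : ℤ} {f : ℤ → ℤ} (h1 : A ≤ B) (h2 : B ≤ C) (hf : ∀ q, 0 ≤ f q) :
    rsum e A B y f ≤ rsum e A C y f := by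
  rw [rsum_split h1 h2]
  have : 0 ≤ rsum e B C y f := rsum_nonneg hf
  omega

/-- A walk that uses up the bead quota of a vertex before it leaves it by a gap takes all its beads
before all its gaps there. -/
theorem beads_before_gaps {L : ℕ} {c : ℤ} {Q : ℤ → ℤ → ℤ} {h : ℤ → ℤ}
    (hle : ∀ p x y, rsum e (-L) p y (slopeBead d c h x) ≤ Q x y)
    (hgap : ∀ p ≥ -(L : ℤ), h (p + 1) = h p + 1 →
        rsum e (-L) p p (slopeBead d c h (h p - c * p)) = Q (h p - c * p) p)
    {p q : ℤ} (hp : -(L : ℤ) ≤ p) (hpq : p < q) (hdv : (e : ℤ) ∣ q - p)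
    (hg : h (p + 1) = h p + 1) (hb : h (q + 1) = h q) :
    ¬(d : ℤ) ∣ (h q - c * q) - (h p - c * p) := by
  intro hd
  have h1 := hgap p hp hg
  have h2 := hle (q + 1) (h p - c * p) p
  have h3 := rsum_succ (e := e) (A := -(L : ℤ)) (B := q) (y := p)
    (f := slopeBead d c h (h p - c * p)) (by omega)
  have h4 := rsum_mono_right (e := e) (y := p) hp hpq.le
    (slopeBead_nonneg (d := d) c h (h p - c * p))
  have h5 : slopeBead d c h (h p - c * p) q = 1 := by
    unfold slopeBead; rw [if_pos ⟨hb, hd⟩]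
  rw [if_pos hdv, h5] at h3
  omega

theorem rsum_one (he : 0 < e) (A y : ℤ) (k : ℕ) : rsum e A (A + e * k) y (fun _ => 1) = k := by
  induction k with
  | zero => rw [rsum_eq_zero fun q _ _ _ => by simp at *; omega]; rfl
  | succ k ih =>
    have h0 : (0 : ℤ) ≤ e * k := by positivity
    have h1 : (0 : ℤ) ≤ e := by positivity
    push_cast
    rw [mul_add, mul_one, ← add_assoc, rsum_split (B := A + e * k) (by omega) (by omega), ih]
    have := rsum_indicator he (A := A + e * k - 1 + 1) (B := A + e * k + e) (g := A + e * k - 1)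
      le_rfl (by omega) y
    rw [sub_add_cancel] at this
    rw [(rsum_congr fun q h1 h2 _ => ?_).trans this]
    rw [if_pos]
    rw [Finset.mem_Ioc]; omega

theorem sum_bead_Ico {h : ℤ → ℤ} (step : ∀ p, h (p + 1) = h p ∨ h (p + 1) = h p + 1) {A B : ℤ}
    (hAB : A ≤ B) : ∑ q ∈ Finset.Ico A B, (if h (q + 1) = h q then 1 else 0 : ℤ) =
      (B - h B) - (A - h A) := by
  induction B, hAB using Int.leInduction with
  | base => simp
  | succ B hB ih =>
    rw [← Finset.insert_Ico_right_eq_Ico_add_one hB, Finset.sum_insert (by simp), ih]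
    have := step B
    split_ifs <;> omega

theorem slopeBead_zero (h : ℤ → ℤ) : slopeBead d 0 h = beadInd d h := by
  funext x q
  simp [slopeBead, beadInd]

theorem exists_modEq_of_coprime (hd : 0 < d) (he : 0 < e) (hcop : Nat.Coprime d e) (x y : ℤ) :
    ∃ t : ℕ, (d : ℤ) ∣ t - x ∧ (e : ℤ) ∣ t - y := by
  have hpos : (0 : ℤ) < d * e := by positivity
  obtain ⟨u, v, huv⟩ := (Nat.isCoprime_iff_coprime.2 hcop)
  have h1 := Int.emod_nonneg (x * (v * e) + y * (u * d)) hpos.ne'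
  refine ⟨((x * (v * e) + y * (u * d)) % (d * e)).toNat, ?_, ?_⟩ <;> rw [Int.toNat_of_nonneg h1]
  all_goals
    have h2 := Int.mul_ediv_add_emod (x * (v * e) + y * (u * d)) (d * e)
    set r := (x * (v * e) + y * (u * d)) % (d * e)
    set k := (x * (v * e) + y * (u * d)) / (d * e)
  · exact ⟨(y - x) * u - e * k, by linear_combination h2 + x * huv⟩
  · exact ⟨(x - y) * v - d * k, by linear_combination h2 + y * huv⟩

/-- Every core and every runner matrix belong to a `BeadsFirst` partition.  It is the greedy walk whose
bead quotas `Q` at the nonzero classes are the entries of `R`, and at the class `0` the number of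
beads of the core on the runner that are left over.  The walk starts so far to the left, at `-L`, that
the latter are not negative. -/
theorem exists_beadsFirst (hd : 0 < d) (he : 0 < e) (hcop : Nat.Coprime d e) {γ : YoungDiagram}
    (hγ : IsCore e γ) (R : Matrix (Fin (d - 1)) (Fin e) ℕ) :
    ∃ (μ : YoungDiagram) (w : ℕ), HasCoreWeight e μ γ w ∧ runnerMatrix d e μ = R ∧
      BeadsFirst d e (prof μ) := by
  have hd' : (0 : ℤ) < d := by exact_mod_cast hd
  have he' : (0 : ℤ) < e := by exact_mod_cast he
  set N := bnd γ with hN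
  have Hγ : IsProfile N (prof γ) := prof_isProfile γ le_rfl
  -- the entries of `R`, extended by zero to the class `0`
  let S : ℕ → ℕ → ℤ := fun x y =>
    if h : (x ≠ 0 ∧ x < d) ∧ y < e then (R ⟨x - 1, by omega⟩ ⟨y, h.2⟩ : ℤ) else 0
  have hS0 : ∀ x y, 0 ≤ S x y := fun x y => by
    simp only [S]; split_ifs <;> positivity
  set K : ℕ := (∑ y ∈ Finset.range e, ∑ x ∈ Finset.range d, S x y).toNat with hK
  have hK' : (K : ℤ) = ∑ y ∈ Finset.range e, ∑ x ∈ Finset.range d, S x y :=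
    Int.toNat_of_nonneg (Finset.sum_nonneg fun y _ => Finset.sum_nonneg fun x _ => hS0 x y)
  set L : ℕ := N + e * K with hL
  have hLN : N ≤ L := Nat.le_add_right _ _
  let b : (ℤ → ℤ) → ℤ → ℤ := fun h q => if h (q + 1) = h q then 1 else 0
  have hb0 : ∀ h q, 0 ≤ b h q := fun h q => by simp only [b]; split_ifs <;> simp
  -- the number of beads of the core on a runner
  let G : ℤ → ℤ := fun y => rsum e (-L) N y (b (prof γ))
  have hGK : ∀ y, (K : ℤ) ≤ G y := by
    intro y
    have h1 := rsum_one he (-(L : ℤ)) y K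
    rw [show -(L : ℤ) + e * K = -N by rw [hL]; push_cast; ring] at h1
    rw [← h1]
    calc _ = rsum e (-L) (-N) y (b (prof γ)) := rsum_congr fun q h1 h2 _ => by
            simp only [b]
            rw [if_pos]
            rw [Hγ.left _ (by omega), Hγ.left _ (by omega)]
      _ ≤ _ := rsum_mono_right (by omega) (by omega) (hb0 _)
  let Q : ℤ → ℤ → ℤ := fun x y => if (d : ℤ) ∣ x then
    G y - ∑ x ∈ Finset.range d, S x (y % e).toNat else S (x % d).toNat (y % e).toNat
  have hQ0 : ∀ x y, 0 ≤ Q x y := by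
    intro x y
    simp only [Q]
    split_ifs
    · have h1 := hGK y
      have h2 : ∑ x ∈ Finset.range d, S x (y % e).toNat ≤
          ∑ y ∈ Finset.range e, ∑ x ∈ Finset.range d, S x y :=
        Finset.single_le_sum (f := fun y => ∑ x ∈ Finset.range d, S x y)
          (fun y _ => Finset.sum_nonneg fun x _ => hS0 x y) (by
            have h2 := Int.emod_nonneg y he'.ne'
            have h3 := Int.emod_lt_of_pos y he'
            rw [Finset.mem_range]; omega)
      linarith
    · exact hS0 _ _
  have hQp : ∀ x x' y y', (d : ℤ) ∣ x - x' → (e : ℤ) ∣ y - y' → Q x y = Q x' y' := by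
    intro x x' y y' hx hy
    have h1 : x % d = x' % d := (Int.emod_eq_emod_iff_emod_sub_eq_zero).2 (Int.emod_eq_zero_of_dvd hx)
    have h2 : y % e = y' % e := (Int.emod_eq_emod_iff_emod_sub_eq_zero).2 (Int.emod_eq_zero_of_dvd hy)
    have h3 : (d : ℤ) ∣ x ↔ (d : ℤ) ∣ x' := by
      rw [Int.dvd_iff_emod_eq_zero, Int.dvd_iff_emod_eq_zero, h1]
    have h4 : G y = G y' := rsum_congr_mod hy
    simp only [Q, h1, h2, h3, h4]
  have hQsum : ∀ y, ∑ x ∈ Finset.range d, Q x y = G y := by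
    intro y
    obtain ⟨k, rfl⟩ : ∃ k, d = k + 1 := ⟨d - 1, by omega⟩
    have hq : ∀ x ∈ Finset.range k, Q ((x + 1 : ℕ) : ℤ) y = S (x + 1) (y % e).toNat := by
      intro x hx
      have hx' := Finset.mem_range.1 hx
      have hnd : ¬((k + 1 : ℕ) : ℤ) ∣ ((x + 1 : ℕ) : ℤ) := by
        rw [Int.natCast_dvd_natCast]
        intro hdv
        have := Nat.le_of_dvd (by omega) hdv
        omega
      simp only [Q]
      rw [if_neg hnd, Int.emod_eq_of_lt (by omega) (by omega), Int.toNat_natCast]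
    have hs0 : S 0 (y % e).toNat = 0 := by
      simp only [S]; rw [dif_neg]; omega
    rw [Finset.sum_range_succ', Finset.sum_congr rfl hq]
    simp only [Q]
    rw [if_pos (by simp), Finset.sum_range_succ', hs0]
    ring
  obtain ⟨h, M, step, hleft, hM, hle, hgap⟩ := exists_greedy hd he L 0 Q hQ0 hQp
  have hMt : ∀ t : ℕ, h (M + t) = h M + t := by
    intro t
    induction t with
    | zero => simp
    | succ t ih =>
      have := hM (M + t) (by simp)
      push_cast
      rw [← add_assoc, this, ih]; ring
  -- every vertex is met by the final run of gaps, so all the quotas are exhausted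
  have hfin : ∀ P : ℤ, (M : ℤ) ≤ P → ∀ x y, rsum e (-L) P y (slopeBead d 0 h x) = Q x y := by
    intro P hP x y
    obtain ⟨t, ht1, ht2⟩ := exists_modEq_of_coprime hd he hcop (x - h M) (y - M)
    have h1 := hgap (M + t) (by omega) (hM _ (by omega))
    rw [hMt] at h1
    have hx : (d : ℤ) ∣ (h M + t - 0 * (M + t)) - x := by
      rw [show (h M + t - 0 * (M + t)) - x = t - (x - h M) by ring]; exact ht1
    have hy : (e : ℤ) ∣ (M + t) - y := by
      rw [show (M + t) - y = t - (y - M) by ring]; exact ht2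
    rw [hQp _ _ _ _ hx hy, rsum_congr_mod hy,
      rsum_congr fun q _ _ _ => slopeBead_congr hx q] at h1
    rw [← h1, rsum_split (B := (M : ℤ)) (by omega) hP,
      rsum_split (B := (M : ℤ)) (C := M + t) (by omega) (by omega),
      rsum_eq_zero (A := (M : ℤ)) (B := P), rsum_eq_zero (A := (M : ℤ)) (B := M + t)]
    all_goals
      intro q hq _ _
      unfold slopeBead
      rw [if_neg]
      have := hM q hq
      omega
  have hrb : ∀ P : ℤ, (M : ℤ) ≤ P → ∀ y, rsum e (-L) P y (b h) = G y := by
    intro P hP y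
    rw [← hQsum]
    simp only [← hfin P hP]
    unfold rsum
    rw [Finset.sum_comm]
    exact Finset.sum_congr rfl fun q _ => (sum_slopeBead hd 0 h q).symm
  have hright : ∀ P : ℤ, (M : ℤ) ≤ P → h P = P := by
    intro P hP
    have h1 := sum_rsum he (-(L : ℤ)) P (b h)
    simp only [hrb P hP, G] at h1
    rw [sum_rsum he, sum_bead_Ico Hγ.step (by omega), sum_bead_Ico step (by omega),
      Hγ.right _ le_rfl, Hγ.left _ (by omega), hleft _ le_rfl] at h1
    linarith
  have H : IsProfile (max L M) h := ⟨step, fun p hp => hleft p (by omega),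
    fun p hp => hright p (by omega)⟩
  have Hγ' : IsProfile (max L M) (prof γ) := Hγ.weaken (by omega)
  have hprof : prof (ofProf H) = h := prof_ofProf H
  -- the walk has the core `γ`, as it has the same number of beads on each runner
  have hs : SameData 1 e (max L M) h (prof γ) := by
    refine SameData.of_beads one_pos (Nat.coprime_one_left e) H Hγ' fun x y => ?_
    have h1 : ∀ g, beadInd 1 g x = b g := fun g => by
      funext q; simp [beadInd, b]
    have h2 : rsum e (-L) (max L M : ℕ) y (b (prof γ)) = G y := by
      rw [rsum_split (B := (N : ℤ)) (by omega) (by omega), rsum_eq_zero (A := (N : ℤ)), add_zero]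
      intro q hq _ _
      simp only [b]
      rw [if_neg]
      rw [Hγ.right q hq, Hγ.right (q + 1) (by omega)]
      omega
    rw [h1, h1, rsum_split (B := -(L : ℤ)) (f := b h) (by omega) (by omega),
      rsum_split (B := -(L : ℤ)) (f := b (prof γ)) (by omega) (by omega),
      hrb _ (by omega), h2]
    congr 1
    refine rsum_congr fun q _ hq _ => ?_
    simp only [b]
    rw [hleft _ (by omega), hleft _ (by omega), Hγ.left _ (by omega), Hγ.left _ (by omega)]
  obtain ⟨c, hc⟩ := hs
  obtain ⟨w, hw, -⟩ := exists_hasCoreWeight_of_const he (hprof.symm ▸ H) Hγ' hγ (c := c) (by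
    intro y
    rw [hprof, ← hc 0 y]
    exact rsum_congr fun q _ _ _ => by simp [flr])
  refine ⟨ofProf H, w, hw, ?_, ?_⟩
  · ext x y
    have hx := x.2
    have hnd : ∀ k : ℤ, k = ((x : ℕ) + 1 : ℕ) → ¬(d : ℤ) ∣ k := by
      rintro k rfl
      rw [Int.natCast_dvd_natCast]
      intro hdv
      have := Nat.le_of_dvd (by omega) hdv
      omega
    have h1 := runnerMatrix_eq (hprof.symm ▸ H) x y
    rw [hprof, rsum_split (B := -(L : ℤ)) (by omega) (by omega), ← slopeBead_zero,
      hfin _ (by omega), rsum_eq_zero (B := -(L : ℤ)), zero_add] at h1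
    · simp only [Q, S] at h1
      rw [if_neg (hnd _ rfl), Int.emod_eq_of_lt (by omega) (by omega),
        Int.emod_eq_of_lt (by omega) (by exact_mod_cast y.2), dif_pos (by
          simp only [Int.toNat_natCast]; have := y.2; omega)] at h1
      exact_mod_cast h1
    · intro q _ hq _
      unfold slopeBead
      rw [if_neg]
      rintro ⟨-, h2⟩
      rw [hleft _ (by omega)] at h2
      refine hnd _ rfl ?_
      rw [← dvd_neg]
      simpa using h2
  · rw [hprof]
    intro p q hpq hdv hp hq
    have hpL : -(L : ℤ) ≤ p := by
      by_contra hlt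
      rw [hleft _ (by omega), hleft _ (by omega)] at hp
      omega
    have := beads_before_gaps hle hgap hpL hpq hdv hp hq
    simpa using this

end maximal

/-! ### The minimal partition with the data of a balanced partition -/

section minimalMate

variable {d e N : ℕ} {h : ℤ → ℤ}

/-- The profile of the conjugate partition. -/
theorem IsProfile.transpose (H : IsProfile N h) : IsProfile N (fun p => h (-p) + p) := by
  refine ⟨fun p => ?_, fun p hp => ?_, fun p hp => ?_⟩
  · have := H.step (-(p + 1))
    rw [show -(p + 1) + 1 = -p by ring] at this
    omega
  · rw [H.right _ (by omega)]; ring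
  · rw [H.left _ (by omega)]; ring

theorem IsProfile.exists_gap (H : IsProfile N h) {t : ℤ} (ht : 0 ≤ t) :
    ∃ p, h p = t ∧ h (p + 1) = h p + 1 := by
  obtain ⟨p, hp1, hp2⟩ := Int.exists_greatest_of_bdd (P := fun p => h p ≤ t)
    ⟨t, fun z hz => (H.self_le z).trans hz⟩ ⟨-N, by rw [H.left _ le_rfl]; exact ht⟩
  have h1 : ¬h (p + 1) ≤ t := fun hh => by have := hp2 _ hh; omega
  have h2 := H.step p
  exact ⟨p, by omega, by omega⟩

theorem IsProfile.exists_bead (H : IsProfile N h) {t : ℤ} (ht : 0 < t) :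
    ∃ p, h p - p = t ∧ h (p + 1) = h p := by
  obtain ⟨p, hp1, hp2⟩ := Int.exists_greatest_of_bdd (P := fun p => t ≤ h p - p)
    ⟨N, fun z hz => by
      by_contra hlt
      rw [H.right z (by omega)] at hz
      omega⟩ ⟨-N - t, by rw [H.left _ (by omega)]; omega⟩
  have h1 : ¬t ≤ h (p + 1) - (p + 1) := fun hh => by have := hp2 _ hh; omega
  have h2 := H.step p
  exact ⟨p, by omega, by omega⟩

theorem sum_bead_values (step : ∀ p, h (p + 1) = h p ∨ h (p + 1) = h p + 1) (F : ℤ → ℤ) {A B : ℤ}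
    (hAB : A ≤ B) : h B - B ≤ h A - A ∧
      ∑ q ∈ Finset.Ico A B, (if h (q + 1) = h q then F (h q - q) else 0) =
        ∑ t ∈ Finset.Ioc (h B - B) (h A - A), F t := by
  induction B, hAB using Int.leInduction with
  | base => simp
  | succ B hB ih =>
    have hs := step B
    refine ⟨by omega, ?_⟩
    rw [← Finset.insert_Ico_right_eq_Ico_add_one hB, Finset.sum_insert (by simp), ih.2]
    split_ifs with hb
    · rw [hb, show Finset.Ioc (h B - (B + 1)) (h A - A) =
        insert (h B - B) (Finset.Ioc (h B - B) (h A - A)) by ext; simp; omega,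
        Finset.sum_insert (by simp)]
    · rw [show h (B + 1) - (B + 1) = h B - B by omega, zero_add]

theorem sum_gap_values (step : ∀ p, h (p + 1) = h p ∨ h (p + 1) = h p + 1) (F : ℤ → ℤ) {A B : ℤ}
    (hAB : A ≤ B) : h A ≤ h B ∧
      ∑ q ∈ Finset.Ico A B, (if h (q + 1) = h q + 1 then F (h q) else 0) =
        ∑ t ∈ Finset.Ico (h A) (h B), F t := by
  induction B, hAB using Int.leInduction with
  | base => simp
  | succ B hB ih =>
    have hs := step B
    refine ⟨by omega, ?_⟩
    rw [← Finset.insert_Ico_right_eq_Ico_add_one hB, Finset.sum_insert (by simp), ih.2]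
    split_ifs with hb
    · rw [hb, ← Finset.insert_Ico_right_eq_Ico_add_one ih.1, Finset.sum_insert (by simp)]
    · rw [show h (B + 1) = h B by omega, zero_add]

theorem rsum_reflect (e W : ℕ) (y : ℤ) (f : ℤ → ℤ) :
    rsum e (-W) W y f = rsum e (-W) W (-y - 1) fun q => f (-q - 1) := by
  unfold rsum
  refine Finset.sum_bij' (fun q _ => -q - 1) (fun q _ => -q - 1) ?_ ?_ ?_ ?_ ?_
  · intro q hq
    simp only [Finset.mem_filter, Finset.mem_Ico] at hq ⊢
    refine ⟨by omega, ?_⟩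
    rw [show -q - 1 - (-y - 1) = -(q - y) by ring, dvd_neg]; exact hq.2
  · intro q hq
    simp only [Finset.mem_filter, Finset.mem_Ico] at hq ⊢
    refine ⟨by omega, ?_⟩
    rw [show -q - 1 - y = -(q - (-y - 1)) by ring, dvd_neg]; exact hq.2
  · intro q _; ring
  · intro q _; ring
  · intro q _; congr 1; ring

theorem sum_reflect {g : ℤ → ℤ} (hg : ∀ y y', (e : ℤ) ∣ y - y' → g y = g y') :
    ∑ y ∈ Finset.range e, g (-(y : ℤ) - 1) = ∑ y ∈ Finset.range e, g y := by
  rw [← Finset.sum_range_reflect]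
  refine Finset.sum_congr rfl fun y hy => hg _ _ ?_
  have := Finset.mem_range.1 hy
  rw [Nat.cast_sub (by omega), Nat.cast_sub (by omega)]
  exact ⟨-1, by push_cast; ring⟩

/-- In a balanced profile, every nonzero class is missing from some runner of beads.  For the class
`x ≥ 2` take the runner of the gap `p` with `h p = x - 2`: the beads above `p` on it have the class
`x - 1`, and those below `p` are too low to be of class `x`. -/
theorem exists_beadless_runner (H : IsProfile N h)
    (hbal : ∀ p q, p < q → (e : ℤ) ∣ q - p → h (p + 1) = h p + 1 → h (q + 1) = h q →
      (d : ℤ) ∣ h q - h p - 1)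
    (hz : ∃ y, ∀ q, (e : ℤ) ∣ q - y → h (q + 1) = h q → ¬(d : ℤ) ∣ h q - 1)
    (x : ℕ) (hx0 : 0 < x) (hxd : x < d) :
    ∃ y, ∀ q, (e : ℤ) ∣ q - y → h (q + 1) = h q → ¬(d : ℤ) ∣ h q - x := by
  rcases Nat.lt_or_ge 1 x with h1 | h1
  · obtain ⟨p, hp1, hp2⟩ := H.exists_gap (t := (x : ℤ) - 2) (by omega)
    refine ⟨p, fun q hdv hq hdx => ?_⟩
    rcases lt_trichotomy p q with hlt | rfl | hgt
    · have h2 := dvd_sub (hbal p q hlt hdv hp2 hq) hdx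
      rw [hp1, show h q - (x - 2) - 1 - (h q - x) = 1 by ring] at h2
      have := Int.le_of_dvd one_pos h2
      omega
    · omega
    · have h2 := H.mono hgt.le
      have h3 := H.nonneg q
      have := Int.eq_zero_of_abs_lt_dvd hdx (by rw [abs_lt]; omega)
      omega
  · obtain rfl : x = 1 := by omega
    exact_mod_cast hz

/-- If a balanced profile has a runner without beads of class `1`, there is a `GapsLast` profile `k`
with the same data.  It is the conjugate of the greedy walk `n` whose bead quotas `Q` are the gap
counts of `h`.  Counting the beads of each class (a row of vertices) shows that the walk uses up its
quotas and ends at height zero.  The bead counts of `h` and `k` then differ by a constant in each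
row, and this constant is `0` as in each nonzero row both profiles miss a runner. -/
theorem exists_gapsLast (hd : 1 < d) (he : 0 < e) (hcop : Nat.Coprime d e) (H : IsProfile N h)
    (hbal : ∀ p q, p < q → (e : ℤ) ∣ q - p → h (p + 1) = h p + 1 → h (q + 1) = h q →
      (d : ℤ) ∣ h q - h p - 1)
    (hz : ∃ y, ∀ q, (e : ℤ) ∣ q - y → h (q + 1) = h q → ¬(d : ℤ) ∣ h q - 1) :
    ∃ (k : ℤ → ℤ) (W : ℕ), IsProfile W h ∧ IsProfile W k ∧ SameData d e W h k ∧
      GapsLast d e k := by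
  have hd0 : 0 < d := by omega
  have he' : (0 : ℤ) < e := by exact_mod_cast he
  set L := N + d with hL
  have HL : IsProfile L h := H.weaken (by omega)
  let Q : ℤ → ℤ → ℤ := fun x y => rsum e (-L) L (-y - 1) (gapInd d h (x - 1))
  have hQ0 : ∀ x y, 0 ≤ Q x y := fun x y => rsum_nonneg (gapInd_nonneg d h _)
  have hQp : ∀ x x' y y', (d : ℤ) ∣ x - x' → (e : ℤ) ∣ y - y' → Q x y = Q x' y' := by
    intro x x' y y' hx hy
    simp only [Q]
    rw [rsum_congr_mod (y := -y - 1) (y' := -y' - 1)]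
    · exact rsum_congr fun q _ _ _ => gapInd_congr (by rwa [sub_sub_sub_cancel_right]) q
    · rw [show -y - 1 - (-y' - 1) = -(y - y') by ring, dvd_neg]; exact hy
  obtain ⟨n, M, step, hleft, hM, hle, hgap⟩ := exists_greedy hd0 he L 1 Q hQ0 hQp
  have hMt : ∀ t : ℕ, n (M + t) = n M + t := by
    intro t
    induction t with
    | zero => simp
    | succ t ih =>
      have := hM (M + t) (by simp)
      push_cast
      rw [← add_assoc, this, ih]; ring
  -- the final row of the walk
  set f := n M - M with hf
  have hfin0 : ∀ P : ℤ, (M : ℤ) ≤ P → ∀ x y, rsum e (-L) P y (slopeBead d 1 n x) =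
      rsum e (-L) M y (slopeBead d 1 n x) := by
    intro P hP x y
    rw [rsum_split (B := (M : ℤ)) (by omega) hP, rsum_eq_zero (A := (M : ℤ)), add_zero]
    intro q hq _ _
    unfold slopeBead
    rw [if_neg]
    have := hM q hq
    omega
  -- the numbers of beads taken in a row, and the row sums of the quotas
  have hrow : ∀ x, ∑ y ∈ Finset.range e, rsum e (-L) M y (slopeBead d 1 n x) =
      ∑ t ∈ Finset.Ioc f L, if (d : ℤ) ∣ t - x then 1 else 0 := by
    intro x
    have h1 := (sum_bead_values step (fun t => if (d : ℤ) ∣ t - x then 1 else 0)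
      (show -(L : ℤ) ≤ M by omega)).2
    rw [hleft _ le_rfl, zero_sub, neg_neg] at h1
    rw [sum_rsum he, ← h1]
    refine Finset.sum_congr rfl fun q _ => ?_
    unfold slopeBead
    rw [one_mul, ite_and]
  have hQrow : ∀ x, ∑ y ∈ Finset.range e, Q x y =
      ∑ t ∈ Finset.Ioc 0 (L : ℤ), if (d : ℤ) ∣ t - x then 1 else 0 := by
    intro x
    have h1 := (sum_gap_values HL.step (fun t => if (d : ℤ) ∣ t - (x - 1) then 1 else 0)
      (show -(L : ℤ) ≤ L by omega)).2
    rw [HL.left _ le_rfl, HL.right _ le_rfl] at h1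
    simp only [Q]
    rw [sum_reflect (g := fun y => rsum e (-L) L y (gapInd d h (x - 1)))
      (fun y y' hy => rsum_congr_mod hy), sum_rsum he]
    have h2 : ∑ q ∈ Finset.Ico (-(L : ℤ)) L, gapInd d h (x - 1) q = ∑ q ∈ Finset.Ico (-(L : ℤ)) L,
        if h (q + 1) = h q + 1 then (if (d : ℤ) ∣ h q - (x - 1) then 1 else 0) else 0 :=
      Finset.sum_congr rfl fun q _ => by unfold gapInd; rw [ite_and]
    rw [h2, h1]
    refine Finset.sum_bij' (fun t _ => t + 1) (fun t _ => t - 1) ?_ ?_ ?_ ?_ ?_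
    · intro t ht; rw [Finset.mem_Ico] at ht; rw [Finset.mem_Ioc]; omega
    · intro t ht; rw [Finset.mem_Ioc] at ht; rw [Finset.mem_Ico]; omega
    · intro t _; ring
    · intro t _; ring
    · intro t _; rw [show t - (x - 1) = t + 1 - x by ring]
  have hlesum : ∀ x, ∑ t ∈ Finset.Ioc f (L : ℤ), (if (d : ℤ) ∣ t - x then 1 else 0 : ℤ) ≤
      ∑ t ∈ Finset.Ioc 0 (L : ℤ), if (d : ℤ) ∣ t - x then 1 else 0 := fun x => by
    rw [← hrow, ← hQrow]; exact Finset.sum_le_sum fun y _ => hle _ _ _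
  have hfL : f ≤ L := by
    have := (sum_bead_values step (fun _ => 0) (show -(L : ℤ) ≤ M by omega)).1
    rw [hleft _ le_rfl] at this
    omega
  -- a negative `f` means too many beads in the row of `0`, a positive one too few in the row of `f`
  have hf0 : f = 0 := by
    rcases lt_trichotomy f 0 with hlt | h0 | hgt
    · exfalso
      have h1 := hlesum 0
      have h2 : insert 0 (Finset.Ioc 0 (L : ℤ)) ⊆ Finset.Ioc f L := by
        intro t ht
        rw [Finset.mem_insert, Finset.mem_Ioc] at ht
        rw [Finset.mem_Ioc]; omega
      have h3 := Finset.sum_le_sum_of_subset_of_nonneg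
        (f := fun t : ℤ => if (d : ℤ) ∣ t - 0 then (1 : ℤ) else 0) h2
        (fun t _ _ => by split_ifs <;> simp)
      rw [Finset.sum_insert (by simp), if_pos (by simp)] at h3
      linarith
    · exact h0
    · exfalso
      -- the final run of gaps stays in the row of `f` and meets all its vertices
      have hex : ∀ y : ℤ, rsum e (-L) M y (slopeBead d 1 n f) = Q f y := by
        intro y
        have h2 := Int.emod_nonneg (y - M) he'.ne'
        have hdv : (e : ℤ) ∣ (M + (((y - M) % e).toNat : ℤ)) - y := by
          rw [Int.toNat_of_nonneg h2, show M + (y - M) % e - y = -((y - M) - (y - M) % e) by ring,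
            dvd_neg]
          exact Int.dvd_self_sub_emod
        have h3 := hgap (M + (((y - M) % e).toNat : ℤ)) (by omega) (hM _ (by omega))
        rw [hMt, show n M + (((y - M) % e).toNat : ℤ) - 1 * (M + (((y - M) % e).toNat : ℤ)) = f by
          rw [hf]; ring, hfin0 _ (by omega)] at h3
        rw [← hQp f f _ _ (by simp) hdv, ← h3]
        exact (rsum_congr_mod hdv).symm
      have h1 := hrow f
      simp only [hex] at h1
      rw [hQrow] at h1
      have h2 : insert f (Finset.Ioc f (L : ℤ)) ⊆ Finset.Ioc 0 (L : ℤ) := by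
        intro t ht
        rw [Finset.mem_insert, Finset.mem_Ioc] at ht
        rw [Finset.mem_Ioc]; omega
      have h3 := Finset.sum_le_sum_of_subset_of_nonneg
        (f := fun t : ℤ => if (d : ℤ) ∣ t - f then (1 : ℤ) else 0) h2
        (fun t _ _ => by split_ifs <;> simp)
      rw [Finset.sum_insert (by simp), if_pos (by simp)] at h3
      linarith
  -- hence all the quotas are used
  have hall : ∀ x y, rsum e (-L) M y (slopeBead d 1 n x) = Q x y := by
    intro x y
    have h1 : ∑ y ∈ Finset.range e, rsum e (-L) M y (slopeBead d 1 n x) =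
        ∑ y ∈ Finset.range e, Q x y := by rw [hrow, hQrow, hf0]
    rw [Finset.sum_eq_sum_iff_of_le fun y _ => hle _ _ _] at h1
    have h2 := Int.emod_nonneg y he'.ne'
    have h3 := Int.emod_lt_of_pos y he'
    have h4 := h1 (y % e).toNat (Finset.mem_range.2 (by omega))
    rw [Int.toNat_of_nonneg h2] at h4
    have hdv : (e : ℤ) ∣ y - y % e := Int.dvd_self_sub_emod
    rw [rsum_congr_mod hdv, h4]
    exact (hQp x x _ _ (by simp) hdv).symm
  set W := max L M with hW
  have Hn : IsProfile W n := ⟨step, fun p hp => hleft p (by omega), fun p hp => by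
    have := hMt (p - M).toNat
    rw [Int.toNat_of_nonneg (by omega), add_sub_cancel] at this
    omega⟩
  have HW : IsProfile W h := HL.weaken (by omega)
  set k : ℤ → ℤ := fun p => n (-p) + p with hk
  have Hk : IsProfile W k := Hn.transpose
  have hkn : ∀ p, n (-p - 1) = k (p + 1) - (p + 1) := fun p => by
    simp only [hk]; rw [show -(p + 1) = -p - 1 by ring]; ring
  have hkn' : ∀ p, n (-p - 1 + 1) = k p - p := fun p => by
    simp only [hk]; rw [show -p - 1 + 1 = -p by ring]; ring
  have hbad : ∀ p q, -p - 1 < -q - 1 → (e : ℤ) ∣ q - p → k (p + 1) = k p → k (q + 1) = k q + 1 →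
      ¬(d : ℤ) ∣ k q + 1 - k p := by
    intro p q hpq hdv hp hq
    have hpL : -(L : ℤ) ≤ -p - 1 := by
      by_contra hlt
      have h1 := hkn p
      have h2 := hkn' p
      rw [hleft _ (by omega)] at h1 h2
      omega
    have h1 := beads_before_gaps hle hgap hpL hpq
      (by rw [show -q - 1 - (-p - 1) = -(q - p) by ring, dvd_neg]; exact hdv)
      (by rw [hkn, hkn']; omega) (by rw [hkn, hkn']; omega)
    rw [hkn, hkn] at h1
    rwa [show k (q + 1) - (q + 1) - 1 * (-q - 1) - (k (p + 1) - (p + 1) - 1 * (-p - 1)) =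
      k q + 1 - k p by rw [hp, hq]; ring] at h1
  have hmin : GapsLast d e k := by
    intro p q hpq hdv hp hq hdd
    refine hbad q p (by omega) (by rw [← neg_sub, dvd_neg]; exact hdv) hq hp ?_
    rw [show k p + 1 - k q = -(k q - k p - 1) by ring, dvd_neg]
    exact hdd
  -- the gaps of `k` are the beads of the walk
  have hgaps : ∀ x y, rsum e (-W) W y (gapInd d h x) = rsum e (-W) W y (gapInd d k x) := by
    intro x y
    have h1 : ∀ q, gapInd d k x (-q - 1) = slopeBead d 1 n (x + 1) q := by
      intro q
      have h2 := hkn (-q - 1)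
      have h3 := hkn' (-q - 1)
      rw [show -(-q - 1) - 1 = q by ring] at h2 h3
      unfold gapInd slopeBead
      rcases step q with hq | hq
      · rw [show n q - 1 * q - (x + 1) = k (-q - 1) - x by omega]
        refine if_congr (and_congr_left fun _ => ?_) rfl rfl
        omega
      · rw [if_neg (by omega), if_neg (by omega)]
    rw [rsum_reflect e W y (gapInd d h x), rsum_reflect e W y (gapInd d k x)]
    simp only [h1]
    rw [rsum_split (B := -(L : ℤ)) (by omega) (by omega),
      rsum_split (B := -(L : ℤ)) (f := slopeBead d 1 n (x + 1)) (by omega) (by omega)]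
    congr 1
    · refine rsum_congr fun q _ hq _ => ?_
      unfold gapInd slopeBead
      rw [hleft _ (by omega), hleft _ (by omega), HL.right _ (by omega), HL.right _ (by omega),
        show 0 - 1 * q - (x + 1) = -q - 1 - x by ring]
      simp
    · rw [hfin0 _ (by omega), hall]
      simp only [Q]
      rw [rsum_split (B := (L : ℤ)) (by omega) (by omega), rsum_eq_zero (A := (L : ℤ)), add_zero,
        rsum_reflect e L (-(-y - 1) - 1)]
      · rw [show -(-(-y - 1) - 1) - 1 = -y - 1 by ring, show x + 1 - 1 = x by ring]
      · intro q hq _ _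
        exact gapInd_left HL (by omega) x
  -- equal gap counts make the runner sums constant in each row
  have hrow_const : ∀ x y, rsum e (-W) W y (flr d h k x) = rsum e (-W) W 0 (flr d h k x) := by
    intro x y
    have h1 : ∀ y, rsum e (-W) W (y + 1) (flr d h k x) = rsum e (-W) W y (flr d h k x) := by
      intro y
      have := rsum_flr_horiz (e := e) hd0 HW Hk (x - 1) y
      rw [hgaps, sub_self, add_zero, sub_add_cancel] at this
      exact this
    induction y using Int.induction_on with
    | zero => rfl
    | succ i ih => rw [h1, ih]
    | pred i ih => rw [← h1, sub_add_cancel, ih]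
  -- so the bead counts of `h` and of `k` differ by a constant in each row
  have hdiff : ∀ x y, rsum e (-W) W y (beadInd d h x) - rsum e (-W) W y (beadInd d k x) =
      rsum e (-W) W 0 (flr d h k x) - rsum e (-W) W 0 (flr d h k (x + 1)) := by
    intro x y
    have := rsum_flr_diag (e := e) hd0 HW Hk x y
    rw [hrow_const, hrow_const x y] at this
    linarith
  refine ⟨k, W, HW, Hk, SameData.of_nonzero hd0 hcop HW Hk ?_
    (∑ x ∈ Finset.range d, rsum e (-W) W 0 (flr d h k x)) ?_, hmin⟩
  · intro x hx0 hxd y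
    obtain ⟨y0, hy0⟩ := exists_beadless_runner H hbal hz x hx0 hxd
    -- the walk leaves the row of `x` for the last time by a bead
    obtain ⟨p, hp1, hp2⟩ := Hn.exists_bead (t := (x : ℤ)) (by exact_mod_cast hx0)
    have z1 : rsum e (-W) W y0 (beadInd d h x) = 0 := rsum_eq_zero fun q _ _ hq => by
      unfold beadInd
      rw [if_neg fun hh => hy0 q hq hh.1 hh.2]
    have z2 : rsum e (-W) W (-p - 1) (beadInd d k x) = 0 := rsum_eq_zero fun q _ _ hq => by
      unfold beadInd
      rw [if_neg]
      rintro ⟨hq1, hq2⟩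
      have b1 := hkn q
      have b2 := hkn' q
      have b3 := hkn (-p - 1)
      have b4 := hkn' (-p - 1)
      rw [show -(-p - 1) - 1 = p by ring] at b3 b4
      rcases lt_trichotomy (-q - 1) p with hlt | heq | hgt
      · refine hbad q (-p - 1) (by omega) (by rw [← neg_sub, dvd_neg]; exact hq) hq1 (by omega) ?_
        rw [show k (-p - 1) + 1 - k q = -(k q - x) by omega, dvd_neg]
        exact hq2
      · rw [heq] at b1 b2; omega
      · have m1 := Hn.anti (show p + 1 ≤ -q - 1 by omega)
        have m2 := Hn.self_le (-q - 1)
        simp only at m1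
        have := Int.eq_zero_of_abs_lt_dvd hq2 (by rw [abs_lt]; omega)
        omega
    have c1 := hdiff x y0
    have c2 := hdiff x (-p - 1)
    have c3 := hdiff x y
    have n1 : 0 ≤ rsum e (-W) W y0 (beadInd d k x) := rsum_nonneg (beadInd_nonneg d k _)
    have n2 : 0 ≤ rsum e (-W) W (-p - 1) (beadInd d h x) := rsum_nonneg (beadInd_nonneg d h _)
    omega
  · intro y
    rw [← sum_rsum_flr hd0]
    exact Finset.sum_congr rfl fun x _ => hrow_const x y

end minimalMate

/-! ### Balanced profiles and regularity -/

/-- The hook condition satisfied by the balanced partitions (for `c = 0`) and by the conjugates of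
their minimal mates (for `c = 1`): a bead lies one class above the gaps before it on its runner,
where the class of `p` is `h p - c * p` modulo `d`. -/
def SlopeBalanced (d e : ℕ) (c : ℤ) (h : ℤ → ℤ) : Prop :=
  ∀ p q, p < q → (e : ℤ) ∣ q - p → h (p + 1) = h p + 1 → h (q + 1) = h q →
    (d : ℤ) ∣ (h q - c * q) - (h p - c * p) - 1

section regular

variable {d e N : ℕ} {h : ℤ → ℤ}

/-- A balanced profile has no run of `e` beads at a positive height `h q`.  Such a run meets every
runner.  For `h q = 1` it would meet the runner without beads of class `1`; for `h q ≥ 2` it would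
meet the runner of the gap of height `h q - 2`, on which the beads above the gap have class
`h q - 1`. -/
theorem SlopeBalanced.regular (hd : 1 < d) (he : 0 < e) (H : IsProfile N h)
    (hbal : SlopeBalanced d e 0 h)
    (hz : ∃ y, ∀ q, (e : ℤ) ∣ q - y → h (q + 1) = h q → ¬(d : ℤ) ∣ h q - 1)
    (q : ℤ) (hq : 0 < h q) : h (q + e) ≠ h q := by
  intro heq
  have he' : (0 : ℤ) < e := by exact_mod_cast he
  -- the run meets every runner
  have hrun : ∀ y, ∃ b, (e : ℤ) ∣ b - y ∧ h (b + 1) = h b ∧ h b = h q ∧ q ≤ b := by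
    intro y
    have h2 := Int.emod_nonneg (y - q) he'.ne'
    have h3 := Int.emod_lt_of_pos (y - q) he'
    refine ⟨q + (y - q) % e, ?_, ?_⟩
    · rw [show q + (y - q) % e - y = -((y - q) - (y - q) % e) by ring, dvd_neg]
      exact Int.dvd_self_sub_emod
    · have m1 := H.mono (show q ≤ q + (y - q) % e by omega)
      have m2 := H.mono (show q + (y - q) % e + 1 ≤ q + e by omega)
      have m3 := H.mono (show q + (y - q) % e ≤ q + (y - q) % e + 1 by omega)
      omega
  rcases eq_or_lt_of_le (show 1 ≤ h q by omega) with h1 | h1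
  · obtain ⟨y, hy⟩ := hz
    obtain ⟨b, hb1, hb2, hb3, -⟩ := hrun y
    exact hy b hb1 hb2 (by rw [hb3, ← h1]; simp)
  · obtain ⟨p, hp1, hp2⟩ := H.exists_gap (t := h q - 2) (by omega)
    obtain ⟨b, hb1, hb2, hb3, hb4⟩ := hrun p
    have hpq : p < b := by
      by_contra hlt
      have := H.mono (not_lt.1 hlt)
      omega
    have h2 := hbal p b hpq hb1 hp2 hb2
    rw [show h b - 0 * b - (h p - 0 * p) - 1 = 1 by rw [hb3, hp1]; ring] at h2
    have := Int.le_of_dvd one_pos h2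
    omega

/-- If all arm lengths of hooks of size divisible by `e` are `-1` modulo `d`, the conjugate profile has
no run of `e` beads: there would be a bead with `e` gaps just before it, that is, a hook of size `e`
and arm length `e - 1`, and `d` does not divide `e`. -/
theorem regular_of_antibalanced (hd : 1 < d) (hcop : Nat.Coprime d e)
    (H : IsProfile N h)
    (hanti : ∀ p q, p < q → (e : ℤ) ∣ q - p → h (p + 1) = h p + 1 → h (q + 1) = h q →
      (d : ℤ) ∣ h q - h p)
    (he : 0 < e) (q : ℤ) (hq : 0 < h (-q) + q) : h (-(q + e)) + (q + e) ≠ h (-q) + q := by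
  intro heq
  obtain ⟨p, hp1, hp2⟩ := H.exists_bead hq
  have hpq : -q ≤ p := by
    by_contra hlt
    have := H.anti (show p + 1 ≤ -q by omega)
    simp only at this
    omega
  have m1 := H.anti (show -(q + e) ≤ p - e by omega)
  have m2 := H.anti (show p - e ≤ p - e + 1 by omega)
  have m3 := H.anti (show p - e + 1 ≤ p by omega)
  simp only at m1 m2 m3
  have h1 := hanti (p - e) p (by omega) (by simp) (by omega) hp2
  rw [show h p - h (p - e) = e by omega, Int.natCast_dvd_natCast] at h1
  have := Nat.Coprime.eq_one_of_dvd hcop h1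
  omega

theorem slopeBalanced_transpose
    (hanti : ∀ p q, p < q → (e : ℤ) ∣ q - p → h (p + 1) = h p + 1 → h (q + 1) = h q →
      (d : ℤ) ∣ h q - h p) : SlopeBalanced d e 1 (fun p => h (-p) + p) := by
  intro p q hpq hdv hp hq
  simp only at hp hq
  have h1 : h (-q - 1 + 1) = h (-q - 1) + 1 := by
    rw [show -q - 1 + 1 = -q by ring, show -q - 1 = -(q + 1) by ring]; omega
  have h2 : h (-p - 1 + 1) = h (-p - 1) := by
    rw [show -p - 1 + 1 = -p by ring, show -p - 1 = -(p + 1) by ring]; omega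
  obtain ⟨u, hu⟩ := hanti (-q - 1) (-p - 1) (by omega)
    (by rwa [show -p - 1 - (-q - 1) = q - p by ring]) h1 h2
  rw [show -q - 1 + 1 = -q by ring] at h1
  rw [show -p - 1 + 1 = -p by ring] at h2
  exact ⟨-u, by linear_combination -hu + h1 - h2⟩

end regular

/-! ### Scanning a profile

The `e`-rim of a partition is found by a scan of its profile from the top, which moves down by one
at a gap and by `e` at a bead.  The contents of the `e`-rim are the positions above the first gap
that are not gaps met by the scan. -/

section scan

/-- The position of the scan after `i` steps, and the number of beads that it has met before. -/
def scan (e : ℕ) (h : ℤ → ℤ) (T : ℤ) : ℕ → ℤ × ℕ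
  | 0 => (T, 0)
  | i + 1 =>
    let s := scan e h T i
    if h (s.1 + 1) = h s.1 then (s.1 - e, s.2 + 1) else (s.1 - 1, s.2)

variable {d e N : ℕ} {c : ℤ} {h : ℤ → ℤ} {T : ℤ}

theorem scan_bead {i : ℕ} (hb : h ((scan e h T i).1 + 1) = h (scan e h T i).1) :
    scan e h T (i + 1) = ((scan e h T i).1 - e, (scan e h T i).2 + 1) := by
  rw [scan]; exact if_pos hb

theorem scan_gap {i : ℕ} (hg : h ((scan e h T i).1 + 1) = h (scan e h T i).1 + 1) :
    scan e h T (i + 1) = ((scan e h T i).1 - 1, (scan e h T i).2) := by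
  rw [scan]; exact if_neg (by omega)

theorem scan_strictAnti (he : 0 < e) : StrictAnti fun i => (scan e h T i).1 := by
  refine strictAnti_nat_of_succ_lt fun i => ?_
  simp only [scan]
  split_ifs <;> simp only <;> omega

theorem scan_le (he : 0 < e) (i : ℕ) : (scan e h T i).1 ≤ T - i := by
  induction i with
  | zero => simp [scan]
  | succ i ih =>
    have := scan_strictAnti (h := h) (T := T) he (Nat.lt_succ_self i)
    simp only [Nat.succ_eq_add_one] at this
    push_cast
    omega

theorem scan_skip (he : 0 < e) {i : ℕ} (hb : h ((scan e h T i).1 + 1) = h (scan e h T i).1) {j : ℕ}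
    (h1 : (scan e h T i).1 - e < (scan e h T j).1) : (scan e h T i).1 ≤ (scan e h T j).1 := by
  have hanti := scan_strictAnti (h := h) (T := T) he
  by_contra hlt
  have h2 : i + 1 ≤ j := by
    by_contra hle
    exact hlt (hanti.antitone (show j ≤ i by omega))
  have h3 := hanti.antitone h2
  simp only [scan_bead hb] at h3
  omega

/-- A position is kept if it is a gap met by the scan. -/
def Kept (e : ℕ) (h : ℤ → ℤ) (T q : ℤ) : Prop :=
  h (q + 1) = h q + 1 ∧ ∃ i, (scan e h T i).1 = q

/-- If the scan meets `w + m * e` and there are beads at `w + e, …, w + m * e`, then going back along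
the scan one stays on the runner of `w`, at beads, until the scan has come from a kept gap. -/
theorem exists_chain_top (H : IsProfile N h) (hT : (N : ℤ) ≤ T) {w : ℤ} (i : ℕ) (m : ℕ)
    (hm : (scan e h T i).1 = w + (m : ℤ) * e)
    (hbelow : ∀ k : ℕ, 0 < k → k ≤ m → h (w + (k : ℤ) * e + 1) = h (w + (k : ℤ) * e)) (hm0 : 0 < m) :
    ∃ j m', j < i ∧ m ≤ m' ∧ (scan e h T j).1 = w + (m' : ℤ) * e + 1 ∧
      h ((scan e h T j).1 + 1) = h (scan e h T j).1 + 1 ∧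
      ∀ k : ℕ, 0 < k → k ≤ m' → h (w + (k : ℤ) * e + 1) = h (w + (k : ℤ) * e) := by
  induction i generalizing m with
  | zero =>
    exfalso
    have h1 := H.bead_lt (hbelow m hm0 le_rfl)
    simp only [scan] at hm
    omega
  | succ i ih =>
    rcases H.step (scan e h T i).1 with hb | hg
    · rw [scan_bead hb] at hm
      simp only at hm
      have hpos : (scan e h T i).1 = w + ((m + 1 : ℕ) : ℤ) * e := by push_cast; linarith
      obtain ⟨j, m', h1, h2, h3⟩ := ih (m + 1) hpos (fun k hk0 hk => by
        rcases Nat.lt_or_ge m k with hlt | hge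
        · obtain rfl : k = m + 1 := by omega
          rw [← hpos]; exact hb
        · exact hbelow k hk0 hge) (by omega)
      exact ⟨j, m', by omega, by omega, h3⟩
    · rw [scan_gap hg] at hm
      simp only at hm
      exact ⟨i, m, by omega, le_rfl, by omega, hg, hbelow⟩

/-- The class of a position above a kept gap on its runner, and not above the last bead, is one more
than that of the kept gap.  The comparison moves upwards along the scan: as long as it fails, the
position compared with is a gap. -/
theorem SlopeBalanced.class_above (he : 0 < e) (H : IsProfile N h) (hbal : SlopeBalanced d e c h)
    (hT : (N : ℤ) ≤ T) (i : ℕ) :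
    h ((scan e h T i).1 + 1) = h (scan e h T i).1 + 1 → ∀ p, (e : ℤ) ∣ p - (scan e h T i).1 →
    (scan e h T i).1 < p → (∃ b, p ≤ b ∧ h (b + 1) = h b) →
    (d : ℤ) ∣ (h p - c * p) - (h (scan e h T i).1 - c * (scan e h T i).1) - 1 := by
  have he' : (0 : ℤ) < e := by exact_mod_cast he
  induction i using Nat.strong_induction_on with
  | _ i ih =>
    intro hw p hdv hlt hb
    rcases H.step p with hp | hp
    · exact hbal _ p hlt hdv hw hp
    obtain ⟨b, hpb, hb⟩ := hb
    have hpb' : p + 1 ≤ b := by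
      rcases eq_or_lt_of_le hpb with rfl | hh
      · omega
      · exact hh
    cases i with
    | zero =>
      exfalso
      have := H.bead_lt hb
      simp only [scan] at hlt
      omega
    | succ i =>
      rcases H.step (scan e h T i).1 with hi | hi
      · -- the kept gap is reached from a run of beads
        have hsb := scan_bead hi
        set w := (scan e h T (i + 1)).1 with hwdef
        have hw1 : (scan e h T i).1 = w + ((1 : ℕ) : ℤ) * e := by
          rw [hwdef, hsb]; push_cast; ring
        obtain ⟨j, m, hj, hm1, hpos, hgap, hbeads⟩ := exists_chain_top H hT i 1 hw1
          (fun k hk0 hk => by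
            obtain rfl : k = 1 := by omega
            rw [← hw1]; exact hi) one_pos
        have htop := hbeads m (by omega) le_rfl
        have hm0 : (0 : ℤ) < (m : ℤ) * e := by positivity
        obtain ⟨u, hu⟩ := hbal w (w + (m : ℤ) * e) (by omega) (by simp) hw htop
        obtain ⟨s, hs⟩ := hdv
        have hs0 : 0 < s := by
          by_contra hneg
          have : (e : ℤ) * s ≤ 0 := mul_nonpos_of_nonneg_of_nonpos he'.le (by omega)
          omega
        have hms : (m : ℤ) < s := by
          by_contra hle
          have h1 := hbeads s.toNat (by omega) (by omega)
          rw [Int.toNat_of_nonneg hs0.le, show w + s * e = p by linarith] at h1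
          omega
        have hgt : w + (m : ℤ) * e + 1 < p + 1 := by
          have : (m : ℤ) * e < s * e := mul_lt_mul_of_pos_right hms he'
          linarith
        obtain ⟨v, hv⟩ := ih j (by omega) hgap (p + 1)
          (by rw [hpos]; exact ⟨s - m, by linear_combination hs⟩)
          (by rw [hpos]; exact hgt) ⟨b, hpb', hb⟩
        rw [hpos] at hv
        exact ⟨u + v, by linear_combination hu + hv - hp + htop⟩
      · have hsg := scan_gap hi
        set w := (scan e h T (i + 1)).1 with hwdef
        have hw1 : (scan e h T i).1 = w + 1 := by rw [hwdef, hsg]; ring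
        obtain ⟨v, hv⟩ := ih i (by omega) hi (p + 1)
          (by rw [hw1, add_sub_add_right_eq_sub]; exact hdv) (by omega) ⟨b, hpb', hb⟩
        rw [hw1] at hv
        exact ⟨v, by linear_combination hv - hp + hw⟩

end scan

section scan

variable {d e N : ℕ} {c : ℤ} {h : ℤ → ℤ} {T : ℤ}

theorem exists_scan_eq_of_le {p q : ℤ} (hp : ∃ i, (scan e h T i).1 = p) (hqp : q ≤ p)
    (hg : ∀ z, q < z → z ≤ p → h (z + 1) = h z + 1) : ∃ i, (scan e h T i).1 = q := by
  obtain ⟨n, hn⟩ := Int.eq_ofNat_of_zero_le (show 0 ≤ p - q by omega)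
  induction n generalizing q with
  | zero => obtain rfl : p = q := by omega
            exact hp
  | succ n ih =>
    obtain ⟨i, hi⟩ := ih (q := q + 1) (by omega) (fun z hz => hg z (by omega)) (by omega)
    refine ⟨i + 1, ?_⟩
    rw [scan_gap (by rw [hi]; exact hg _ (by omega) (by omega)), hi]
    simp

theorem exists_scan_eq {q : ℤ} (hq : q ≤ T) (hg : ∀ p, q < p → p ≤ T → h (p + 1) = h p + 1) :
    ∃ i, (scan e h T i).1 = q :=
  exists_scan_eq_of_le ⟨0, rfl⟩ hq hg

/-- Let `w` be a kept gap, and let `p ≥ w` be on the runner of `w - 1` and not above the last bead.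
Then the class of `p + 1` is one more than that of `w`.  Unless `p` is the last bead, this is
`class_above` for `p + 1`.  If it is, the scan meets `p`; some position between `w - 1` and `p` on
their runner is a gap, as otherwise the scan would jump from bead to bead down to `w - 1` and skip
`w`; compare with this gap. -/
theorem SlopeBalanced.class_after (he : 1 < e) (H : IsProfile N h) (hbal : SlopeBalanced d e c h)
    (hT : (N : ℤ) ≤ T) {w : ℤ} (hw : Kept e h T w) {p b : ℤ} (hdv : (e : ℤ) ∣ p - (w - 1))
    (hwp : w ≤ p) (hpb : p ≤ b) (hb : h (b + 1) = h b) :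
    (d : ℤ) ∣ (h (p + 1) - c * (p + 1)) - (h w - c * w) - 1 := by
  have he' : (0 : ℤ) < e := by omega
  obtain ⟨hgap, i, hi⟩ := hw
  subst hi
  set w := (scan e h T i).1 with hwdef
  have key := hbal.class_above (by omega) H hT i hgap
  rw [← hwdef] at key
  by_cases hlast : ∃ b', p < b' ∧ h (b' + 1) = h b'
  · obtain ⟨b', h1, h2⟩ := hlast
    exact key (p + 1) (by rwa [show p + 1 - w = p - (w - 1) by ring]) (by omega) ⟨b', by omega, h2⟩
  · -- `p` is the last bead
    push Not at hlast
    obtain rfl : p = b := by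
      by_contra hne
      exact hlast b (by omega) hb
    obtain ⟨i0, hi0⟩ := exists_scan_eq (e := e) (h := h) (T := T) (q := p)
      (by have := H.bead_lt hb; omega)
      (fun q hq _ => (H.step q).resolve_left (hlast q hq))
    obtain ⟨s, hs⟩ := hdv
    have hs0 : 0 < s := by
      by_contra hneg
      have : (e : ℤ) * s ≤ 0 := mul_nonpos_of_nonneg_of_nonpos he'.le (by omega)
      omega
    have hex : ∃ k : ℕ, (k : ℤ) < s ∧ h (p - (k : ℤ) * e + 1) = h (p - (k : ℤ) * e) + 1 := by
      by_contra hno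
      push Not at hno
      have hbeads : ∀ k : ℕ, (k : ℤ) < s → h (p - (k : ℤ) * e + 1) = h (p - (k : ℤ) * e) :=
        fun k hk => (H.step _).resolve_right (hno k hk)
      have hpos : ∀ k : ℕ, (k : ℤ) < s → (scan e h T (i0 + k)).1 = p - (k : ℤ) * e := by
        intro k
        induction k with
        | zero => intro _; simpa using hi0
        | succ k ih =>
          intro hk
          have h1 := ih (by push_cast at hk; omega)
          rw [← add_assoc, scan_bead (by rw [h1]; exact hbeads k (by push_cast at hk; omega)), h1]
          push_cast; ring
      have h1 := hpos (s - 1).toNat (by omega)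
      have h2 := hbeads (s - 1).toNat (by omega)
      rw [Int.toNat_of_nonneg (by omega), show p - (s - 1) * e = w - 1 + e by linarith] at h1 h2
      have h3 := scan_skip (e := e) (h := h) (T := T) (by omega) (i := i0 + (s - 1).toNat)
        (by rw [h1]; exact h2) (j := i) (by rw [h1]; omega)
      omega
    obtain ⟨k, hk, hg⟩ := hex
    have hk0 : k ≠ 0 := by rintro rfl; simp at hg; omega
    have hke : (0 : ℤ) < (k : ℤ) * e := by positivity
    obtain ⟨u, hu⟩ := hbal (p - (k : ℤ) * e) p (by omega) (by simp) hg hb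
    have hlt : (k : ℤ) * e < s * e := mul_lt_mul_of_pos_right hk he'
    obtain ⟨v, hv⟩ := key (p - (k : ℤ) * e + 1) ⟨s - k, by linear_combination hs⟩
      (by linarith) ⟨p, by omega, hb⟩
    exact ⟨u + v, by linear_combination hu + hv - hg + hb⟩

theorem not_dvd_one (hd : 1 < d) : ¬(d : ℤ) ∣ 1 := fun h => by
  have := Int.le_of_dvd one_pos h
  omega

/-- There is no bead above a gap on its runner, if the next position is a kept gap: the class after
this bead would be determined both by balance and by `class_after`, with different results. -/
theorem SlopeBalanced.no_bead_above (hd : 1 < d) (he : 1 < e) (H : IsProfile N h)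
    (hbal : SlopeBalanced d e c h) (hT : (N : ℤ) ≤ T) {v : ℤ} (hv : h (v + 1) = h v + 1)
    (hw : Kept e h T (v + 1)) {b : ℤ} (hvb : v < b) (hdv : (e : ℤ) ∣ b - v)
    (hb : h (b + 1) = h b) : False := by
  obtain ⟨u, hu⟩ := hbal v b hvb hdv hv hb
  obtain ⟨t, ht⟩ := hbal.class_after he H hT hw (p := b) (by rwa [add_sub_cancel_right]) (by omega)
    le_rfl hb
  exact not_dvd_one hd ⟨u - t, by linear_combination hu - ht + hb - hv⟩

/-- The class after a position `q` met by the scan after `n` beads is that of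
`(q + n * e + 1) * (1 - c)`, provided that its runner has a gap at `q` or below: comparing both ends
of a jump of the scan with this gap, one sees how the class changes. -/
theorem SlopeBalanced.scan_class (he : 0 < e) (H : IsProfile N h) (hbal : SlopeBalanced d e c h)
    (hT : (N : ℤ) ≤ T) (i : ℕ) (k : ℕ)
    (hk : h ((scan e h T i).1 - (k : ℤ) * e + 1) = h ((scan e h T i).1 - (k : ℤ) * e) + 1) :
    (d : ℤ) ∣ (h ((scan e h T i).1 + 1) - c * ((scan e h T i).1 + 1)) -
      ((scan e h T i).1 + (scan e h T i).2 * e + 1) * (1 - c) := by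
  induction i generalizing k with
  | zero =>
    simp only [scan]
    rw [H.right _ (by omega)]
    exact ⟨0, by push_cast; ring⟩
  | succ i ih =>
    rcases H.step (scan e h T i).1 with hi | hi
    · have hsb := scan_bead hi
      rw [hsb] at hk ⊢
      simp only at hk ⊢
      set q := (scan e h T i).1
      set n := (scan e h T i).2
      rw [show q - e - (k : ℤ) * e = q - ((k + 1 : ℕ) : ℤ) * e by push_cast; ring] at hk
      obtain ⟨u, hu⟩ := ih (k + 1) hk
      have hk0 : (0 : ℤ) < ((k + 1 : ℕ) : ℤ) * e := by positivity
      obtain ⟨v, hv⟩ := hbal (q - ((k + 1 : ℕ) : ℤ) * e) q (by omega) (by simp) hk hi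
      rcases H.step (q - e) with hq | hq
      · have hk1 : (0 : ℤ) < (k : ℤ) * e := by
          rcases Nat.eq_zero_or_pos k with rfl | hpos
          · exfalso
            rw [show q - ((0 + 1 : ℕ) : ℤ) * e = q - e by push_cast; ring] at hk
            omega
          · positivity
        obtain ⟨s, hs⟩ := hbal (q - ((k + 1 : ℕ) : ℤ) * e) (q - e)
          (by push_cast; linarith) (by
            rw [show q - e - (q - ((k + 1 : ℕ) : ℤ) * e) = (k : ℤ) * e by push_cast; ring]
            simp) hk hq
        exact ⟨u - v + s, by push_cast at *; linear_combination hu - hv + hs + hq - hi⟩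
      · obtain ⟨s, hs⟩ := hbal (q - e) q (by omega) (by simp) hq hi
        exact ⟨u - s, by push_cast at *; linear_combination hu - hs + hq - hi⟩
    · have hsg := scan_gap hi
      rw [hsg]
      simp only
      obtain ⟨u, hu⟩ := ih 0 (by simpa using hi)
      rw [sub_add_cancel]
      exact ⟨u, by linear_combination hu - hi⟩

end scan

/-! ### Removing the `e`-rim -/

section rim

open Classical in
/-- The contents of the `e`-rim: the positions above the first gap `g` that are not kept. -/
noncomputable def rimSet (e : ℕ) (h : ℤ → ℤ) (T g : ℤ) : Finset ℤ :=
  (Finset.Ioc g T).filter fun q => ¬Kept e h T q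

/-- The profile after the removal of the `e`-rim. -/
noncomputable def removeRim (e : ℕ) (h : ℤ → ℤ) (T g q : ℤ) : ℤ :=
  h q - if q ∈ rimSet e h T g then 1 else 0

/-- `g` is the first gap of `h`. -/
def FirstGap (h : ℤ → ℤ) (g : ℤ) : Prop := h g = 0 ∧ h (g + 1) = 1

variable {d e N : ℕ} {c : ℤ} {h : ℤ → ℤ} {T g : ℤ}

theorem mem_rimSet {q : ℤ} : q ∈ rimSet e h T g ↔ g < q ∧ q ≤ T ∧ ¬Kept e h T q := by
  simp only [rimSet, Finset.mem_filter, Finset.mem_Ioc, and_assoc]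

theorem FirstGap.gap (hg : FirstGap h g) : h (g + 1) = h g + 1 := by rw [hg.1, hg.2]; rfl

theorem FirstGap.zero (H : IsProfile N h) (hg : FirstGap h g) {p : ℤ} (hp : p ≤ g) : h p = 0 := by
  have h1 := H.mono hp
  have h2 := H.nonneg p
  have h3 := hg.1
  omega

theorem FirstGap.pos (H : IsProfile N h) (hg : FirstGap h g) {p : ℤ} (hp : g < p) : 0 < h p := by
  have h1 := H.mono (show g + 1 ≤ p by omega)
  have h3 := hg.2
  omega

theorem FirstGap.bead (H : IsProfile N h) (hg : FirstGap h g) {p : ℤ} (hp : p < g) :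
    h (p + 1) = h p := by
  rw [hg.zero H hp.le, hg.zero H (show p + 1 ≤ g by omega)]

theorem kept_of_le (H : IsProfile N h) {q : ℤ} (hq : (N : ℤ) ≤ q) (hqT : q ≤ T) :
    Kept e h T q := by
  have hgap : ∀ p, (N : ℤ) ≤ p → h (p + 1) = h p + 1 := fun p hp => by
    rw [H.right _ hp, H.right _ (by omega)]
  exact ⟨hgap q hq, exists_scan_eq hqT fun p hp _ => hgap p (by omega)⟩

/-- The last position of a block of the `e`-rim is a bead. -/
theorem bead_of_rim_top (H : IsProfile N h) (hT : (N : ℤ) ≤ T) {q : ℤ}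
    (hq : q ∈ rimSet e h T g) (hq1 : q + 1 ∉ rimSet e h T g) :
    h (q + 1) = h q ∧ Kept e h T (q + 1) := by
  rw [mem_rimSet] at hq hq1
  have hqT : q ≠ T := by
    rintro rfl
    exact hq.2.2 (kept_of_le H hT le_rfl)
  have hk : Kept e h T (q + 1) := by
    by_contra hk
    exact hq1 ⟨by omega, by omega, hk⟩
  refine ⟨?_, hk⟩
  obtain ⟨hgap, i, hi⟩ := hk
  refine (H.step q).resolve_right fun hqg => hq.2.2 ⟨hqg, i + 1, ?_⟩
  rw [scan_gap (by rw [hi]; exact hgap), hi]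
  simp

/-- The position before a block of the `e`-rim, if it is not the first gap, is a gap `e` steps below
a bead. -/
theorem gap_of_rim_bottom (H : IsProfile N h) {q : ℤ}
    (hgq : g < q) (hq : q ∉ rimSet e h T g) (hq1 : q + 1 ∈ rimSet e h T g) :
    h (q + 1) = h q + 1 ∧ h (q + e + 1) = h (q + e) := by
  rw [mem_rimSet] at hq hq1
  have hk : Kept e h T q := by
    by_contra hk
    exact hq ⟨by omega, by omega, hk⟩
  obtain ⟨hgap, i, hi⟩ := hk
  refine ⟨hgap, ?_⟩
  cases i with
  | zero => simp only [scan] at hi; omega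
  | succ i =>
    rcases H.step (scan e h T i).1 with hb | hb
    · rw [scan_bead hb] at hi
      rw [show q + e = (scan e h T i).1 by simp only at hi; omega]
      exact hb
    · exfalso
      rw [scan_gap hb] at hi
      have : (scan e h T i).1 = q + 1 := by simp only at hi; omega
      exact hq1.2.2 ⟨by rw [this] at hb; exact hb, i, this⟩

theorem removeRim_of_mem {q : ℤ} (hq : q ∈ rimSet e h T g) : removeRim e h T g q = h q - 1 := by
  unfold removeRim; rw [if_pos hq]

theorem removeRim_of_notMem {q : ℤ} (hq : q ∉ rimSet e h T g) : removeRim e h T g q = h q := by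
  unfold removeRim; rw [if_neg hq, sub_zero]

theorem removeRim_isProfile (H : IsProfile N h) (hT : (N : ℤ) ≤ T) (hg : FirstGap h g) :
    IsProfile N (removeRim e h T g) := by
  refine ⟨fun q => ?_, fun q hq => ?_, fun q hq => ?_⟩
  · have hs := H.step q
    by_cases h1 : q ∈ rimSet e h T g <;> by_cases h2 : q + 1 ∈ rimSet e h T g
    · rw [removeRim_of_mem h1, removeRim_of_mem h2]; omega
    · rw [removeRim_of_mem h1, removeRim_of_notMem h2]
      have := bead_of_rim_top H hT h1 h2
      omega
    · rw [removeRim_of_notMem h1, removeRim_of_mem h2]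
      have hgq : g ≤ q := by have := (mem_rimSet.1 h2).1; omega
      rcases eq_or_lt_of_le hgq with rfl | hlt
      · have := hg.gap; omega
      · have := gap_of_rim_bottom H hlt h1 h2
        omega
    · rw [removeRim_of_notMem h1, removeRim_of_notMem h2]; exact hs
  · rw [removeRim_of_notMem, H.left q hq]
    intro hm
    have h1 := (mem_rimSet.1 hm).1
    have h2 := H.gap_ge hg.gap
    omega
  · rw [removeRim_of_notMem, H.right q hq]
    intro hm
    have h1 := mem_rimSet.1 hm
    exact h1.2.2 (kept_of_le H hq h1.2.1)

/-- Removing the `e`-rim preserves the hook condition.  A gap `p` and a bead `q` of the new profile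
are compared with a gap and a bead of the old one: the bead is `q` itself, or `q + e` at the bottom of
a block of the `e`-rim; the gap is `p` itself, or there is a kept gap at `p + 1` at the top of a
block. -/
theorem SlopeBalanced.removeRim (hd : 1 < d) (he : 1 < e) (H : IsProfile N h)
    (hbal : SlopeBalanced d e c h) (hT : (N : ℤ) ≤ T) (hg : FirstGap h g) :
    SlopeBalanced d e c (removeRim e h T g) := by
  intro p q hpq hdv hp hq
  set k := Mullineux.removeRim e h T g with hk
  have hgp : g ≤ p := by
    by_contra hlt
    have h1 : p ∉ rimSet e h T g := fun hm => by have := (mem_rimSet.1 hm).1; omega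
    have h2 : p + 1 ∉ rimSet e h T g := fun hm => by have := (mem_rimSet.1 hm).1; omega
    rw [hk, removeRim_of_notMem h1, removeRim_of_notMem h2, hg.bead H (by omega)] at hp
    omega
  -- in either case there is a bead `b` of `h` on the runner of `q`, not below `q`
  have hqb : ∃ b, q ≤ b ∧ (e : ℤ) ∣ b - q ∧ h (b + 1) = h b ∧
      (d : ℤ) ∣ (k q - c * q) - ((h b - c * b) - 1) := by
    by_cases h1 : q ∈ rimSet e h T g <;> by_cases h2 : q + 1 ∈ rimSet e h T g
    · rw [hk, removeRim_of_mem h1, removeRim_of_mem h2] at hq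
      refine ⟨q, le_rfl, by simp, by omega, ?_⟩
      rw [hk, removeRim_of_mem h1]
      exact ⟨0, by ring⟩
    · exfalso
      rw [hk, removeRim_of_mem h1, removeRim_of_notMem h2, (bead_of_rim_top H hT h1 h2).1] at hq
      omega
    · have h3 := gap_of_rim_bottom H (by omega) h1 h2
      refine ⟨q + e, by omega, by simp, h3.2, ?_⟩
      obtain ⟨u, hu⟩ := hbal q (q + e) (by omega) (by simp) h3.1 h3.2
      rw [hk, removeRim_of_notMem h1]
      exact ⟨-u, by linear_combination -hu⟩
    · exfalso
      rw [hk, removeRim_of_notMem h1, removeRim_of_notMem h2] at hq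
      have h3 := H.bead_lt hq
      have h4 : Kept e h T q := by
        by_contra hkept
        exact h1 (mem_rimSet.2 ⟨by omega, by omega, hkept⟩)
      have := h4.1
      omega
  obtain ⟨b, hqb, hdvb, hb, ⟨u, hu⟩⟩ := hqb
  have hpb : p < b := by omega
  have hdvp : (e : ℤ) ∣ b - p := by
    rw [show b - p = (b - q) + (q - p) by ring]; exact dvd_add hdvb hdv
  have hbN := H.bead_lt hb
  by_cases h1 : p ∈ rimSet e h T g <;> by_cases h2 : p + 1 ∈ rimSet e h T g
  · rw [hk, removeRim_of_mem h1, removeRim_of_mem h2] at hp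
    obtain ⟨v, hv⟩ := hbal p b hpb hdvp (by omega) hb
    rw [show k p = h p - 1 from removeRim_of_mem h1]
    exact ⟨u + v, by linear_combination hu + hv⟩
  · obtain ⟨h3, h4⟩ := bead_of_rim_top H hT h1 h2
    obtain ⟨v, hv⟩ := hbal.class_after he H hT h4 (p := b) (by rwa [add_sub_cancel_right])
      (by omega) le_rfl hb
    rw [show k p = h p - 1 from removeRim_of_mem h1]
    exact ⟨u + v, by linear_combination hu + hv - hb + h3⟩
  · exfalso
    rw [hk, removeRim_of_notMem h1, removeRim_of_mem h2] at hp
    have := H.step p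
    omega
  · exfalso
    rw [hk, removeRim_of_notMem h1, removeRim_of_notMem h2] at hp
    have h4 : Kept e h T (p + 1) := by
      by_contra hkept
      exact h2 (mem_rimSet.2 ⟨by omega, by omega, hkept⟩)
    exact hbal.no_bead_above hd he H hT hp h4 hpb hdvp hb

end rim

section rimData

variable {d e N : ℕ} {c : ℤ} {h : ℤ → ℤ} {T g : ℤ}

theorem FirstGap.le (H : IsProfile N h) (hg : FirstGap h g) : g ≤ N := by
  by_contra hlt
  have h1 := hg.zero H (show (N : ℤ) + 1 ≤ g by omega)
  rw [H.right _ (by omega)] at h1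
  omega

theorem exists_bead_of_mem_rimSet (H : IsProfile N h) {q : ℤ} (hq : q ∈ rimSet e h T g) :
    ∃ b, q ≤ b ∧ h (b + 1) = h b := by
  rw [mem_rimSet] at hq
  by_contra hno
  push Not at hno
  have hgap : ∀ p, q ≤ p → h (p + 1) = h p + 1 := fun p hp => (H.step p).resolve_left (hno p hp)
  exact hq.2.2 ⟨hgap q le_rfl, exists_scan_eq hq.2.1 fun p hp _ => hgap p hp.le⟩

/-- Below the last kept gap there are only beads on the runner of the position preceding it. -/
theorem exists_last_kept (he : 0 < e) (H : IsProfile N h) (hT : (N : ℤ) ≤ T) (hg : FirstGap h g) :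
    ∃ i, g ≤ (scan e h T i).1 ∧ h ((scan e h T i).1 + 1) = h (scan e h T i).1 + 1 ∧
      (∀ k : ℕ, h ((scan e h T i).1 - 1 - (k : ℤ) * e + 1) = h ((scan e h T i).1 - 1 - (k : ℤ) * e)) ∧
      ∀ q, Kept e h T q → g ≤ q → (scan e h T i).1 ≤ q := by
  have hanti := scan_strictAnti (h := h) (T := T) he
  let P : ℕ → Prop := fun i => g ≤ (scan e h T i).1 ∧
    h ((scan e h T i).1 + 1) = h (scan e h T i).1 + 1
  have hP0 : P 0 := by
    have := hg.le H
    refine ⟨by simp only [scan]; omega, ?_⟩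
    simp only [scan]
    rw [H.right _ hT, H.right _ (by omega)]
  have hbd : ∀ i, P i → i ≤ (T - g).toNat := fun i hi => by
    have h1 := scan_le (h := h) (T := T) he i
    have h2 := hi.1
    omega
  classical
  set i := Nat.findGreatest P (T - g).toNat with hi
  have hPi : P i := Nat.findGreatest_spec (Nat.zero_le _) hP0
  have hmax : ∀ j, P j → j ≤ i := fun j hj => Nat.le_findGreatest (hbd j hj) hj
  refine ⟨i, hPi.1, hPi.2, fun k => ?_, ?_⟩
  · set w := (scan e h T i).1 with hw
    have hchain : ∀ k : ℕ, w - 1 - (k : ℤ) * e < g ∨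
        (scan e h T (i + 1 + k)).1 = w - 1 - (k : ℤ) * e := by
      intro k
      induction k with
      | zero =>
        right
        rw [add_zero, scan_gap hPi.2, ← hw]
        simp
      | succ k ih =>
        rcases ih with ih | ih
        · left; push_cast; rw [add_mul]; omega
        · rcases H.step (scan e h T (i + 1 + k)).1 with hb | hb
          · right
            rw [← add_assoc, scan_bead hb, ih]
            push_cast; ring
          · left
            by_contra hge
            have := hmax (i + 1 + k) ⟨by
              rw [ih]; push_cast at hge; rw [add_mul] at hge; omega, hb⟩
            omega
    rcases hchain k with h1 | h1
    · exact hg.bead H h1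
    · rcases lt_or_ge (w - 1 - (k : ℤ) * e) g with h2 | h2
      · exact hg.bead H h2
      · refine (H.step _).resolve_right fun hgap => ?_
        have := hmax (i + 1 + k) ⟨by rw [h1]; exact h2, by rw [h1]; exact hgap⟩
        omega
  · rintro q ⟨hq, j, rfl⟩ hgq
    exact hanti.antitone (hmax j ⟨hgq, hq⟩)

open Classical in
/-- A kept gap `p` which the scan meets after `n` beads has the runner of `t = p + n * e` and the class
of `t * (1 - c)`.  Along the scan `t` stays constant at a bead and decreases by one at a gap, so the
vertices of the kept gaps are those of consecutive integers `t`. -/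
theorem SlopeBalanced.sum_kept_aux (he : 0 < e) (H : IsProfile N h) (hbal : SlopeBalanced d e c h)
    (hT : (N : ℤ) ≤ T) {F : ℤ → ℤ → ℤ}
    (hF : ∀ x x' y y', (d : ℤ) ∣ x - x' → (e : ℤ) ∣ y - y' → F x y = F x' y') (i : ℕ) :
    (scan e h T i).1 + (scan e h T i).2 * e ≤ T ∧
    ∑ p ∈ (Finset.Ioc (scan e h T i).1 T).filter (Kept e h T), F (h p - c * p) p =
      ∑ t ∈ Finset.Ioc ((scan e h T i).1 + (scan e h T i).2 * e) T, F (t * (1 - c)) t := by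
  have he' : (0 : ℤ) < e := by exact_mod_cast he
  induction i with
  | zero => simp [scan]
  | succ i ih =>
    obtain ⟨ih1, ih2⟩ := ih
    have hn : (0 : ℤ) ≤ (scan e h T i).2 * e := by positivity
    rcases H.step (scan e h T i).1 with hi | hi
    · have hsb := scan_bead hi
      have hset : (Finset.Ioc (scan e h T (i + 1)).1 T).filter (Kept e h T) =
          (Finset.Ioc (scan e h T i).1 T).filter (Kept e h T) := by
        ext q
        rw [hsb]
        simp only [Finset.mem_filter, Finset.mem_Ioc]
        constructor
        · rintro ⟨⟨h1, h2⟩, hk⟩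
          refine ⟨⟨?_, h2⟩, hk⟩
          obtain ⟨hgap, j, rfl⟩ := hk
          have h3 := scan_skip he hi h1
          refine lt_of_le_of_ne h3 fun heq => ?_
          rw [heq] at hi
          omega
        · rintro ⟨⟨h1, h2⟩, hk⟩
          exact ⟨⟨by omega, h2⟩, hk⟩
      have hpc : (scan e h T (i + 1)).1 + ((scan e h T (i + 1)).2 : ℤ) * e =
          (scan e h T i).1 + (scan e h T i).2 * e := by
        rw [hsb]; push_cast; ring
      rw [hset, hpc]
      exact ⟨ih1, ih2⟩
    · have hsg := scan_gap hi
      have hpc : (scan e h T (i + 1)).1 + ((scan e h T (i + 1)).2 : ℤ) * e =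
          (scan e h T i).1 + (scan e h T i).2 * e - 1 := by
        rw [hsg]; ring
      have hpos : (scan e h T (i + 1)).1 = (scan e h T i).1 - 1 := by rw [hsg]
      rw [hpc, hpos]
      set q := (scan e h T i).1 with hq
      set n := (scan e h T i).2 with hndef
      refine ⟨by omega, ?_⟩
      rw [show Finset.Ioc (q - 1) T = insert q (Finset.Ioc q T) by
        ext p; simp only [Finset.mem_Ioc, Finset.mem_insert]; omega,
        show Finset.Ioc (q + n * e - 1) T = insert (q + n * e) (Finset.Ioc (q + n * e) T) by
        ext p; simp only [Finset.mem_Ioc, Finset.mem_insert]; omega,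
        Finset.filter_insert, if_pos ⟨hi, i, hq.symm⟩, Finset.sum_insert (by simp),
        Finset.sum_insert (by simp), ih2]
      congr 1
      obtain ⟨u, hu⟩ := hbal.scan_class he H hT i 0 (by simpa using hi)
      rw [← hq, ← hndef] at hu
      exact hF _ _ _ _ ⟨u, by linear_combination hu - hi⟩ ⟨-n, by ring⟩

open Classical in
/-- The `e`-rim of a balanced profile with first gap `g` and the vertices of the positions outside of
it.  With `a` the size of the `e`-rim, put `r = g + a`, increased by one if `e` does not divide `a`.
Then `e` divides `a` if and only if `g` is kept; the vertices of the kept gaps from `g` on are those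
of the integers `t ≥ r`; no gap that is not kept leads to the vertex of `r`; and, if `g` is kept, its
vertex is that of `r` and does not occur on the `e`-rim.  If `w` is the last kept gap, met after `n`
beads, then `r = w + n * e`. -/
theorem SlopeBalanced.exists_rim_data (hd : 1 < d) (he : 1 < e) (H : IsProfile N h)
    (hbal : SlopeBalanced d e c h) (hT : (N : ℤ) ≤ T) (hg : FirstGap h g) :
    ∃ r : ℤ, r = g + (rimSet e h T g).card + (if e ∣ (rimSet e h T g).card then 0 else 1) ∧
      r ≤ T + 1 ∧ (e ∣ (rimSet e h T g).card ↔ Kept e h T g) ∧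
      (∀ F : ℤ → ℤ → ℤ, (∀ x x' y y', (d : ℤ) ∣ x - x' → (e : ℤ) ∣ y - y' → F x y = F x' y') →
        ∑ p ∈ (Finset.Icc g T).filter (Kept e h T), F (h p - c * p) p =
          ∑ t ∈ Finset.Icc r T, F (t * (1 - c)) t) ∧
      (∀ p, g ≤ p → p ≤ T → h (p + 1) = h p + 1 → ¬Kept e h T p → (e : ℤ) ∣ p + 1 - r →
        ¬(d : ℤ) ∣ (h (p + 1) - c * (p + 1)) - r * (1 - c)) ∧
      (Kept e h T g → (e : ℤ) ∣ g - r ∧ (d : ℤ) ∣ (h g - c * g) - r * (1 - c) ∧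
        ∀ p ∈ rimSet e h T g, (e : ℤ) ∣ p - g → ¬(d : ℤ) ∣ (h p - c * p) - (h g - c * g)) := by
  have he0 : 0 < e := by omega
  have he' : (0 : ℤ) < e := by exact_mod_cast he0
  obtain ⟨i, hgw, hwgap, hbelow, hlast⟩ := exists_last_kept he0 H hT hg
  have hstep := scan_gap hwgap
  have hwk : Kept e h T (scan e h T i).1 := ⟨hwgap, i, rfl⟩
  have hwc := hbal.scan_class he0 H hT i 0 (by simpa using hwgap)
  have hA := fun F hF => hbal.sum_kept_aux he0 H hT (F := F) hF (i + 1)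
  rw [hstep] at hA
  simp only at hA
  set w := (scan e h T i).1 with hw
  set n := (scan e h T i).2 with hn
  -- no position below `w` on the runner of `w - 1` is a gap
  have hrunner : ∀ p, p < w → (e : ℤ) ∣ p + 1 - w → h (p + 1) = h p := by
    intro p hp hdv
    obtain ⟨s, hs⟩ := hdv
    have hs0 : s ≤ 0 := by
      by_contra hpos
      have : (e : ℤ) * 1 ≤ e * s := mul_le_mul_of_nonneg_left (by omega) he'.le
      omega
    have := hbelow (-s).toNat
    rw [Int.toNat_of_nonneg (by omega), show w - 1 - -s * e = p by linarith] at this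
    exact this
  have hgap := hg.gap
  have hwg : Kept e h T g ↔ w = g := by
    constructor
    · intro hk; exact le_antisymm (hlast g hk le_rfl) hgw
    · intro heq; rw [← heq]; exact hwk
  have hrT : w + n * e ≤ T + 1 := by
    have := (hA (fun _ _ => 0) fun _ _ _ _ _ _ => rfl).1
    linarith
  have hgT : g ≤ T := (hg.le H).trans hT
  have hsum : ∀ F : ℤ → ℤ → ℤ,
      (∀ x x' y y', (d : ℤ) ∣ x - x' → (e : ℤ) ∣ y - y' → F x y = F x' y') →
        ∑ p ∈ (Finset.Icc g T).filter (Kept e h T), F (h p - c * p) p =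
          ∑ t ∈ Finset.Icc (w + n * e) T, F (t * (1 - c)) t := by
    intro F hF
    rw [show Finset.Icc (w + n * e) T = Finset.Ioc (w - 1 + n * e) T by
      ext p; simp only [Finset.mem_Ioc, Finset.mem_Icc]; omega, ← (hA F hF).2]
    refine Finset.sum_congr ?_ fun _ _ => rfl
    ext p
    simp only [Finset.mem_filter, Finset.mem_Ioc, Finset.mem_Icc]
    constructor
    · rintro ⟨⟨h1, h2⟩, h3⟩
      have := hlast p h3 h1
      exact ⟨⟨by omega, h2⟩, h3⟩
    · rintro ⟨⟨h1, h2⟩, h3⟩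
      exact ⟨⟨by omega, h2⟩, h3⟩
  -- the size of the `e`-rim
  have hcard : w + n * e = g + (rimSet e h T g).card + if Kept e h T g then 0 else 1 := by
    have h1 := hsum (fun _ _ => 1) fun _ _ _ _ _ _ => rfl
    simp only [Finset.sum_const, nsmul_eq_mul, mul_one, Int.card_Icc] at h1
    have h2 := Finset.card_filter_add_card_filter_not (s := Finset.Icc g T) (Kept e h T)
    rw [Int.card_Icc] at h2
    have h3 : ((Finset.Icc g T).filter fun q => ¬Kept e h T q).card =
        (rimSet e h T g).card + if Kept e h T g then 0 else 1 := by
      have h4 : Finset.Icc g T = insert g (Finset.Ioc g T) := by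
        ext p; simp only [Finset.mem_Ioc, Finset.mem_Icc, Finset.mem_insert]; omega
      have h5 : rimSet e h T g = (Finset.Ioc g T).filter fun q => ¬Kept e h T q := by
        ext p; simp only [mem_rimSet, Finset.mem_filter, Finset.mem_Ioc, and_assoc]
      rw [h5, h4, Finset.filter_insert]
      by_cases hk : Kept e h T g
      · rw [if_neg (not_not.2 hk), if_pos hk, add_zero]
      · rw [if_pos hk, if_neg hk, Finset.card_insert_of_notMem (by simp)]
    rw [h3] at h2
    split_ifs at h2 ⊢ <;> omega
  have hdiv : e ∣ (rimSet e h T g).card ↔ Kept e h T g := by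
    rw [← Int.natCast_dvd_natCast]
    constructor
    · rintro ⟨s, hs⟩
      by_contra hk
      rw [if_neg hk] at hcard
      have h1 : g ≠ w := fun heq => hk (hwg.2 heq.symm)
      have h2 := hrunner g (by omega) ⟨n - s, by linear_combination -hcard - hs⟩
      omega
    · intro hk
      rw [if_pos hk, hwg.1 hk] at hcard
      exact ⟨n, by linear_combination -hcard⟩
  obtain ⟨u, hu⟩ := hwc
  have hwr : (d : ℤ) ∣ (h w - c * w) - (w + n * e) * (1 - c) :=
    ⟨u, by linear_combination hu - hwgap⟩
  refine ⟨w + n * e, ?_, hrT, hdiv, hsum, ?_, ?_⟩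
  · rw [hcard]
    congr 1
    simp only [hdiv]
  · intro p hgp hpT hp hk hdv hdd
    have hdv' : (e : ℤ) ∣ p + 1 - w := by
      rw [show p + 1 - w = (p + 1 - (w + n * e)) + n * e by ring]
      exact dvd_add hdv (by simp)
    rcases lt_or_ge p w with hlt | hge
    · have := hrunner p hlt hdv'
      omega
    · have hpg : p ≠ g := by
        rintro rfl
        exact hk (hwg.2 (le_antisymm hge hgw))
      obtain ⟨b, hpb, hb⟩ := exists_bead_of_mem_rimSet H (e := e) (T := T) (g := g) (q := p)
        (mem_rimSet.2 ⟨by omega, hpT, hk⟩)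
      obtain ⟨v, hv⟩ := hbal.class_after he H hT hwk (p := p)
        (by rwa [show p - (w - 1) = p + 1 - w by ring]) hge hpb hb
      obtain ⟨s, hs⟩ := hdd
      obtain ⟨t, ht⟩ := hwr
      exact not_dvd_one hd ⟨s - v - t, by linear_combination hs - hv - ht⟩
  · intro hk
    have hwg' := hwg.1 hk
    rw [← hwg']
    refine ⟨⟨-n, by ring⟩, hwr, ?_⟩
    intro p hp hdv hdd
    have hgp := (mem_rimSet.1 hp).1
    obtain ⟨b, hpb, hb⟩ := exists_bead_of_mem_rimSet H hp
    obtain ⟨v, hv⟩ := hbal.class_after he H hT hwk (p := p - 1)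
      (by rwa [sub_sub_sub_cancel_right]) (by omega) (by omega : p - 1 ≤ b) hb
    rw [sub_add_cancel] at hv
    obtain ⟨s, hs⟩ := hdd
    exact not_dvd_one hd ⟨s - v, by linear_combination hs - hv⟩

open Classical in
/-- The sum of a function of the vertices over the positions outside of the `e`-rim. -/
theorem sum_notMem_rimSet (H : IsProfile N h) (hT : (N : ℤ) ≤ T) (hg : FirstGap h g) {r : ℤ}
    {F : ℤ → ℤ → ℤ}
    (hF : ∑ p ∈ (Finset.Icc g T).filter (Kept e h T), F (h p - c * p) p =
      ∑ t ∈ Finset.Icc r T, F (t * (1 - c)) t) :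
    ∑ p ∈ Finset.Ico (-(T + 1)) (T + 1), (if p ∈ rimSet e h T g then 0 else F (h p - c * p) p) =
      ∑ p ∈ Finset.Ico (-(T + 1)) g, F (-(c * p)) p +
        (if Kept e h T g then 0 else F (-(c * g)) g) + ∑ t ∈ Finset.Icc r T, F (t * (1 - c)) t := by
  have hgN := hg.le H
  have hgN' := H.gap_ge hg.gap
  rw [← hF, sum_Ico_split _ (show -(T + 1) ≤ g by omega) (show g ≤ T + 1 by omega), add_assoc]
  congr 1
  · refine Finset.sum_congr rfl fun p hp => ?_
    have hp' := (Finset.mem_Ico.1 hp).2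
    rw [if_neg (fun hm => by have := (mem_rimSet.1 hm).1; omega), hg.zero H hp'.le, zero_sub]
  · rw [Finset.sum_filter, show Finset.Icc g T = insert g (Finset.Ioc g T) by
        ext p; simp only [Finset.mem_Ioc, Finset.mem_Icc, Finset.mem_insert]; omega,
      show Finset.Ico g (T + 1) = insert g (Finset.Ioc g T) by
        ext p; simp only [Finset.mem_Ioc, Finset.mem_Ico, Finset.mem_insert]; omega,
      Finset.sum_insert (by simp), Finset.sum_insert (by simp), hg.1,
      if_neg (fun hm => by have := (mem_rimSet.1 hm).1; omega), ← add_assoc, zero_sub]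
    congr 1
    · split_ifs <;> simp
    · refine Finset.sum_congr rfl fun p hp => ?_
      have hp' := Finset.mem_Ioc.1 hp
      have : p ∈ rimSet e h T g ↔ ¬Kept e h T p := by
        rw [mem_rimSet]; exact ⟨fun hh => hh.2.2, fun hh => ⟨hp'.1, hp'.2, hh⟩⟩
      simp only [this]
      split_ifs <;> rfl

end rimData

/-! ### The `e`-rims of a pair of mates -/

section pair

variable {d e N : ℕ} {c : ℤ} {h n : ℤ → ℤ} {T g g' : ℤ}

/-- The indicator of `(X, Y)` and `(x, y)` being the same vertex, that is, of `X ≡ x` modulo `d` and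
`Y ≡ y` modulo `e`. -/
def vertexInd (d e : ℕ) (x y X Y : ℤ) : ℤ := if (d : ℤ) ∣ X - x ∧ (e : ℤ) ∣ Y - y then 1 else 0

theorem vertexInd_nonneg (x y X Y : ℤ) : 0 ≤ vertexInd d e x y X Y := by
  unfold vertexInd; split_ifs <;> simp

theorem vertexInd_self (x y : ℤ) : vertexInd d e x y x y = 1 := by
  simp [vertexInd]

theorem vertexInd_congr {x y X X' Y Y' : ℤ} (hX : (d : ℤ) ∣ X - X') (hY : (e : ℤ) ∣ Y - Y') :
    vertexInd d e x y X Y = vertexInd d e x y X' Y' := by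
  unfold vertexInd
  refine if_congr (and_congr ?_ ?_) rfl rfl
  · rw [show X - x = (X' - x) + (X - X') by ring]; exact dvd_add_left hX
  · rw [show Y - y = (Y' - y) + (Y - Y') by ring]; exact dvd_add_left hY

/-- The indicator of a gap at `q` with `h (q + 1) - c * (q + 1) ≡ x` modulo `d`. -/
def slopeGap (d : ℕ) (c : ℤ) (h : ℤ → ℤ) (x q : ℤ) : ℤ :=
  if h (q + 1) = h q + 1 ∧ (d : ℤ) ∣ h (q + 1) - c * (q + 1) - x then 1 else 0

theorem sum_Ioc_neg (f : ℤ → ℤ) (a b : ℤ) :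
    ∑ q ∈ Finset.Ico a b, f q = ∑ s ∈ Finset.Ioc (-b) (-a), f (-s) := by
  refine Finset.sum_bij' (fun q _ => -q) (fun q _ => -q) ?_ ?_ ?_ ?_ ?_
  · intro q hq; rw [Finset.mem_Ico] at hq; rw [Finset.mem_Ioc]; omega
  · intro q hq; rw [Finset.mem_Ioc] at hq; rw [Finset.mem_Ico]; omega
  · intro q _; ring
  · intro q _; ring
  · intro q _; rw [neg_neg]

open Classical in
/-- Let the end points of the gaps of `h` be at the same vertices as the beads of `n`, reflected.  Then
the number `-g'` of rows of `n` is the number `r` found from the `e`-rim of `h`.  Both sides contain a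
run of vertices, starting after `r` and after `-g'`, respectively.  If `-g' < r`, the vertex of `r`
occurs too often on the side of `n`, as no other gap of `h` leads there; if `r < -g'`, the vertex of
`-g'` occurs too often on the side of `h`, as by the hook condition no bead of `n` above `g'` is
there. -/
theorem SlopeBalanced.rows_mate (hd : 1 < d) (H : IsProfile N h)
    (Hn : IsProfile N n) (nbal : SlopeBalanced d e (1 - c) n)
    (hT : (N : ℤ) ≤ T) (hg : FirstGap h g) (hg' : FirstGap n g') {r : ℤ} (hrT : r ≤ T + 1)
    (hsum : ∀ F : ℤ → ℤ → ℤ,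
      (∀ x x' y y', (d : ℤ) ∣ x - x' → (e : ℤ) ∣ y - y' → F x y = F x' y') →
      ∑ p ∈ (Finset.Icc g T).filter (Kept e h T),
        F (h p - c * p) p = ∑ t ∈ Finset.Icc r T, F (t * (1 - c)) t)
    (hr : ∀ p, g ≤ p → p ≤ T → h (p + 1) = h p + 1 → ¬Kept e h T p → (e : ℤ) ∣ p + 1 - r →
        ¬(d : ℤ) ∣ (h (p + 1) - c * (p + 1)) - r * (1 - c))
    (heq : ∀ x y, rsum e (-(T + 1)) (T + 1) (y - 1) (slopeGap d c h x) =
      rsum e (-(T + 1)) (T + 1) (-y) (slopeBead d (1 - c) n x)) : -g' = r := by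
  have hgN := hg.le H
  have hgN1 := H.gap_ge hg.gap
  have hgN2 := hg'.le Hn
  have hgN3 := Hn.gap_ge hg'.gap
  -- both sides of `heq`, up to the contribution of the `e`-rim and of the beads above `g'`
  have hL : ∀ x y, rsum e (-(T + 1)) (T + 1) (y - 1) (slopeGap d c h x) =
      ∑ s ∈ Finset.Ioc r (T + 1), vertexInd d e x y (s * (1 - c)) s +
        ∑ p ∈ (Finset.Icc g T).filter (fun p => ¬Kept e h T p),
          if h (p + 1) = h p + 1 then vertexInd d e x y (h (p + 1) - c * (p + 1)) (p + 1) else 0 := by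
    intro x y
    have h1 : rsum e (-(T + 1)) (T + 1) (y - 1) (slopeGap d c h x) =
        ∑ p ∈ Finset.Ico (-(T + 1)) (T + 1),
          if h (p + 1) = h p + 1 then vertexInd d e x y (h (p + 1) - c * (p + 1)) (p + 1) else 0 := by
      unfold rsum slopeGap vertexInd
      rw [Finset.sum_filter]
      refine Finset.sum_congr rfl fun p _ => ?_
      rw [show p + 1 - y = p - (y - 1) by ring]
      simp only [← ite_and]
      exact if_congr (by tauto) rfl rfl
    rw [h1, sum_Ico_split _ (show -(T + 1) ≤ g by omega) (show g ≤ T + 1 by omega),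
      Finset.sum_eq_zero (s := Finset.Ico (-(T + 1)) g), zero_add,
      show Finset.Ico g (T + 1) = Finset.Icc g T by
        ext p; simp only [Finset.mem_Ico, Finset.mem_Icc]; omega,
      ← Finset.sum_filter_add_sum_filter_not _ (Kept e h T)]
    · congr 1
      have h2 := hsum (fun X Y => vertexInd d e x y (X + (1 - c)) (Y + 1)) fun X X' Y Y' hX hY =>
        vertexInd_congr (by simpa using hX) (by simpa using hY)
      rw [show ∑ s ∈ Finset.Ioc r (T + 1), vertexInd d e x y (s * (1 - c)) s =
        ∑ t ∈ Finset.Icc r T, vertexInd d e x y (t * (1 - c) + (1 - c)) (t + 1) by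
          refine Finset.sum_bij' (fun s _ => s - 1) (fun s _ => s + 1) ?_ ?_ ?_ ?_ ?_
          · intro q hq; rw [Finset.mem_Ioc] at hq; rw [Finset.mem_Icc]; omega
          · intro q hq; rw [Finset.mem_Icc] at hq; rw [Finset.mem_Ioc]; omega
          · intro q _; ring
          · intro q _; ring
          · intro q _; congr 1 <;> ring, ← h2]
      refine Finset.sum_congr rfl fun p hp => ?_
      have hk := (Finset.mem_filter.1 hp).2.1
      rw [if_pos hk, hk]
      congr 1; ring
    · intro p hp
      rw [if_neg]
      have := hg.bead H (Finset.mem_Ico.1 hp).2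
      omega
  have hR : ∀ x y, rsum e (-(T + 1)) (T + 1) (-y) (slopeBead d (1 - c) n x) =
      ∑ s ∈ Finset.Ioc (-g') (T + 1), vertexInd d e x y (s * (1 - c)) s +
        ∑ p ∈ Finset.Ico g' (T + 1),
          if n (p + 1) = n p then vertexInd d e x y (n p - (1 - c) * p) (-p) else 0 := by
    intro x y
    have h1 : rsum e (-(T + 1)) (T + 1) (-y) (slopeBead d (1 - c) n x) =
        ∑ p ∈ Finset.Ico (-(T + 1)) (T + 1),
          if n (p + 1) = n p then vertexInd d e x y (n p - (1 - c) * p) (-p) else 0 := by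
      unfold rsum slopeBead vertexInd
      rw [Finset.sum_filter]
      refine Finset.sum_congr rfl fun p _ => ?_
      have hdv : (e : ℤ) ∣ -p - y ↔ (e : ℤ) ∣ p - -y := by
        rw [show -p - y = -(p - -y) by ring, dvd_neg]
      simp only [← ite_and]
      exact if_congr (by rw [hdv]; tauto) rfl rfl
    rw [h1, sum_Ico_split _ (show -(T + 1) ≤ g' by omega) (show g' ≤ T + 1 by omega)]
    congr 1
    rw [sum_Ioc_neg, neg_neg]
    refine Finset.sum_congr rfl fun s hs => ?_
    have hs' := (Finset.mem_Ioc.1 hs).1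
    rw [if_pos (hg'.bead Hn (by omega)), hg'.zero Hn (by omega), neg_neg]
    congr 1; ring
  have hterm : ∀ x y X Y, ∀ (P : Prop) [Decidable P], 0 ≤ if P then vertexInd d e x y X Y else 0 :=
    fun x y X Y P _ => by split_ifs; exacts [vertexInd_nonneg _ _ _ _, le_rfl]
  -- a run of vertices starting one step earlier has one more passage at the vertex of `v`
  have hmore : ∀ u v : ℤ, u < v → v ≤ T + 1 →
      1 + ∑ s ∈ Finset.Ioc v (T + 1), vertexInd d e (v * (1 - c)) v (s * (1 - c)) s ≤
        ∑ s ∈ Finset.Ioc u (T + 1), vertexInd d e (v * (1 - c)) v (s * (1 - c)) s := by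
    intro u v huv hvT
    have hsub : insert v (Finset.Ioc v (T + 1)) ⊆ Finset.Ioc u (T + 1) := by
      intro t ht
      rw [Finset.mem_insert, Finset.mem_Ioc] at ht
      rw [Finset.mem_Ioc]; omega
    have := Finset.sum_le_sum_of_subset_of_nonneg
      (f := fun s : ℤ => vertexInd d e (v * (1 - c)) v (s * (1 - c)) s) hsub
      (fun _ _ _ => vertexInd_nonneg _ _ _ _)
    rwa [Finset.sum_insert (by simp), vertexInd_self] at this
  rcases lt_trichotomy (-g') r with hlt | heq' | hgt
  · exfalso
    have h1 := heq (r * (1 - c)) r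
    rw [hL, hR, Finset.sum_eq_zero (s := (Finset.Icc g T).filter _), add_zero] at h1
    · have h2 := hmore _ _ hlt hrT
      have h3 : 0 ≤ ∑ p ∈ Finset.Ico g' (T + 1), if n (p + 1) = n p then
          vertexInd d e (r * (1 - c)) r (n p - (1 - c) * p) (-p) else 0 :=
        Finset.sum_nonneg fun p _ => hterm _ _ _ _ _
      linarith
    · intro p hp
      rw [Finset.mem_filter, Finset.mem_Icc] at hp
      split_ifs with hgap
      · unfold vertexInd
        rw [if_neg]
        rintro ⟨h2, h3⟩
        exact hr p hp.1.1 hp.1.2 hgap hp.2 h3 h2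
      · rfl
  · exact heq'
  · exfalso
    have h1 := heq (-g' * (1 - c)) (-g')
    rw [hL, hR, Finset.sum_eq_zero (s := Finset.Ico g' (T + 1)), add_zero] at h1
    · have h2 := hmore _ _ hgt (by omega)
      have h3 : 0 ≤ ∑ p ∈ (Finset.Icc g T).filter (fun p => ¬Kept e h T p), if h (p + 1) = h p + 1
          then vertexInd d e (-g' * (1 - c)) (-g') (h (p + 1) - c * (p + 1)) (p + 1) else 0 :=
        Finset.sum_nonneg fun p _ => hterm _ _ _ _ _
      linarith
    · intro p hp
      rw [Finset.mem_Ico] at hp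
      split_ifs with hb
      · unfold vertexInd
        rw [if_neg]
        rintro ⟨⟨u, hu⟩, h3⟩
        have hne : g' ≠ p := by
          rintro rfl
          have := hg'.gap
          omega
        obtain ⟨v, hv⟩ := nbal g' p (by omega)
          (by rw [show p - g' = -(-p - -g') by ring, dvd_neg]; exact h3) hg'.gap hb
        rw [hg'.1] at hv
        exact not_dvd_one hd ⟨u - v, by linear_combination hu - hv⟩
      · rfl

theorem flr_succ_sub (hd : 0 < d) (x q : ℤ) : flr d h n x q - flr d h n (x + 1) q =
    (if (d : ℤ) ∣ h q - x then 1 else 0) - if (d : ℤ) ∣ n q - x then 1 else 0 := by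
  have h1 := add_one_ediv d hd (h q - x - 1)
  have h2 := add_one_ediv d hd (n q - x - 1)
  rw [sub_add_cancel] at h1 h2
  unfold flr
  rw [h1, h2, show h q - (x + 1) = h q - x - 1 by ring, show n q - (x + 1) = n q - x - 1 by ring]
  ring

theorem sum_vertexInd (f : ℤ → ℤ) (P : ℤ → Prop) [DecidablePred P] (A B x y : ℤ) :
    ∑ p ∈ Finset.Ico A B, (if P p then vertexInd d e x y (f p) p else 0) =
      rsum e A B y fun q => if P q ∧ (d : ℤ) ∣ f q - x then 1 else 0 := by
  unfold rsum vertexInd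
  rw [Finset.sum_filter]
  refine Finset.sum_congr rfl fun p _ => ?_
  simp only [← ite_and]
  exact if_congr (by tauto) rfl rfl

end pair

section pair

variable {d e N : ℕ} {h n : ℤ → ℤ} {g g' : ℤ}

theorem gapInd_transpose (step : ∀ p, n (p + 1) = n p ∨ n (p + 1) = n p + 1) (x q : ℤ) :
    gapInd d (fun p => n (-p) + p) (x - 1) (-q - 1) = slopeBead d 1 n x q := by
  unfold gapInd slopeBead
  simp only
  simp only [show -(-q - 1 + 1) = q by ring, show -(-q - 1) = q + 1 by ring]
  rcases step q with hq | hq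
  · rw [hq, show n q + (-q - 1) - (x - 1) = n q - 1 * q - x by ring]
    refine if_congr (and_congr_left fun _ => ?_) rfl rfl
    omega
  · rw [if_neg (by omega), if_neg (by omega)]

theorem beadInd_transpose (x q : ℤ) :
    beadInd d (fun p => n (-p) + p) x (-q - 1) = slopeGap d 1 n x q := by
  unfold beadInd slopeGap
  simp only
  simp only [show -(-q - 1 + 1) = q by ring, show -(-q - 1) = q + 1 by ring]
  refine if_congr (and_congr (by omega) ?_) rfl rfl
  rw [show n (q + 1) + (-q - 1) - x = n (q + 1) - 1 * (q + 1) - x by ring]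

/-- The `e`-rims of two mates have the same size `a`, the numbers of rows add up to `a`, or to
`a + 1` if `e` does not divide `a`, and what remains after the removal of the `e`-rims is a pair of
mates again.  The rows are found by `rows_mate` in both directions.  The vertices on the two `e`-rims
agree because those of the whole profiles and those outside of the `e`-rims do, apart from the first
gaps.  If just one of the first gaps were kept, its vertex would occur on the `e`-rim of its profile
once more than on the other `e`-rim, but it does not occur there at all. -/
theorem rim_pair (hd : 1 < d) (he : 1 < e) (H : IsProfile N h) (Hn : IsProfile N n)
    (hbal : SlopeBalanced d e 0 h) (nbal : SlopeBalanced d e 1 n)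
    (hg : FirstGap h g) (hg' : FirstGap n g')
    (h0 : ∀ x y, rsum e (-(N + 1 : ℕ)) (N + 1 : ℕ) y (flr d h (fun p => n (-p) + p) x) = 0) :
    (rimSet e h N g).card = (rimSet e n N g').card ∧
    -g' = g + (rimSet e h N g).card + (if e ∣ (rimSet e h N g).card then 0 else 1) ∧
    ∀ x y, rsum e (-(N + 1 : ℕ)) (N + 1 : ℕ) y
      (flr d (removeRim e h N g) (fun p => removeRim e n N g' (-p) + p) x) = 0 := by
  classical
  have hd0 : 0 < d := by omega
  have HW : IsProfile (N + 1) h := H.weaken (by omega)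
  have HnW : IsProfile (N + 1) n := Hn.weaken (by omega)
  set k : ℤ → ℤ := fun p => n (-p) + p with hk
  have Hk : IsProfile (N + 1) k := HnW.transpose
  have hs : SameData d e (N + 1) h k := ⟨0, h0⟩
  have hW : ((N + 1 : ℕ) : ℤ) = N + 1 := by push_cast; rfl
  obtain ⟨r, hr1, hr2, hr3, hr4, hr5, hr6⟩ := hbal.exists_rim_data hd he H le_rfl hg
  obtain ⟨r', hr1', hr2', hr3', hr4', hr5', hr6'⟩ := nbal.exists_rim_data hd he Hn le_rfl hg'
  have e1 : -g' = r := by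
    refine SlopeBalanced.rows_mate (c := 0) (T := N) (e := e) hd H Hn
      (by rw [sub_zero]; exact nbal) le_rfl hg hg' hr2 hr4 hr5 fun x y => ?_
    rw [sub_zero, ← hW]
    have h1 : slopeGap d 0 h x = gapInd d h (x - 1) := by
      funext q
      unfold slopeGap gapInd
      refine if_congr (and_congr_right fun hq => ?_) rfl rfl
      rw [hq, show h q + 1 - 0 * (q + 1) - x = h q - (x - 1) by ring]
    rw [h1, hs.gaps hd0 HW Hk, rsum_reflect, show -(y - 1) - 1 = -y by ring]
    exact rsum_congr fun q _ _ _ => gapInd_transpose Hn.step x q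
  have e2 : -g = r' := by
    refine SlopeBalanced.rows_mate (c := 1) (T := N) (e := e) hd Hn H
      (by rw [sub_self]; exact hbal) le_rfl hg' hg hr2' hr4' hr5' fun x y => ?_
    rw [sub_self, ← hW, slopeBead_zero, hs.beads hd0 HW Hk, rsum_reflect e (N + 1) (-y),
      neg_neg]
    exact rsum_congr fun q _ _ _ => (beadInd_transpose x q).symm
  have hgN := hg.le H
  have hgN1 := H.gap_ge hg.gap
  have hgN2 := hg'.le Hn
  have hgN3 := Hn.gap_ge hg'.gap
  -- the vertices met by `h` and by the conjugate of `n`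
  have hvert : ∀ x y, ∑ p ∈ Finset.Ico (-(N + 1 : ℤ)) (N + 1), vertexInd d e x y (h p) p =
      ∑ p ∈ Finset.Ico (-(N + 1 : ℤ)) (N + 1), vertexInd d e x y (k p) p := by
    intro x y
    have h1 : ∀ f : ℤ → ℤ, ∑ p ∈ Finset.Ico (-(N + 1 : ℤ)) (N + 1), vertexInd d e x y (f p) p =
        rsum e (-(N + 1 : ℤ)) (N + 1) y fun q => if (d : ℤ) ∣ f q - x then 1 else 0 := by
      intro f
      have := sum_vertexInd (d := d) (e := e) f (fun _ => True) (-(N + 1 : ℤ)) (N + 1) x y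
      simpa using this
    have h2 : rsum e (-(N + 1 : ℤ)) (N + 1) y (fun q => flr d h k x q - flr d h k (x + 1) q) = 0 := by
      rw [rsum_sub, ← hW, h0, h0, sub_zero]
    simp only [flr_succ_sub hd0] at h2
    rw [rsum_sub, sub_eq_zero] at h2
    rw [h1, h1, h2]
  -- the numbers of vertices in the two `e`-rims
  let A : ℤ → ℤ → ℤ := fun x y => ∑ p ∈ Finset.Ico (-(N + 1 : ℤ)) (N + 1),
    if p ∈ rimSet e h N g then vertexInd d e x y (h p) p else 0
  let B : ℤ → ℤ → ℤ := fun x y => ∑ p ∈ Finset.Ico (-(N + 1 : ℤ)) (N + 1),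
    if -p ∈ rimSet e n N g' then vertexInd d e x y (k p) p else 0
  -- outside of the `e`-rims there are the positions below the first gap, the integers `t ≥ r`, and
  -- the first gap unless it is kept
  have hAB : ∀ x y, A x y = B x y +
      (if Kept e h N g then vertexInd d e x y 0 g else 0) -
        (if Kept e n N g' then vertexInd d e x y (-g') (-g') else 0) := by
    intro x y
    have hA : A x y + (∑ p ∈ Finset.Ico (-(N + 1 : ℤ)) g, vertexInd d e x y 0 p +
        (if Kept e h N g then 0 else vertexInd d e x y 0 g) +
          ∑ t ∈ Finset.Icc (-g') (N : ℤ), vertexInd d e x y t t) =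
        ∑ p ∈ Finset.Ico (-(N + 1 : ℤ)) (N + 1), vertexInd d e x y (h p) p := by
      have h1 := sum_notMem_rimSet (c := 0) H le_rfl hg (hr4 (fun X Y => vertexInd d e x y X Y)
        fun _ _ _ _ hX hY => vertexInd_congr hX hY)
      simp only [zero_mul, neg_zero, sub_zero, mul_one] at h1
      rw [e1, ← h1]
      simp only [A]
      rw [← Finset.sum_add_distrib]
      refine Finset.sum_congr rfl fun p _ => ?_
      split_ifs <;> simp
    have hB : B x y + (∑ p ∈ Finset.Ico (-(N + 1 : ℤ)) g, vertexInd d e x y 0 p +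
        vertexInd d e x y 0 g + (if Kept e n N g' then 0 else vertexInd d e x y (-g') (-g')) +
          ∑ t ∈ Finset.Ioc (-g') (N : ℤ), vertexInd d e x y t t) =
        ∑ p ∈ Finset.Ico (-(N + 1 : ℤ)) (N + 1), vertexInd d e x y (k p) p := by
      have hF := hr4' (fun X Y => vertexInd d e x y X (-Y)) fun _ _ a b hX hY =>
        vertexInd_congr hX (by rw [show -a - -b = -(a - b) by ring, dvd_neg]; exact hY)
      have h1 := sum_notMem_rimSet (c := 1) (F := fun X Y => vertexInd d e x y X (-Y)) Hn le_rfl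
        hg' hF
      simp only [one_mul, sub_self, mul_zero] at h1
      -- reflecting the window exchanges its end points
      set f : ℤ → ℤ := fun q => if -q ∈ rimSet e n N g' then 0 else vertexInd d e x y (k q) q with hf
      have h2 : ∑ q ∈ Finset.Ico (-(N + 1 : ℤ)) (N + 1), f q =
          ∑ p ∈ Finset.Ico (-(N + 1 : ℤ)) (N + 1), f (-p) - f (N + 1) + f (-(N + 1)) := by
        rw [sum_Ioc_neg, neg_neg]
        have h3 : insert (-(N + 1 : ℤ)) (Finset.Ioc (-(N + 1 : ℤ)) (N + 1)) =
            insert ((N : ℤ) + 1) (Finset.Ico (-(N + 1 : ℤ)) (N + 1)) := by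
          ext p; simp only [Finset.mem_insert, Finset.mem_Ioc, Finset.mem_Ico]; omega
        have h4 := congrArg (fun s => ∑ p ∈ s, f (-p)) h3
        rw [Finset.sum_insert (by simp), Finset.sum_insert (by simp), neg_neg] at h4
        linarith
      have h5 : ∀ p, f (-p) = if p ∈ rimSet e n N g' then 0 else
          vertexInd d e x y (n p - p) (-p) := by
        intro p
        simp only [hf, hk, neg_neg]
        rfl
      rw [Finset.sum_congr rfl fun p _ => h5 p, h1] at h2
      have h6 : f (N + 1) = vertexInd d e x y (N + 1) (N + 1) := by
        simp only [hf]
        rw [if_neg (fun hm => by have := (mem_rimSet.1 hm).1; omega), Hk.right _ (by omega)]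
      have h7 : f (-(N + 1)) = vertexInd d e x y 0 (-(N + 1)) := by
        simp only [hf]
        rw [if_neg (fun hm => by have := (mem_rimSet.1 hm).2.1; omega), Hk.left _ (by omega)]
      have h8 : ∑ p ∈ Finset.Ico (-(N + 1 : ℤ)) g', vertexInd d e x y (-p) (-p) =
          vertexInd d e x y (N + 1) (N + 1) +
            ∑ t ∈ Finset.Ioc (-g') (N : ℤ), vertexInd d e x y t t := by
        rw [sum_Ioc_neg, neg_neg, show Finset.Ioc (-g') ((N : ℤ) + 1) =
          insert ((N : ℤ) + 1) (Finset.Ioc (-g') (N : ℤ)) by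
            ext p; simp only [Finset.mem_insert, Finset.mem_Ioc]; omega,
          Finset.sum_insert (by simp)]
        simp only [neg_neg]
      have h9 : ∑ t ∈ Finset.Icc r' (N : ℤ), vertexInd d e x y 0 (-t) +
          vertexInd d e x y 0 (-(N + 1)) = ∑ p ∈ Finset.Ico (-(N + 1 : ℤ)) g, vertexInd d e x y 0 p +
            vertexInd d e x y 0 g := by
        rw [← e2, sum_Ioc_neg, neg_neg, show Finset.Icc (-g) (N : ℤ) =
          insert (-g) (Finset.Ioc (-g) (N : ℤ)) by
            ext p; simp only [Finset.mem_insert, Finset.mem_Ioc, Finset.mem_Icc]; omega,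
          Finset.sum_insert (by simp), show Finset.Ioc (-g) ((N : ℤ) + 1) =
          insert ((N : ℤ) + 1) (Finset.Ioc (-g) (N : ℤ)) by
            ext p; simp only [Finset.mem_insert, Finset.mem_Ioc]; omega,
          Finset.sum_insert (by simp), neg_neg]
        ring
      have h10 : B x y + ∑ q ∈ Finset.Ico (-(N + 1 : ℤ)) (N + 1), f q =
          ∑ p ∈ Finset.Ico (-(N + 1 : ℤ)) (N + 1), vertexInd d e x y (k p) p := by
        simp only [B, hf]
        rw [← Finset.sum_add_distrib]
        refine Finset.sum_congr rfl fun p _ => ?_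
        split_ifs <;> simp
      rw [← h10, h2, h6, h7]
      linarith
    rw [hvert, ← hB, show Finset.Icc (-g') (N : ℤ) = insert (-g') (Finset.Ioc (-g') (N : ℤ)) by
      ext p; simp only [Finset.mem_insert, Finset.mem_Ioc, Finset.mem_Icc]; omega,
      Finset.sum_insert (by simp)] at hA
    split_ifs at hA ⊢ <;> linarith
  have hA0 : ∀ x y, 0 ≤ A x y := fun x y => Finset.sum_nonneg fun p _ => by
    split_ifs; exacts [vertexInd_nonneg _ _ _ _, le_rfl]
  have hB0 : ∀ x y, 0 ≤ B x y := fun x y => Finset.sum_nonneg fun p _ => by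
    split_ifs; exacts [vertexInd_nonneg _ _ _ _, le_rfl]
  -- if only one of the first gaps were kept, its vertex would have to occur on the `e`-rim
  have hkept : Kept e h N g ↔ Kept e n N g' := by
    constructor
    · intro hkg
      by_contra hkg'
      have h1 := hAB 0 g
      rw [if_pos hkg, if_neg hkg', vertexInd_self] at h1
      have h2 : A 0 g = 0 := Finset.sum_eq_zero fun p _ => by
        split_ifs with hm
        · unfold vertexInd
          rw [if_neg]
          rintro ⟨h3, h4⟩
          refine (hr6 hkg).2.2 p hm h4 ?_
          rw [hg.1]
          simpa using h3
        · rfl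
      have := hB0 0 g
      omega
    · intro hkg'
      by_contra hkg
      have h1 := hAB (-g') (-g')
      rw [if_neg hkg, if_pos hkg', vertexInd_self] at h1
      have h2 : B (-g') (-g') = 0 := Finset.sum_eq_zero fun p _ => by
        split_ifs with hm
        · unfold vertexInd
          rw [if_neg]
          rintro ⟨h3, h4⟩
          refine (hr6' hkg').2.2 (-p) hm ?_ ?_
          · rw [show -p - g' = -(p - -g') by ring, dvd_neg]; exact h4
          · rw [hg'.1]
            simp only [hk] at h3
            rwa [show n (-p) - 1 * -p - (0 - 1 * g') = n (-p) + p - -g' by ring]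
        · rfl
      have := hA0 (-g') (-g')
      omega
  -- both `e`-rims have the same vertices
  have hABeq : ∀ x y, A x y = B x y := by
    intro x y
    rw [hAB]
    by_cases hkg : Kept e h N g
    · rw [if_pos hkg, if_pos (hkept.1 hkg)]
      obtain ⟨h1, ⟨u, hu⟩, -⟩ := hr6 hkg
      rw [hg.1] at hu
      rw [e1, vertexInd_congr (X := 0) (X' := r) (Y := g) (Y' := r)
        ⟨u, by linear_combination hu⟩ h1]
      ring
    · rw [if_neg hkg, if_neg (fun hh => hkg (hkept.2 hh))]
      ring
  have hcard : (rimSet e h N g).card = (rimSet e n N g').card := by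
    have h1 : ((rimSet e h N g).card : ℤ) + (if Kept e h N g then 0 else 1) =
        (rimSet e n N g').card + (if Kept e n N g' then 0 else 1) := by
      have a1 := hr1
      have a2 := hr1'
      simp only [hr3, hr3'] at a1 a2
      linarith
    simp only [hkept] at h1
    split_ifs at h1 <;> omega
  refine ⟨hcard, by rw [e1]; exact hr1, fun x y => ?_⟩
  have h1 : ∀ q, flr d (removeRim e h N g) (fun p => removeRim e n N g' (-p) + p) x q =
      flr d h k x q - ((if q ∈ rimSet e h N g ∧ (d : ℤ) ∣ h q - x then 1 else 0) -
        if -q ∈ rimSet e n N g' ∧ (d : ℤ) ∣ k q - x then 1 else 0) := by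
    intro q
    have f1 : ∀ (m : ℤ) (P : Prop) [Decidable P], (m - (if P then 1 else 0) - x) / (d : ℤ) =
        (m - x) / d - if P ∧ (d : ℤ) ∣ m - x then 1 else 0 := by
      intro m P _
      by_cases hP : P
      · have := add_one_ediv d hd0 (m - x - 1)
        rw [sub_add_cancel] at this
        simp only [hP, if_true, true_and]
        rw [this, show m - 1 - x = m - x - 1 by ring]; ring
      · simp [hP]
    have f2 : removeRim e n N g' (-q) + q = k q - if -q ∈ rimSet e n N g' then 1 else 0 := by
      simp only [removeRim, hk]; ring
    unfold flr
    simp only [f2]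
    rw [f1]
    unfold removeRim
    rw [f1]
    ring
  rw [rsum_congr fun q _ _ _ => h1 q, rsum_sub, h0, rsum_sub, hW]
  have h2 := hABeq x y
  simp only [A, B] at h2
  rw [sum_vertexInd h (fun p => p ∈ rimSet e h N g),
    sum_vertexInd k (fun p => -p ∈ rimSet e n N g')] at h2
  rw [h2]
  ring

end pair

/-! ### The `e`-rim of a Young diagram -/

section bridge

variable {d e N : ℕ} {c : ℤ} {h : ℤ → ℤ} {T : ℤ}

theorem beadPos_lt_of_lt (μ : YoungDiagram) {i i' : ℕ} (hi : i < i') :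
    beadPos μ i' < beadPos μ i := by
  have := μ.rowLen_anti i i' hi.le
  unfold beadPos
  omega

theorem beadPos_le_of_le (μ : YoungDiagram) {i i' : ℕ} (hi : i ≤ i') :
    beadPos μ i' ≤ beadPos μ i := by
  rcases hi.eq_or_lt with rfl | hlt
  exacts [le_rfl, (beadPos_lt_of_lt μ hlt).le]

theorem firstGap_prof (μ : YoungDiagram) : FirstGap (prof μ) (gapPos μ 0) := by
  simpa [FirstGap] using prof_gapPos μ 0

theorem mem_segment (e : ℕ) (μ : YoungDiagram) (s i j : ℕ) :
    (i, j) ∈ segment e μ s ↔ (j : ℤ) + 1 = prof μ ((j : ℤ) - i) ∧ gapPos μ 0 < (j : ℤ) - i ∧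
      (j : ℤ) - i ≤ beadPos μ s ∧ beadPos μ s - e < (j : ℤ) - i := by
  have h1 := beadPos_le_of_le μ (Nat.zero_le s)
  have h2 : (μ.rowLen s : ℤ) - 1 - s = beadPos μ s := by unfold beadPos; ring
  simp only [segment, Finset.mem_filter, mem_rimHook_iff, h2]
  omega

/-- The segment starting in row `s` reaches all the rows before the start of the next one. -/
theorem beadPos_of_lt_segmentStart {e : ℕ} (he : 0 < e) (μ : YoungDiagram) (k : ℕ) {i : ℕ}
    (hi : i < segmentStart e μ (k + 1)) :
    beadPos μ (segmentStart e μ k) - e < beadPos μ i := by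
  rw [segmentStart, Nat.lt_succ_iff, le_max_iff] at hi
  rcases hi with hi | hi
  · have := beadPos_le_of_le μ hi
    omega
  · rcases Nat.eq_zero_or_pos i with rfl | hpos
    · have := beadPos_le_of_le μ (Nat.zero_le (segmentStart e μ k))
      omega
    · obtain ⟨⟨i', j'⟩, hm, hle⟩ := (Finset.le_sup_iff (by simpa using hpos)).1 hi
      rw [mem_segment] at hm
      have h1 := beadPos_le_of_le μ (show i ≤ i' from hle)
      have h2 := (lt_prof_sub_iff_beadPos μ ((j' : ℤ) - i') i').1 (by omega)
      omega

/-- The row in which the next segment starts begins at a content below those of the segment. -/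
theorem beadPos_segmentStart_succ (e : ℕ) (μ : YoungDiagram) (k : ℕ)
    (hg : gapPos μ 0 < beadPos μ (segmentStart e μ (k + 1))) :
    beadPos μ (segmentStart e μ (k + 1)) ≤ beadPos μ (segmentStart e μ k) - e := by
  by_contra! hlt
  have hs : segmentStart e μ (k + 1) = max (segmentStart e μ k)
    ((segment e μ (segmentStart e μ k)).sup Prod.fst) + 1 := rfl
  set s := segmentStart e μ (k + 1) with hsdef
  have h1 := beadPos_le_of_le μ (show segmentStart e μ k ≤ s by omega)
  have h2 := prof_beadPos μ s
  have h3 : 0 < prof μ (beadPos μ s) := (firstGap_prof μ).pos (prof_isProfile μ le_rfl) hg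
  have h4 : ((μ.rowLen s - 1 : ℕ) : ℤ) - s = beadPos μ s := by
    unfold beadPos
    omega
  have h5 : (s, μ.rowLen s - 1) ∈ segment e μ (segmentStart e μ k) := by
    rw [mem_segment, h4]
    omega
  have h6 : s ≤ (segment e μ (segmentStart e μ k)).sup Prod.fst :=
    Finset.le_sup (f := Prod.fst) h5
  omega

theorem le_segmentStart (e : ℕ) (μ : YoungDiagram) (k : ℕ) : k ≤ segmentStart e μ k := by
  induction k with
  | zero => exact Nat.zero_le _
  | succ k ih => rw [segmentStart]; omega

theorem gap_of_segmentStart {e : ℕ} (he : 0 < e) (μ : YoungDiagram) (k : ℕ) {z : ℤ}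
    (h1 : beadPos μ (segmentStart e μ (k + 1)) < z)
    (h2 : z ≤ beadPos μ (segmentStart e μ k) - e) : prof μ (z + 1) = prof μ z + 1 := by
  refine (prof_step μ z).resolve_left fun hb => ?_
  obtain ⟨i, rfl⟩ := exists_beadPos hb
  have h3 : i < segmentStart e μ (k + 1) := by
    by_contra! hle
    have := beadPos_le_of_le μ hle
    omega
  have := beadPos_of_lt_segmentStart he μ k h3
  omega

theorem gap_of_beadPos_zero (μ : YoungDiagram) {z : ℤ} (h1 : beadPos μ 0 < z) :
    prof μ (z + 1) = prof μ z + 1 := by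
  refine (prof_step μ z).resolve_left fun hb => ?_
  obtain ⟨i, rfl⟩ := exists_beadPos hb
  have := beadPos_le_of_le μ (Nat.zero_le i)
  omega

/-- The scan meets the beads at the beginnings of the segments. -/
theorem exists_scan_eq_segmentStart {e : ℕ} (he : 0 < e) (μ : YoungDiagram) (H : IsProfile N (prof μ))
    (k : ℕ) (hg : gapPos μ 0 < beadPos μ (segmentStart e μ k)) :
    ∃ i, (scan e (prof μ) N i).1 = beadPos μ (segmentStart e μ k) := by
  induction k with
  | zero =>
    refine exists_scan_eq_of_le ⟨0, rfl⟩ ?_ fun z hz _ => gap_of_beadPos_zero μ hz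
    exact (H.bead_lt
      (by rw [(prof_beadPos μ _).1, (prof_beadPos μ _).2])).le
  | succ k ih =>
    have h1 := beadPos_segmentStart_succ e μ k hg
    obtain ⟨i, hi⟩ := ih (by omega)
    refine exists_scan_eq_of_le (p := beadPos μ (segmentStart e μ k) - e) ⟨i + 1, ?_⟩ h1
      fun z hz hz' => gap_of_segmentStart he μ k hz hz'
    rw [scan_bead (by rw [hi, (prof_beadPos μ _).1, (prof_beadPos μ _).2]), hi]

/-- The positions skipped by the scan are the contents of the segments of the `e`-rim. -/
theorem mem_rimSet_prof {e : ℕ} (he : 0 < e) (μ : YoungDiagram) (H : IsProfile N (prof μ)) (q : ℤ) :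
    q ∈ rimSet e (prof μ) N (gapPos μ 0) ↔ gapPos μ 0 < q ∧
      ∃ k, q ≤ beadPos μ (segmentStart e μ k) ∧ beadPos μ (segmentStart e μ k) - e < q := by
  have hbead : ∀ i, prof μ (beadPos μ i + 1) = prof μ (beadPos μ i) := fun i => by
    rw [(prof_beadPos μ _).1, (prof_beadPos μ _).2]
  rw [mem_rimSet]
  refine and_congr_right fun hgq => ⟨fun hq => ?_, fun ⟨k, h1, h2⟩ => ?_⟩
  · by_contra! hno
    refine hq.2 ?_
    have hex : ∃ k, beadPos μ (segmentStart e μ k) < q := by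
      refine ⟨μ.colLen 0, ?_⟩
      have h1 := beadPos_le_of_le μ (le_segmentStart e μ (μ.colLen 0))
      have h2 : μ.rowLen (μ.colLen 0) = 0 := by
        by_contra h0
        have := YoungDiagram.mem_iff_lt_rowLen.2 (Nat.pos_of_ne_zero h0)
        have := YoungDiagram.mem_iff_lt_colLen.1 this
        omega
      unfold beadPos at h1
      unfold gapPos at hgq
      unfold beadPos
      rw [h2] at h1
      push_cast at *
      omega
    classical
    have hmin := fun m => Nat.find_min hex (m := m)
    have hk := Nat.find_spec hex
    rcases hfind : Nat.find hex with _ | k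
    · rw [hfind] at hk
      exact ⟨gap_of_beadPos_zero μ hk,
        exists_scan_eq_of_le ⟨0, rfl⟩ hq.1 fun z hz _ => gap_of_beadPos_zero μ (hk.trans hz)⟩
    · rw [hfind] at hk hmin
      have h1 := not_lt.1 (hmin k (Nat.lt_succ_self k))
      have h2 := hno k h1
      obtain ⟨i, hi⟩ := exists_scan_eq_segmentStart he μ H k (by omega)
      refine ⟨gap_of_segmentStart he μ k hk h2,
        exists_scan_eq_of_le (p := beadPos μ (segmentStart e μ k) - e) ⟨i + 1, ?_⟩ h2
          fun z hz hz' => gap_of_segmentStart he μ k (hk.trans hz) hz'⟩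
      rw [scan_bead (by rw [hi]; exact hbead _), hi]
  · have hb := hbead (segmentStart e μ k)
    refine ⟨by have := H.bead_lt hb; omega, fun ⟨hgap, j, hj⟩ => ?_⟩
    obtain ⟨i, hi⟩ := exists_scan_eq_segmentStart he μ H k (by omega)
    rcases h1.eq_or_lt with rfl | hlt
    · omega
    · have := scan_skip (e := e) (h := prof μ) (T := N) he (i := i) (by rw [hi]; exact hb) (j := j)
        (by rw [hj, hi]; exact h2)
      omega

theorem mem_eRim {e : ℕ} (he : 0 < e) (μ : YoungDiagram) (H : IsProfile N (prof μ)) (i j : ℕ) :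
    (i, j) ∈ eRim e μ ↔ (j : ℤ) + 1 = prof μ ((j : ℤ) - i) ∧
      (j : ℤ) - i ∈ rimSet e (prof μ) N (gapPos μ 0) := by
  rw [mem_rimSet_prof he μ H]
  simp only [eRim, Finset.mem_biUnion, Finset.mem_range, mem_segment]
  constructor
  · rintro ⟨k, -, h1, h2, h3⟩
    exact ⟨h1, h2, k, h3⟩
  · rintro ⟨h1, h2, k, h3⟩
    refine ⟨k, ?_, h1, h2, h3⟩
    -- a segment starting below the last row is empty
    by_contra! hk
    have h4 := (lt_prof_sub_iff_beadPos μ ((j : ℤ) - i) (segmentStart e μ k)).2 h3.1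
    have h5 := le_segmentStart e μ k
    have h6 := (mem_rim_iff μ i j).2 h1
    have h7 := YoungDiagram.mem_iff_lt_colLen.1 h6.1
    have h8 := μ.colLen_anti 0 j (Nat.zero_le j)
    omega

theorem prof_of_mem_rimSet (μ : YoungDiagram) (H : IsProfile N (prof μ)) {e : ℕ} (he : 0 < e) :
    ∀ q ∈ rimSet e (prof μ) N (gapPos μ 0), 0 < prof μ q ∧ q < prof μ q := by
  intro q hq
  obtain ⟨h1, k, h2, -⟩ := (mem_rimSet_prof he μ H q).1 hq
  have := (lt_prof_sub_iff_beadPos μ q _).2 h2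
  exact ⟨(firstGap_prof μ).pos (prof_isProfile μ le_rfl) h1, by omega⟩

theorem card_eRim {e : ℕ} (he : 0 < e) (μ : YoungDiagram) (H : IsProfile N (prof μ)) :
    (eRim e μ).card = (rimSet e (prof μ) N (gapPos μ 0)).card :=
  card_rim_contents μ _ _ (mem_eRim he μ H) (prof_of_mem_rimSet μ H he)

theorem prof_sdiff_eRim {e : ℕ} (he : 0 < e) {μ ν : YoungDiagram} (H : IsProfile N (prof μ))
    (hν : ν.cells = μ.cells \ eRim e μ) : prof ν = removeRim e (prof μ) N (gapPos μ 0) := by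
  funext q
  rw [prof_sdiff hν (mem_eRim he μ H) (prof_of_mem_rimSet μ H he)]
  rfl

theorem exists_sdiff_eRim {e : ℕ} (he : 0 < e) (μ : YoungDiagram) :
    ∃ ν : YoungDiagram, ν.cells = μ.cells \ eRim e μ := by
  have H := prof_isProfile μ le_rfl
  have Hr := removeRim_isProfile (e := e) H le_rfl (firstGap_prof μ)
  refine ⟨ofProf Hr, ?_⟩
  ext ⟨i, j⟩
  rw [YoungDiagram.mem_cells, mem_ofProf, Finset.mem_sdiff, YoungDiagram.mem_cells,
    mem_iff_lt_prof, mem_eRim he μ H]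
  unfold removeRim
  split_ifs with hm
  · simp only [hm, and_true]; omega
  · simp [hm]

end bridge

/-! ### Recovering a profile from its first gap, the size of its `e`-rim and what remains -/

section recover

variable {e N : ℕ} {h : ℤ → ℤ} {T g : ℤ}

theorem mem_rimSet_of_scan_bead (he : 0 < e) {i : ℕ} {q : ℤ}
    (hb : h ((scan e h T i).1 + 1) = h (scan e h T i).1) (h1 : (scan e h T i).1 - e < q)
    (h2 : q ≤ (scan e h T i).1) (hgq : g < q) : q ∈ rimSet e h T g := by
  have h3 := scan_le (h := h) (T := T) he i
  refine mem_rimSet.2 ⟨hgq, by omega, fun ⟨hgap, j, hj⟩ => ?_⟩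
  rcases h2.eq_or_lt with rfl | hlt
  · omega
  · have := scan_skip (e := e) (h := h) (T := T) he hb (j := j) (by omega)
    omega

theorem card_rimSet_above (he : 0 < e) (i : ℕ) (hi : g ≤ (scan e h T i).1) (H : IsProfile N h) :
    ((rimSet e h T g).filter ((scan e h T i).1 < ·)).card = e * (scan e h T i).2 := by
  induction i with
  | zero =>
    simp only [scan, mul_zero, Finset.card_eq_zero]
    refine Finset.filter_eq_empty_iff.2 fun q hq => ?_
    have := (mem_rimSet.1 hq).2.1
    omega
  | succ i ih =>
    rcases H.step (scan e h T i).1 with hb | hb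
    · rw [scan_bead hb] at hi ⊢
      simp only at hi ⊢
      have h1 : (rimSet e h T g).filter ((scan e h T i).1 - (e : ℤ) < ·) =
          (rimSet e h T g).filter ((scan e h T i).1 < ·) ∪
            Finset.Ioc ((scan e h T i).1 - (e : ℤ)) (scan e h T i).1 := by
        ext q
        simp only [Finset.mem_filter, Finset.mem_union, Finset.mem_Ioc]
        constructor
        · rintro ⟨h2, h3⟩
          rcases lt_or_ge (scan e h T i).1 q with h4 | h4
          exacts [Or.inl ⟨h2, h4⟩, Or.inr ⟨h3, h4⟩]
        · rintro (⟨h2, h3⟩ | ⟨h2, h3⟩)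
          · exact ⟨h2, by omega⟩
          · exact ⟨mem_rimSet_of_scan_bead he hb h2 h3 (by omega), h2⟩
      rw [h1, Finset.card_union_of_disjoint, ih (by omega), Int.card_Ioc,
        show (scan e h T i).1 - ((scan e h T i).1 - (e : ℤ)) = e by ring, Int.toNat_natCast]
      · ring
      · rw [Finset.disjoint_left]
        intro q h2 h3
        rw [Finset.mem_filter] at h2
        rw [Finset.mem_Ioc] at h3
        omega
    · rw [scan_gap hb] at hi ⊢
      simp only at hi ⊢
      rw [← ih (by omega)]
      congr 1
      refine Finset.filter_congr fun q hq => ⟨fun h2 => ?_, fun h2 => by omega⟩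
      by_contra hle
      obtain rfl : q = (scan e h T i).1 := by omega
      exact (mem_rimSet.1 hq).2.2 ⟨hb, i, rfl⟩

/-- The scan meets the position `g + a % e`, where `a` is the size of the `e`-rim: the blocks above it
consist of whole jumps of `e`, and everything between `g` and this position is on the `e`-rim. -/
theorem exists_scan_eq_base (he : 0 < e) (H : IsProfile N h) (hT : (N : ℤ) ≤ T)
    (hg : FirstGap h g) :
    ∃ i, (scan e h T i).1 = g + ((rimSet e h T g).card % e : ℕ) ∧
      ∀ q, g < q → q ≤ (scan e h T i).1 → q ∈ rimSet e h T g := by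
  classical
  have hgN := hg.le H
  have hex : ∃ i, (scan e h T (i + 1)).1 < g :=
    ⟨(T - g).toNat, by have := scan_le (h := h) (T := T) he ((T - g).toNat + 1); omega⟩
  have hlt := Nat.find_spec hex
  have hge : g ≤ (scan e h T (Nat.find hex)).1 := by
    rcases hf : Nat.find hex with _ | m
    · simp only [scan]; omega
    · exact not_lt.1 (Nat.find_min hex (m := m) (by omega))
  set i := Nat.find hex
  have hcard := card_rimSet_above he i hge H
  have hsub : ∀ q, g < q → q ≤ (scan e h T i).1 → q ∈ rimSet e h T g := by
    intro q h1 h2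
    rcases H.step (scan e h T i).1 with hb | hb
    · rw [scan_bead hb] at hlt
      exact mem_rimSet_of_scan_bead he hb (by simp only at hlt; omega) h2 h1
    · rw [scan_gap hb] at hlt
      simp only at hlt
      omega
  refine ⟨i, ?_, hsub⟩
  have h1 := Finset.card_filter_add_card_filter_not (s := rimSet e h T g)
    ((scan e h T i).1 < ·)
  have h2 : (rimSet e h T g).filter (fun q => ¬(scan e h T i).1 < q) =
      Finset.Ioc g (scan e h T i).1 := by
    ext q
    rw [Finset.mem_filter, Finset.mem_Ioc, not_lt]
    exact ⟨fun h3 => ⟨(mem_rimSet.1 h3.1).1, h3.2⟩, fun h3 => ⟨hsub q h3.1 h3.2, h3.2⟩⟩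
  have h3 : (scan e h T i).1 - g < e := by
    rcases H.step (scan e h T i).1 with hb | hb
    · rw [scan_bead hb] at hlt
      simp only at hlt
      omega
    · rw [scan_gap hb] at hlt
      simp only at hlt
      omega
  rw [hcard, h2, Int.card_Ioc] at h1
  rw [← h1, Nat.mul_add_mod, Nat.mod_eq_of_lt (by omega)]
  omega

/-- The scan can be traced back on the profile that remains: the scan has come to a position `z` by a
jump if and only if the remaining profile has a bead at `z`. -/
theorem scan_eq_of_succ (he : 0 < e) (H : IsProfile N h) (hg : FirstGap h g) (i : ℕ)
    (hi : g ≤ (scan e h T (i + 1)).1) :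
    (scan e h T i).1 = (scan e h T (i + 1)).1 +
      if removeRim e h T g ((scan e h T (i + 1)).1 + 1) =
        removeRim e h T g (scan e h T (i + 1)).1 then (e : ℤ) else 1 := by
  have hz : removeRim e h T g (scan e h T (i + 1)).1 = h ((scan e h T (i + 1)).1 + 1) - 1 := by
    rcases H.step (scan e h T (i + 1)).1 with hb | hb
    · rcases hi.eq_or_lt with heq | hlt
      · rw [← heq] at hb
        have := hg.gap
        omega
      · rw [removeRim_of_mem, hb]
        have := scan_le (h := h) (T := T) he (i + 1)
        exact mem_rimSet_of_scan_bead he hb (by omega) le_rfl hlt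
    · rw [removeRim_of_notMem, hb]
      · ring
      · exact fun hm => (mem_rimSet.1 hm).2.2 ⟨hb, i + 1, rfl⟩
  rcases H.step (scan e h T i).1 with hb | hb
  · have h1 := congrArg Prod.fst (scan_bead hb)
    simp only at h1
    rw [if_pos, h1]
    · ring
    · rw [hz, removeRim_of_mem]
      exact mem_rimSet_of_scan_bead he hb (by omega) (by omega) (by omega)
  · have h1 := congrArg Prod.fst (scan_gap hb)
    simp only at h1
    rw [if_neg, h1]
    · ring
    · rw [hz, removeRim_of_notMem]
      · omega
      · rw [h1, sub_add_cancel]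
        exact fun hm => (mem_rimSet.1 hm).2.2 ⟨hb, i, rfl⟩

/-- The kept positions can be read off from the positions of the scan alone. -/
theorem kept_iff (he : 1 < e) (H : IsProfile N h) (q : ℤ) :
    Kept e h T q ↔ ∃ j, (scan e h T j).1 = q ∧ (scan e h T (j + 1)).1 = q - 1 := by
  constructor
  · rintro ⟨hgap, j, rfl⟩
    exact ⟨j, rfl, by rw [scan_gap hgap]⟩
  · rintro ⟨j, rfl, hj⟩
    refine ⟨(H.step _).resolve_left fun hb => ?_, j, rfl⟩
    rw [scan_bead hb] at hj
    simp only at hj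
    omega

variable {h' : ℤ → ℤ}

/-- A profile is determined by its first gap, the size of its `e`-rim and what remains.  By
`exists_scan_eq_base` the first two determine the last position of the scan above the first gap, and
from there the scan can be traced back. -/
theorem eq_of_removeRim_eq (he : 1 < e) (H : IsProfile N h) (H' : IsProfile N h')
    (hT : (N : ℤ) ≤ T) (hg : FirstGap h g) (hg' : FirstGap h' g)
    (hcard : (rimSet e h T g).card = (rimSet e h' T g).card)
    (heq : removeRim e h T g = removeRim e h' T g) : h = h' := by
  have he0 : 0 < e := by omega
  obtain ⟨i, hi, hsub⟩ := exists_scan_eq_base he0 H hT hg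
  obtain ⟨i', hi', hsub'⟩ := exists_scan_eq_base he0 H' hT hg'
  rw [← hcard] at hi'
  have hA := scan_strictAnti (h := h) (T := T) he0
  have hA' := scan_strictAnti (h := h') (T := T) he0
  have hback : ∀ k, k ≤ i → k ≤ i' → (scan e h T (i - k)).1 = (scan e h' T (i' - k)).1 := by
    intro k
    induction k with
    | zero => intro _ _; simp only [Nat.sub_zero]; rw [hi, hi']
    | succ k ih =>
      intro h1 h2
      have h3 := ih (by omega) (by omega)
      have a1 : (scan e h T i).1 ≤ (scan e h T (i - k)).1 := hA.antitone (by omega)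
      have h4 := scan_eq_of_succ he0 H hg (T := T) (i - (k + 1)) (by
        rw [show i - (k + 1) + 1 = i - k by omega]; omega)
      have h5 := scan_eq_of_succ he0 H' hg' (T := T) (i' - (k + 1)) (by
        rw [show i' - (k + 1) + 1 = i' - k by omega]; omega)
      rw [show i - (k + 1) + 1 = i - k by omega] at h4
      rw [show i' - (k + 1) + 1 = i' - k by omega, ← heq, ← h3, ← h4] at h5
      exact h5.symm
  have hii : i = i' := by
    rcases lt_trichotomy i i' with hlt | hlt | hlt
    · exfalso
      have h1 := hback i le_rfl hlt.le
      have h2 := hA' (show 0 < i' - i by omega)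
      simp only [Nat.sub_self] at h1 h2
      rw [← h1] at h2
      simp [scan] at h2
    · exact hlt
    · exfalso
      have h1 := hback i' hlt.le le_rfl
      have h2 := hA (show 0 < i - i' by omega)
      simp only [Nat.sub_self] at h1 h2
      rw [h1] at h2
      simp [scan] at h2
  subst hii
  have hscan : ∀ j, j ≤ i → (scan e h T j).1 = (scan e h' T j).1 := fun j hj => by
    have := hback (i - j) (by omega) (by omega)
    rwa [show i - (i - j) = j by omega] at this
  have hrim : rimSet e h T g = rimSet e h' T g := by
    ext q
    by_cases hq : g < q ∧ q ≤ T
    · rw [← not_iff_not]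
      simp only [mem_rimSet, hq, true_and, not_not]
      constructor
      · intro hk
        obtain ⟨j, h1, h2⟩ := (kept_iff he H q).1 hk
        have hj : j < i := by
          by_contra hle
          have h3 : (scan e h T j).1 ≤ (scan e h T i).1 := hA.antitone (by omega)
          exact (mem_rimSet.1 (hsub q hq.1 (by omega))).2.2 hk
        exact (kept_iff he H' q).2
          ⟨j, by rw [← hscan j hj.le, h1], by rw [← hscan (j + 1) hj, h2]⟩
      · intro hk
        obtain ⟨j, h1, h2⟩ := (kept_iff he H' q).1 hk
        have hj : j < i := by
          by_contra hle
          have h3 : (scan e h' T j).1 ≤ (scan e h' T i).1 := hA'.antitone (by omega)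
          exact (mem_rimSet.1 (hsub' q hq.1 (by omega))).2.2 hk
        exact (kept_iff he H q).2
          ⟨j, by rw [hscan j hj.le, h1], by rw [hscan (j + 1) hj, h2]⟩
    · simp only [mem_rimSet]
      tauto
  funext q
  have := congrFun heq q
  unfold removeRim at this
  rw [hrim] at this
  exact sub_left_injective this

end recover

/-! ### Mullineux symbols -/

section symbol

variable {d e N : ℕ}

/-- A partition is determined by its Mullineux symbol. -/
theorem IsSymbol.injective (he : 1 < e) {μ ν : YoungDiagram} {l : List (ℕ × ℕ)}
    (hμ : IsSymbol e μ l) (hν : IsSymbol e ν l) : μ = ν := by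
  induction hμ generalizing ν with
  | nil => cases hν; rfl
  | @cons μ μ₁ l h0 h1 h2 ih =>
    generalize hl : ((eRim e μ).card, μ.colLen 0) :: l = l' at hν
    cases hν with
    | nil => cases hl
    | @cons _ ν₁ l₁ h0' h1' h2' =>
      obtain ⟨hp, rfl⟩ := List.cons.inj hl
      obtain ⟨hcard, hlen⟩ := Prod.mk.inj hp
      obtain rfl := ih h2'
      have he0 : 0 < e := by omega
      have H := prof_isProfile μ (le_max_left (bnd μ) (bnd ν))
      have H' := prof_isProfile ν (le_max_right (bnd μ) (bnd ν))
      have hgg : gapPos ν 0 = gapPos μ 0 := by unfold gapPos; rw [hlen]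
      have hg' := firstGap_prof ν
      rw [card_eRim he0 μ H, card_eRim he0 ν H', hgg] at hcard
      have h3 := (prof_sdiff_eRim he0 H h1).symm.trans (prof_sdiff_eRim he0 H' h1')
      rw [hgg] at hg' h3
      exact prof_injective (eq_of_removeRim_eq he H H' le_rfl (firstGap_prof μ) hg' hcard h3)

theorem eRim_nonempty (he : 0 < e) {μ : YoungDiagram} (hμ : μ ≠ ⊥) : (eRim e μ).card ≠ 0 := by
  have h0 : (0, 0) ∈ μ := by
    by_contra hno
    refine hμ ?_
    ext ⟨i, j⟩
    simp only [YoungDiagram.mem_cells, YoungDiagram.notMem_bot, iff_false]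
    exact fun hm => hno (μ.up_left_mem (Nat.zero_le i) (Nat.zero_le j) hm)
  have h1 := (mem_iff_lt_prof μ 0 0).1 h0
  simp only [Nat.cast_zero, sub_zero] at h1
  have h2 := (lt_prof_iff_gapPos μ 0 0).1 h1
  have h3 := (lt_prof_sub_iff_beadPos μ 0 0).1 (by simpa using h1)
  rw [card_eRim he μ (prof_isProfile μ le_rfl)]
  refine (Finset.card_pos.2 ⟨beadPos μ 0, ?_⟩).ne'
  rw [mem_rimSet_prof he μ (prof_isProfile μ le_rfl)]
  exact ⟨by omega, 0, le_rfl, by simp only [segmentStart]; omega⟩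

theorem card_lt_of_sdiff_eRim (he : 0 < e) {μ ν : YoungDiagram} (hμ : μ ≠ ⊥)
    (hν : ν.cells = μ.cells \ eRim e μ) : ν.card < μ.card := by
  have hsub : eRim e μ ⊆ μ.cells := by
    rintro ⟨i, j⟩ hm
    have := ((mem_eRim he μ (prof_isProfile μ le_rfl) i j).1 hm).1
    rw [YoungDiagram.mem_cells, mem_iff_lt_prof]
    omega
  change ν.cells.card < μ.cells.card
  have h1 := eRim_nonempty he hμ
  have h2 := Finset.card_le_card hsub
  rw [hν, Finset.card_sdiff_of_subset hsub]
  omega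

theorem eRim_bot (e : ℕ) : eRim e ⊥ = ∅ := by
  refine Finset.eq_empty_of_forall_notMem fun b hb => ?_
  simp [eRim, segment, rimHook] at hb

/-- Mates, that is, balanced partitions for `c = 0` and `c = 1` such that the first one and the
conjugate of the second one have the same data and area, have dual Mullineux symbols. -/
theorem exists_dual_symbols (hd : 1 < d) (he : 1 < e) {μ ν : YoungDiagram}
    (H : IsProfile N (prof μ)) (H' : IsProfile N (prof ν))
    (hbal : SlopeBalanced d e 0 (prof μ)) (hbal' : SlopeBalanced d e 1 (prof ν))
    (h0 : ∀ x y, rsum e (-(N + 1 : ℕ)) (N + 1 : ℕ) y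
      (flr d (prof μ) (fun p => prof ν (-p) + p) x) = 0) :
    ∃ l, IsSymbol e μ l ∧ IsSymbol e ν (dualSymbol e l) := by
  induction hn : μ.card using Nat.strong_induction_on generalizing μ ν with
  | _ n ih =>
    have he0 : 0 < e := by omega
    have hgμ := firstGap_prof μ
    have hgν := firstGap_prof ν
    obtain ⟨h1, h2, h3⟩ := rim_pair hd he H H' hbal hbal' hgμ hgν h0
    rw [← card_eRim he0 μ H] at h1 h2
    rw [← card_eRim he0 ν H'] at h1
    by_cases hμ : μ = ⊥
    · have hν : ν = ⊥ := by
        by_contra hν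
        refine eRim_nonempty he0 hν ?_
        rw [← h1, hμ, eRim_bot, Finset.card_empty]
      rw [hμ, hν]
      exact ⟨[], IsSymbol.nil, IsSymbol.nil⟩
    · have hν : ν ≠ ⊥ := by
        intro hν
        refine eRim_nonempty he0 hμ ?_
        rw [h1, hν, eRim_bot, Finset.card_empty]
      obtain ⟨μ₁, hμ₁⟩ := exists_sdiff_eRim he0 μ
      obtain ⟨ν₁, hν₁⟩ := exists_sdiff_eRim he0 ν
      have p1 := prof_sdiff_eRim he0 H hμ₁
      have p2 := prof_sdiff_eRim he0 H' hν₁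
      obtain ⟨l, hl, hl'⟩ := ih _ (hn ▸ card_lt_of_sdiff_eRim he0 hμ hμ₁) (μ := μ₁) (ν := ν₁)
        (by rw [p1]; exact removeRim_isProfile H le_rfl hgμ)
        (by rw [p2]; exact removeRim_isProfile H' le_rfl hgν)
        (by rw [p1]; exact hbal.removeRim hd he H le_rfl hgμ)
        (by rw [p2]; exact hbal'.removeRim hd he H' le_rfl hgν)
        (by rw [p1, p2]; exact h3) rfl
      refine ⟨_, IsSymbol.cons hμ hμ₁ hl, ?_⟩
      have h4 : ((eRim e ν).card, ν.colLen 0) =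
          ((eRim e μ).card, (eRim e μ).card + (if e ∣ (eRim e μ).card then 0 else 1) -
            μ.colLen 0) := by
        rw [h1]
        rw [h1] at h2
        refine Prod.ext rfl ?_
        unfold gapPos at h2
        simp only
        split_ifs at h2 ⊢ <;> omega
      have h5 := IsSymbol.cons hν hν₁ hl'
      rw [h4] at h5
      exact h5

end symbol

/-! ### The extreme elements of a minimal set -/

section main

variable {d e : ℕ}

/-- If the first row of the runner matrix has an entry `0`, then some runner has no bead of
class `1`. -/
theorem exists_runner_without_one (hd : 1 < d) {μ : YoungDiagram}
    (hR : ∃ y, runnerMatrix d e μ ⟨0, Nat.sub_pos_of_lt hd⟩ y = 0) :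
    ∃ y, ∀ q, (e : ℤ) ∣ q - y → prof μ (q + 1) = prof μ q → ¬(d : ℤ) ∣ prof μ q - 1 := by
  obtain ⟨y, hy⟩ := hR
  have H := prof_isProfile μ le_rfl
  have h1 := runnerMatrix_eq H ⟨0, Nat.sub_pos_of_lt hd⟩ y
  rw [hy] at h1
  refine ⟨(y : ℕ), fun q hq hb hdv => ?_⟩
  have h2 := H.bead_lt hb
  rcases lt_or_ge q (-(bnd μ : ℤ)) with hlt | hge
  · rw [H.left q hlt.le, zero_sub, dvd_neg] at hdv
    exact not_dvd_one hd hdv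
  · have h3 := (Finset.sum_eq_zero_iff_of_nonneg fun q _ => beadInd_nonneg d (prof μ) _ q).1 h1.symm
      q (by rw [Finset.mem_filter, Finset.mem_Ico]; exact ⟨⟨hge, h2⟩, hq⟩)
    unfold beadInd at h3
    rw [if_pos ⟨hb, by simpa using hdv⟩] at h3
    exact one_ne_zero h3

/-- In the balanced case, the conjugate of the least element is the Mullineux image of the greatest
one. -/
theorem exists_mullineuxImage (hd : 1 < d) (he : 1 < e) (hcop : Nat.Coprime d e)
    {γ lam : YoungDiagram} {w : ℕ} {R : Matrix (Fin (d - 1)) (Fin e) ℕ}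
    (hR : ∃ y, R ⟨0, Nat.sub_pos_of_lt hd⟩ y = 0) (hlam : HasCoreWeight e lam γ w)
    (hlamR : runnerMatrix d e lam = R) (hb : BeadsFirst d e (prof lam))
    (hbal : IsBalanced d e lam) :
    ∃ κ, IsUniqueDomMinimal (minimalSet d e γ R) κ ∧ IsMullineuxImage e lam κ.transpose := by
  have hd0 : 0 < d := by omega
  have he0 : 0 < e := by omega
  have hbal' := isBalanced_iff.1 hbal
  have hz := exists_runner_without_one hd (hlamR ▸ hR)
  have hs0 : SlopeBalanced d e 0 (prof lam) := fun p q h1 h2 h3 h4 => by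
    simpa using hbal' p q h1 h2 h3 h4
  have H := prof_isProfile lam le_rfl
  obtain ⟨k, W, HW, Hk, hdata, hgl⟩ := exists_gapsLast hd he0 hcop H hbal' hz
  set κ := ofProf Hk with hκ
  have hpκ : prof κ = k := prof_ofProf Hk
  rw [← hpκ] at Hk hdata hgl
  obtain ⟨⟨w', hκw⟩, hκR⟩ := hdata.core hd0 he0 HW Hk hlam
  rw [hlamR] at hκR
  have hmin := isUniqueDomMinimal_of_gapsLast hd0 he0 hcop hκw hκR.symm hgl
  have hmax := isUniqueDomMaximal_of_beadsFirst hd0 he0 hcop hlam hlamR hb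
  -- a common window
  set N := max (bnd lam) (max (bnd κ) (bnd κ.transpose)) with hN
  have Hl := prof_isProfile lam (show bnd lam ≤ N by omega)
  have Hκ := prof_isProfile κ (show bnd κ ≤ N by omega)
  have Hν := prof_isProfile κ.transpose (show bnd κ.transpose ≤ N by omega)
  have hT := fun M (HM : N ≤ M) =>
    rsum_flr_eq_zero hd0 he0 hcop hmax.1.1 hmin.1.1 (Hl.weaken HM) (Hκ.weaken HM)
  have hanti := fun p q h1 h2 h3 h4 =>
    antibalanced_of_balanced hd0 he0 Hl Hκ (hT N le_rfl) hbal' hgl (p := p) (q := q) h1 h2 h3 h4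
  have hpν : prof κ.transpose = fun p => prof κ (-p) + p := funext (prof_transpose κ)
  refine ⟨κ, hmin, isRegular_of_prof he0 (hs0.regular hd he0 H hz), ?_, ?_⟩
  · refine isRegular_of_prof he0 fun q hq => ?_
    rw [prof_transpose] at hq ⊢
    rw [prof_transpose]
    exact regular_of_antibalanced hd hcop Hκ hanti he0 q hq
  · refine exists_dual_symbols hd he Hl Hν hs0 (hpν ▸ slopeBalanced_transpose hanti) ?_
    have h1 : (fun p => prof κ.transpose (-p) + p) = prof κ := by
      funext p
      rw [prof_transpose, neg_neg, neg_add_cancel_right]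
    rw [h1]
    exact hT (N + 1) (Nat.le_succ N)

theorem IsMullineuxImage.unique (he : 1 < e) {lam ν ν' : YoungDiagram}
    (h : IsMullineuxImage e lam ν) (h' : IsMullineuxImage e lam ν') : ν = ν' := by
  obtain ⟨-, -, l, h1, h2⟩ := h
  obtain ⟨-, -, l', h1', h2'⟩ := h'
  have hl : l = l' := by
    clear h2 h2'
    induction h1 generalizing l' with
    | nil => cases h1' with
      | nil => rfl
      | cons h0 => exact absurd rfl h0
    | @cons μ ν₁ l h0 hν h ih =>
      cases h1' with
      | nil => exact absurd rfl h0
      | @cons _ ν₂ l₂ h0' hν' h' =>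
        obtain rfl : ν₁ = ν₂ := YoungDiagram.ext (hν.trans hν'.symm)
        rw [ih _ h']
  subst hl
  exact h2.injective he h2'

theorem mullineuxMap_eq (he : 1 < e) {lam ν : YoungDiagram} (h : IsMullineuxImage e lam ν) :
    mullineuxMap e lam = ν := by
  have hex : ∃ ν, IsMullineuxImage e lam ν := ⟨ν, h⟩
  rw [mullineuxMap, dif_pos hex]
  exact hex.choose_spec.unique he h

end main

end Mullineux

theorem mainTheorem2 (d e : ℕ) (hd : 1 < d) (hde : d < e) (hcop : Nat.Coprime d e)
    (γ : YoungDiagram) (hγ : Mullineux.IsCore e γ)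
    (R : Matrix (Fin (d - 1)) (Fin e) ℕ) (hR : ∃ y, R ⟨0, Nat.sub_pos_of_lt hd⟩ y = 0) :
    ∃ lam : YoungDiagram,
      Mullineux.IsUniqueDomMaximal (Mullineux.minimalSet d e γ R) lam ∧
      (Mullineux.IsBalanced d e lam →
        Mullineux.IsRegular e lam ∧
        (∃! ν : YoungDiagram, Mullineux.IsMullineuxImage e lam ν) ∧
        Mullineux.IsUniqueDomMinimal (Mullineux.minimalSet d e γ R)
          (Mullineux.mullineuxMap e lam).transpose) := by
  have he : 1 < e := hd.trans hde
  obtain ⟨lam, w, hw, hlamR, hb⟩ :=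
    Mullineux.exists_beadsFirst (by omega) (by omega) hcop hγ R
  refine ⟨lam, Mullineux.isUniqueDomMaximal_of_beadsFirst (by omega) (by omega) hcop hw hlamR hb,
    fun hbal => ?_⟩
  obtain ⟨κ, hmin, him⟩ := Mullineux.exists_mullineuxImage hd he hcop hR hw hlamR hb hbal
  refine ⟨him.1, ⟨_, him, fun ν hν => hν.unique he him⟩, ?_⟩
  rw [Mullineux.mullineuxMap_eq he him, YoungDiagram.transpose_transpose]
  exact hmin
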